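/- **Syntax.** Fix a set $B$ of base types. Types are generated by $\to$ from individuals $\iota$, the elements of $B$, and the types $h$ (positive formulas), $a$ (atoms), $r$ (rigid atoms), $p$ (programs), $g$ (goals), with inclusions $r\subseteq a\subseteq h\subseteq g$ and $r\subseteq p$. *Argument types* are built by $\to$ from $\iota$, $B$, $h$. A *variable type* is an argument type or $\alpha_1\to\dots\to\alpha_n\to a$ with argument types $\alpha_i$; a *constant type* is a variable type or $\alpha_1\to\dots\to\alpha_n\to r$ with argument types $\alpha_i$. For each level $i\in\mathbb N$ and each type there are countably many logic variables of that level (variable types) and countably many non-logical constants (constant types). The logical constants are $\top_g,\top_h$; $\wedge_p,\wedge_g,\wedge_h$; $\vee_g,\vee_h$; $\supset_g\colon p\to g\to g$; $\supset_p\colon g\to r\to p$; and, for each variable type $\alpha$, $\Sigma_g,\Sigma_h,\Pi_g,\Pi_p$. Terms are simply typed $\lambda$-terms, abstracting over variables of variable type, modulo $\beta\eta$-equivalence and modulo the identification of a formula of type $h$ with the corresponding goal. We write $\exists x\,G=\Sigma_g(\lambda x.G)$, $\forall x\,G=\Pi_g(\lambda x.G)$, $\forall x\,D=\Pi_p(\lambda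 x.D)$. A term is *over* $\mathcal U_i$ if all free variables and constants of its normal form have level at most $i$. A *substitution* $\theta$ maps variables to terms of the same type, has finite support, and sends each variable of level $i$ to a term over $\mathcal U_i$. $\theta\varphi$ means first $\theta$, then $\varphi$. A *state* $\langle i;\mathcal P;G\rangle$ consists of a level $i$, a finite sequence $\mathcal P$ of terms of type $p$ and a goal $G$ of type $g$, all over $\mathcal U_i$. A *state vector* $\mathbf A=A_1\otimes\dots\otimes A_n$ is a finite sequence of states; $\square$ is the empty one; $\mathbf A\theta$ is componentwise application. The *elaboration* of $D$ is: $\{A\}$ for a rigid atom $A$; $\{G\supset A\}$ for $G\supset A$; the union of those of $D$ and $D'$ for $D\wedge D'$; and $\{\forall x\,K\mid K\text{ in the elaboration of }D\}$ for $\forall x\,D$. **Resolution.** One step replaces one state of a vector as follows, and applies its substitution $\theta$ to all other states. *Null*: $\langle i;\mathcal P;\top_g\rangle$ is deleted, $\theta=\mathrm{id}$. *True*: if $G$ is an atomic goal (its head is a variable or a non-logical constant), $\theta\neq\mathrm{id}$ and $G\theta=\top_g$, then $\langle i;\mathcal P;G\rangle$ becomes $\langle i;\mathcal P\theta;\top_g\rangle$.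 *Backchain*: $\langle i;\mathcal P;A'\rangle$, with $A'$ a rigid atom, becomes $\langle i;\mathcal P\theta;G\theta\rangle$ if $\forall\bar x(G\supset A)$ is in the elaboration of a member of $\mathcal P$, with $\bar x$ renamed to distinct fresh variables of level $\le i$, and $A'\theta=A\theta$. *Axiom*: the same with a fact $\forall\bar x\,A$; the state is deleted. *Or*: $G_1\vee G_2$ becomes $G_1$, or becomes $G_2$. *And*: $\langle i;\mathcal P;G_1\wedge G_2\rangle$ becomes $\langle i;\mathcal P;G_1\rangle\otimes\langle i;\mathcal P;G_2\rangle$. *Instance*: $\exists x\,G$ becomes $G[t/x]$, for any $t$ over $\mathcal U_i$. *Augment*: $\langle i;\mathcal P;D\supset G\rangle$ becomes $\langle i;\mathcal P,D;G\rangle$. *Generic*: $\langle i;\mathcal P;\forall x\,G\rangle$ becomes $\langle i+1;\mathcal P;G[c/x]\rangle$, with $c$ a fresh constant of level $i+1$. (In the last five rules $\theta=\mathrm{id}$.) Fresh means: not having occurred so far in the derivation, its substitutions and renamings included. *Enriched* ($*$-) resolution has in addition *Sub*: $\langle i;\mathcal P;G\rangle$ becomes $\langle i;\mathcal P\theta;G\theta\rangle$,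 for an arbitrary substitution $\theta$. $\mathbf A$ *resolves to* $\mathbf A'$ *with answer* $\theta$ if there is a finite sequence of steps from $\mathbf A$ to $\mathbf A'$ and $\theta$ is the composition of their substitutions, restricted to the free variables of $\mathbf A$. **Uniform algebras.** A *uniform applicative structure* $M$ has carriers $D_{i,\tau}$ for all levels $i$ and types $\tau$; extensional application $D_{i,\alpha\to\beta}\times D_{i,\alpha}\to D_{i,\beta}$; a functorial system of injective inclusions $D_{i,\tau}\to D_{j,\tau}$ ($i\le j$) commuting with application; injective maps $D_{i,\sigma}\to D_{i,\tau}$ for the basic inclusions $\sigma\subseteq\tau$ ($r\subseteq a$, $a\subseteq h$, $h\subseteq g$, $r\subseteq p$); an element of $D_{i,\tau}$ for each constant of level $i$ and type $\tau$, and of $D_{0,\tau}$ for each logical constant (considered at every level through the inclusions); and on each $D_{i,p}$ a preorder $\preceq$ and an element $\top_p$ with $\top_p\wedge_p d=d=d\wedge_p\top_p$, $d\preceq d\wedge_p d'$, $d\wedge_p d'\preceq d'\wedge_p d$, and $f d\preceq\Pi_p f$. Let $\Omega$ be a distributive lattice with top $\top$. An *$\Omega$-valuation* is a family $I_i\colon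 D_{i,p}\times D_{i,g}\to\Omega$ such that $I_i(x,x)=\top$ for $x\in D_{i,r}$; $I_i(d,e)\le I_{i+1}(d,e)$; $I_i(d,\top_g)=\top$; $I_i(d,e\wedge e')=I_i(d,e)\wedge I_i(d,e')$; $I_i(d,e\vee e')=I_i(d,e)\vee I_i(d,e')$; $I_i(d,d'\supset e)=I_i(d\wedge_p d',e)$; $I_i(d,\Sigma_g f)=\bigvee_{x\in D_{i,\alpha}}I_i(d,fx)$ and $I_i(d,\Pi_g f)=\bigwedge_{x\in D_{i,\alpha}}I_i(d,fx)$ (these bounds exist); $d\preceq d'$ implies $I_i(d,e)\le I_i(d',e)$; and $(e\supset_p x)\preceq d$ implies $I_i(d,e)\le I_i(d,x)$ for $x\in D_{i,r}$. An assignment $\varphi$ sends each variable of level $i$ and type $\tau$ into $D_{i,\tau}$. A *uniform algebra* over $\Omega$ is such an $M$ with a valuation and an interpretation assigning, to each term $t$ of type $\tau$ over $\mathcal U_i$ and each $\varphi$, an element $t_\varphi\in D_{i,\tau}$, compatibly with the inclusions, which interprets variables, constants, inclusions and application as given and satisfies $(\lambda x.t)_\varphi\,d=(t[y/x])_{\varphi[d/y]}$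 for $d\in D_{i,\alpha}$ and fresh $y$ of level $i$. The *truth value* $[\![\mathbf A]\!]_\varphi\in\Omega$ of a state vector is the meet over its states $\langle i;\mathcal P;G\rangle$ of $I_i((\bigwedge\mathcal P)_\varphi,G_\varphi)$, where $\bigwedge(D_1,\dots,D_n)=(\cdots(\top_p\wedge_p D_1)\cdots)\wedge_p D_n$. **Corollary ($*$-deduction is conservative).** Let $\mathbf A$ be a state vector. 1. (Soundness.) If $\mathbf A$ $*$-resolves to $\mathbf A'$ with answer $\theta$, then for every distributive lattice $\Omega$ with top: if $[\![\mathbf A']\!]_\varphi=\top$ in all uniform algebras over $\Omega$ for all assignments $\varphi$, then $[\![\mathbf A\theta]\!]_\varphi=\top$ in all uniform algebras over $\Omega$ for all $\varphi$. 2. In particular, if $\mathbf A$ $*$-resolves to $\square$ with answer $\theta$, then $[\![\mathbf A\theta]\!]_\varphi=\top$ in every uniform algebra, for every $\Omega$ and every $\varphi$. 3. If $\mathbf A$ $*$-resolves to $\mathbf A'$ with answer $\theta$ without use of the rule Generic, then $[\![\mathbf A']\!]_\varphi\le[\![\mathbf A\theta]\!]_\varphi$ in every uniform algebra, for every $\Omega$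 and every $\varphi$. 4. (Conservativity.) If $\mathbf A$ $*$-resolves to $\square$ with the identity answer, then $\mathbf A$ resolves to $\square$, without the rule Sub, with the identity answer. 5. (Lifting.) Let $\theta$ be a substitution. If $\mathbf A\theta$ $*$-resolves to $\mathbf A'$ with answer $\varphi$, and either $\mathbf A'=\square$ or the constants introduced by the Generic steps of that resolution occur neither in $\mathbf A$ nor in $\theta$ restricted to the free variables of $\mathbf A$, then $\mathbf A$ $*$-resolves to the same $\mathbf A'$ with answer $\theta\varphi$ restricted to the free variables of $\mathbf A$. -/

import Mathlib

universe u v w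

namespace UCTT

/-! ### Types, constants and variables -/

/-- Types over a set `B` of user-defined base types: individuals `iota`, positive formulas `h`,
atoms `a`, rigid atoms `r`, programs `p`, goals `g`, and function types. -/
inductive Ty (B : Type u) : Type u
  | iota : Ty B
  | base (b : B) : Ty B
  | h : Ty B
  | a : Ty B
  | r : Ty B
  | p : Ty B
  | g : Ty B
  | arr (α β : Ty B) : Ty B

section Types

variable {B : Type u}

/-- Argument types: built by arrows from the non-logical base types and `h`. -/
def Ty.ArgTy : Ty B → Prop
  | .iota => True
  | .base _ => True
  | .h => True
  | .arr α β => α.ArgTy ∧ β.ArgTy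
  | _ => False

/-- Types of variables: argument types, and `α₁ → ⋯ → αₙ → a` with argument types `αᵢ`. -/
def Ty.VarTy : Ty B → Prop
  | .a => True
  | .arr α β => α.ArgTy ∧ β.VarTy
  | .iota => True
  | .base _ => True
  | .h => True
  | _ => False

/-- Types of non-logical constants: those of variables, and `α₁ → ⋯ → αₙ → r`. -/
def Ty.ConTy : Ty B → Prop
  | .r => True
  | .a => True
  | .arr α β => α.ArgTy ∧ β.ConTy
  | .iota => True
  | .base _ => True
  | .h => True
  | _ => False

/-- Logic (free) variables: countably many for each level and each type of variables. -/
structure LVar (τ : Ty B) : Type where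
  level : ℕ
  idx : ℕ
  ok : τ.VarTy

/-- Non-logical constants: countably many for each level and each type of constants. -/
structure Con (τ : Ty B) : Type where
  level : ℕ
  idx : ℕ
  ok : τ.ConTy

/-- Logical constants. -/
inductive LCon : Ty B → Type u
  | topG : LCon .g
  | topH : LCon .h
  | andP : LCon (.arr .p (.arr .p .p))
  | andG : LCon (.arr .g (.arr .g .g))
  | andH : LCon (.arr .h (.arr .h .h))
  | orG : LCon (.arr .g (.arr .g .g))
  | orH : LCon (.arr .h (.arr .h .h))
  | impG : LCon (.arr .p (.arr .g .g))
  | impP : LCon (.arr .g (.arr .r .p))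
  | sigG {α : Ty B} (hα : α.VarTy) : LCon (.arr (.arr α .g) .g)
  | sigH {α : Ty B} (hα : α.VarTy) : LCon (.arr (.arr α .h) .h)
  | piG {α : Ty B} (hα : α.VarTy) : LCon (.arr (.arr α .g) .g)
  | piP {α : Ty B} (hα : α.VarTy) : LCon (.arr (.arr α .p) .p)

/-- The basic inclusions between the subtypes of the type of formulas. -/
inductive Incl : Ty B → Ty B → Type u
  | ra : Incl .r .a
  | ah : Incl .a .h
  | hg : Incl .h .g
  | rp : Incl .r .p

/-- Variables in the context `Γ`: de Bruijn indices for the bound variables listed in `Γ`,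
and the logic variables. -/
inductive Vr : List (Ty B) → Ty B → Type u
  | free {τ : Ty B} (x : LVar τ) : Vr [] τ
  | zero {Γ : List (Ty B)} {α : Ty B} : Vr (α :: Γ) α
  | succ {Γ : List (Ty B)} {α τ : Ty B} (y : Vr Γ τ) : Vr (α :: Γ) τ

/-- Raw typed terms in the context `Γ` of bound variables. -/
inductive Tm : List (Ty B) → Ty B → Type u
  | var {Γ : List (Ty B)} {τ : Ty B} (y : Vr Γ τ) : Tm Γ τ
  | con {Γ : List (Ty B)} {τ : Ty B} (c : Con τ) : Tm Γ τ
  | lcon {Γ : List (Ty B)} {τ : Ty B} (k : LCon τ) : Tm Γ τ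
  | inc {Γ : List (Ty B)} {σ τ : Ty B} (e : Incl σ τ) (t : Tm Γ σ) : Tm Γ τ
  | app {Γ : List (Ty B)} {α β : Ty B} (t : Tm Γ (.arr α β)) (s : Tm Γ α) : Tm Γ β
  | lam {Γ : List (Ty B)} {α β : Ty B} (hα : α.VarTy) (t : Tm (α :: Γ) β) : Tm Γ (.arr α β)

/-- A logic variable together with its type. -/
abbrev AVar (B : Type u) : Type u := Σ τ : Ty B, LVar τ

/-- A non-logical constant together with its type. -/
abbrev ACon (B : Type u) : Type u := Σ τ : Ty B, Con τ

/-! ### Renaming and substitution on raw terms -/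

/-- Lifting of a renaming under a binder. -/
def liftRen {Γ Δ : List (Ty B)} (ρ : ∀ τ, Vr Γ τ → Vr Δ τ) (α : Ty B) :
    ∀ τ, Vr (α :: Γ) τ → Vr (α :: Δ) τ
  | _, .zero => .zero
  | _, .succ y => .succ (ρ _ y)

def Tm.ren : ∀ {Γ Δ : List (Ty B)} {τ : Ty B}, (∀ σ, Vr Γ σ → Vr Δ σ) → Tm Γ τ → Tm Δ τ
  | _, _, _, ρ, .var y => .var (ρ _ y)
  | _, _, _, _, .con c => .con c
  | _, _, _, _, .lcon k => .lcon k
  | _, _, _, ρ, .inc e t => .inc e (t.ren ρ)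
  | _, _, _, ρ, .app t s => .app (t.ren ρ) (s.ren ρ)
  | _, _, _, ρ, .lam hα t => .lam hα (t.ren (liftRen ρ _))

/-- Weakening of a term by one bound variable. -/
def Tm.wk {Γ : List (Ty B)} {τ : Ty B} (α : Ty B) (t : Tm Γ τ) : Tm (α :: Γ) τ :=
  t.ren (fun _ y => .succ y)

/-- Lifting of a substitution under a binder. -/
def liftSub {Γ Δ : List (Ty B)} (s : ∀ τ, Vr Γ τ → Tm Δ τ) (α : Ty B) :
    ∀ τ, Vr (α :: Γ) τ → Tm (α :: Δ) τ
  | _, .zero => .var .zero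
  | _, .succ y => (s _ y).wk α

/-- Simultaneous capture-avoiding substitution. -/
def Tm.bind : ∀ {Γ Δ : List (Ty B)} {τ : Ty B}, (∀ σ, Vr Γ σ → Tm Δ σ) → Tm Γ τ → Tm Δ τ
  | _, _, _, s, .var y => s _ y
  | _, _, _, _, .con c => .con c
  | _, _, _, _, .lcon k => .lcon k
  | _, _, _, s, .inc e t => .inc e (t.bind s)
  | _, _, _, s, .app t t' => .app (t.bind s) (t'.bind s)
  | _, _, _, s, .lam hα t => .lam hα (t.bind (liftSub s _))

/-- The substitution replacing the innermost bound variable by `t`. -/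
def instSub {Γ : List (Ty B)} {α : Ty B} (t : Tm Γ α) : ∀ τ, Vr (α :: Γ) τ → Tm Γ τ
  | _, .zero => t
  | _, .succ y => .var y

theorem liftRen_comp {Γ Δ Θ : List (Ty B)} (ρ : ∀ τ, Vr Γ τ → Vr Δ τ)
    (ρ' : ∀ τ, Vr Δ τ → Vr Θ τ) (α : Ty B) :
    (fun τ y => liftRen ρ' α τ (liftRen ρ α τ y)) = liftRen (fun τ y => ρ' τ (ρ τ y)) α := by
  funext τ y
  cases y <;> rfl

theorem Tm.ren_ren {Γ : List (Ty B)} {τ : Ty B} (t : Tm Γ τ) :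
    ∀ {Δ Θ : List (Ty B)} (ρ : ∀ σ, Vr Γ σ → Vr Δ σ) (ρ' : ∀ σ, Vr Δ σ → Vr Θ σ),
      (t.ren ρ).ren ρ' = t.ren (fun σ y => ρ' σ (ρ σ y)) := by
  induction t with
  | var y => intros; rfl
  | con c => intros; rfl
  | lcon k => intros; rfl
  | inc e t ih => intros; simp only [Tm.ren, ih]
  | app t s iht ihs => intros; simp only [Tm.ren, iht, ihs]
  | lam hα t ih => intros; simp only [Tm.ren, ih, liftRen_comp]

theorem Tm.ren_wk {Γ Δ : List (Ty B)} {τ : Ty B} (t : Tm Γ τ) (ρ : ∀ σ, Vr Γ σ → Vr Δ σ)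
    (α : Ty B) : (t.wk α).ren (liftRen ρ α) = (t.ren ρ).wk α := by
  simp only [Tm.wk, Tm.ren_ren]
  rfl

theorem liftSub_ren {Γ Δ Θ : List (Ty B)} (ρ : ∀ τ, Vr Γ τ → Vr Δ τ)
    (s : ∀ τ, Vr Δ τ → Tm Θ τ) (α : Ty B) :
    (fun τ y => liftSub s α τ (liftRen ρ α τ y)) = liftSub (fun τ y => s τ (ρ τ y)) α := by
  funext τ y
  cases y <;> rfl

theorem Tm.bind_ren {Γ : List (Ty B)} {τ : Ty B} (t : Tm Γ τ) :
    ∀ {Δ Θ : List (Ty B)} (ρ : ∀ σ, Vr Γ σ → Vr Δ σ) (s : ∀ σ, Vr Δ σ → Tm Θ σ),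
      (t.ren ρ).bind s = t.bind (fun σ y => s σ (ρ σ y)) := by
  induction t with
  | var y => intros; rfl
  | con c => intros; rfl
  | lcon k => intros; rfl
  | inc e t ih => intros; simp only [Tm.ren, Tm.bind, ih]
  | app t s iht ihs => intros; simp only [Tm.ren, Tm.bind, iht, ihs]
  | lam hα t ih => intros; simp only [Tm.ren, Tm.bind, ih, liftSub_ren]

theorem ren_liftSub {Γ Δ Θ : List (Ty B)} (s : ∀ τ, Vr Γ τ → Tm Δ τ)
    (ρ : ∀ τ, Vr Δ τ → Vr Θ τ) (α : Ty B) :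
    (fun τ y => (liftSub s α τ y).ren (liftRen ρ α)) = liftSub (fun τ y => (s τ y).ren ρ) α := by
  funext τ y
  cases y with
  | zero => rfl
  | succ y => exact Tm.ren_wk _ _ _

theorem Tm.ren_bind {Γ : List (Ty B)} {τ : Ty B} (t : Tm Γ τ) :
    ∀ {Δ Θ : List (Ty B)} (s : ∀ σ, Vr Γ σ → Tm Δ σ) (ρ : ∀ σ, Vr Δ σ → Vr Θ σ),
      (t.bind s).ren ρ = t.bind (fun σ y => (s σ y).ren ρ) := by
  induction t with
  | var y => intros; rfl
  | con c => intros; rfl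
  | lcon k => intros; rfl
  | inc e t ih => intros; simp only [Tm.ren, Tm.bind, ih]
  | app t s iht ihs => intros; simp only [Tm.ren, Tm.bind, iht, ihs]
  | lam hα t ih => intros; simp only [Tm.ren, Tm.bind, ih, ren_liftSub]

theorem Tm.bind_wk {Γ Δ : List (Ty B)} {τ : Ty B} (t : Tm Γ τ) (s : ∀ σ, Vr Γ σ → Tm Δ σ)
    (α : Ty B) : (t.wk α).bind (liftSub s α) = (t.bind s).wk α := by
  simp only [Tm.wk, Tm.bind_ren, Tm.ren_bind]
  rfl

theorem liftSub_comp {Γ Δ Θ : List (Ty B)} (s : ∀ τ, Vr Γ τ → Tm Δ τ)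
    (s' : ∀ τ, Vr Δ τ → Tm Θ τ) (α : Ty B) :
    (fun τ y => (liftSub s α τ y).bind (liftSub s' α)) =
      liftSub (fun τ y => (s τ y).bind s') α := by
  funext τ y
  cases y with
  | zero => rfl
  | succ y => exact Tm.bind_wk _ _ _

theorem Tm.bind_bind {Γ : List (Ty B)} {τ : Ty B} (t : Tm Γ τ) :
    ∀ {Δ Θ : List (Ty B)} (s : ∀ σ, Vr Γ σ → Tm Δ σ) (s' : ∀ σ, Vr Δ σ → Tm Θ σ),
      (t.bind s).bind s' = t.bind (fun σ y => (s σ y).bind s') := by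
  induction t with
  | var y => intros; rfl
  | con c => intros; rfl
  | lcon k => intros; rfl
  | inc e t ih => intros; simp only [Tm.bind, ih]
  | app t s iht ihs => intros; simp only [Tm.bind, iht, ihs]
  | lam hα t ih => intros; simp only [Tm.bind, ih, liftSub_comp]

theorem liftSub_var (Γ : List (Ty B)) (α : Ty B) :
    liftSub (fun τ (y : Vr Γ τ) => Tm.var y) α = fun _ y => Tm.var y := by
  funext τ y
  cases y <;> rfl

theorem Tm.bind_var {Γ : List (Ty B)} {τ : Ty B} (t : Tm Γ τ) :
    t.bind (fun _ y => .var y) = t := by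
  induction t with
  | var y => rfl
  | con c => rfl
  | lcon k => rfl
  | inc e t ih => simp only [Tm.bind, ih]
  | app t s iht ihs => simp only [Tm.bind, iht, ihs]
  | lam hα t ih => simp only [Tm.bind, liftSub_var, ih]

/-! ### Convertibility -/

/-- `λ`-equivalence: `β`- and `η`-conversion, and the identification of a positive formula with
the goal formula it is included as. -/
inductive Conv : ∀ {Γ : List (Ty B)} {τ : Ty B}, Tm Γ τ → Tm Γ τ → Prop
  | refl {Γ : List (Ty B)} {τ : Ty B} (t : Tm Γ τ) : Conv t t
  | symm {Γ : List (Ty B)} {τ : Ty B} {t t' : Tm Γ τ} : Conv t t' → Conv t' t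
  | trans {Γ : List (Ty B)} {τ : Ty B} {t t' t'' : Tm Γ τ} : Conv t t' → Conv t' t'' → Conv t t''
  | inc {Γ : List (Ty B)} {σ τ : Ty B} (e : Incl σ τ) {t t' : Tm Γ σ} :
      Conv t t' → Conv (.inc e t) (.inc e t')
  | app {Γ : List (Ty B)} {α β : Ty B} {t t' : Tm Γ (.arr α β)} {s s' : Tm Γ α} :
      Conv t t' → Conv s s' → Conv (.app t s) (.app t' s')
  | lam {Γ : List (Ty B)} {α β : Ty B} (hα : α.VarTy) {t t' : Tm (α :: Γ) β} :
      Conv t t' → Conv (.lam hα t) (.lam hα t')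
  | beta {Γ : List (Ty B)} {α β : Ty B} (hα : α.VarTy) (t : Tm (α :: Γ) β) (s : Tm Γ α) :
      Conv (.app (.lam hα t) s) (t.bind (instSub s))
  | eta {Γ : List (Ty B)} {α β : Ty B} (hα : α.VarTy) (t : Tm Γ (.arr α β)) :
      Conv (.lam hα (.app (t.wk α) (.var .zero))) t
  | incTop {Γ : List (Ty B)} : Conv (Γ := Γ) (.inc .hg (.lcon .topH)) (.lcon .topG)
  | incAnd {Γ : List (Ty B)} (t s : Tm Γ .h) :
      Conv (.inc .hg (.app (.app (.lcon .andH) t) s))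
        (.app (.app (.lcon .andG) (.inc .hg t)) (.inc .hg s))
  | incOr {Γ : List (Ty B)} (t s : Tm Γ .h) :
      Conv (.inc .hg (.app (.app (.lcon .orH) t) s))
        (.app (.app (.lcon .orG) (.inc .hg t)) (.inc .hg s))
  | incSig {Γ : List (Ty B)} {α : Ty B} (hα : α.VarTy) (t : Tm (α :: Γ) .h) :
      Conv (.inc .hg (.app (.lcon (.sigH hα)) (.lam hα t)))
        (.app (.lcon (.sigG hα)) (.lam hα (.inc .hg t)))

theorem Conv.bind {Γ : List (Ty B)} {τ : Ty B} {t t' : Tm Γ τ} (hc : Conv t t') :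
    ∀ {Δ : List (Ty B)} (s : ∀ σ, Vr Γ σ → Tm Δ σ), Conv (t.bind s) (t'.bind s) := by
  induction hc with
  | refl t => intros; exact .refl _
  | symm _ ih => intro Δ s; exact (ih s).symm
  | trans _ _ ih ih' => intro Δ s; exact (ih s).trans (ih' s)
  | inc e _ ih => intro Δ s; exact .inc e (ih s)
  | app _ _ ih ih' => intro Δ s; exact .app (ih s) (ih' s)
  | lam hα _ ih => intro Δ s; exact .lam hα (ih _)
  | @beta Γ α β hα t u =>
    intro Δ s
    have key : (t.bind (instSub u)).bind s = (t.bind (liftSub s α)).bind (instSub (u.bind s)) := by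
      simp only [Tm.bind_bind]
      congr 1
      funext σ y
      cases y with
      | zero => rfl
      | succ y =>
        simp only [instSub, liftSub, Tm.wk, Tm.bind_ren, Tm.bind, Tm.bind_var]
    rw [key]
    exact .beta hα _ _
  | eta hα t =>
    intro Δ s
    simp only [Tm.bind, Tm.bind_wk]
    exact .eta hα _
  | incTop => intros; exact .incTop
  | incAnd t u => intros; exact .incAnd _ _
  | incOr t u => intros; exact .incOr _ _
  | incSig hα t => intros; exact .incSig hα _

/-! ### Levels and occurrences -/

def Vr.LevelLE (i : ℕ) : ∀ {Γ : List (Ty B)} {τ : Ty B}, Vr Γ τ → Prop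
  | _, _, .free x => x.level ≤ i
  | _, _, .zero => True
  | _, _, .succ y => y.LevelLE i

/-- All the logic variables and constants of the raw term have level at most `i`. -/
def Tm.LevelLE (i : ℕ) : ∀ {Γ : List (Ty B)} {τ : Ty B}, Tm Γ τ → Prop
  | _, _, .var y => y.LevelLE i
  | _, _, .con c => c.level ≤ i
  | _, _, .lcon _ => True
  | _, _, .inc _ t => t.LevelLE i
  | _, _, .app t s => t.LevelLE i ∧ s.LevelLE i
  | _, _, .lam _ t => t.LevelLE i

def Vr.Is (x : AVar B) : ∀ {Γ : List (Ty B)} {τ : Ty B}, Vr Γ τ → Prop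
  | _, τ, .free y => (⟨τ, y⟩ : AVar B) = x
  | _, _, .zero => False
  | _, _, .succ y => y.Is x

/-- The logic variable `x` occurs in the raw term. -/
def Tm.HasVar (x : AVar B) : ∀ {Γ : List (Ty B)} {τ : Ty B}, Tm Γ τ → Prop
  | _, _, .var y => y.Is x
  | _, _, .con _ => False
  | _, _, .lcon _ => False
  | _, _, .inc _ t => t.HasVar x
  | _, _, .app t s => t.HasVar x ∨ s.HasVar x
  | _, _, .lam _ t => t.HasVar x

/-- The non-logical constant `c` occurs in the raw term. -/
def Tm.HasCon (c : ACon B) : ∀ {Γ : List (Ty B)} {τ : Ty B}, Tm Γ τ → Prop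
  | _, _, .var _ => False
  | _, τ, .con d => (⟨τ, d⟩ : ACon B) = c
  | _, _, .lcon _ => False
  | _, _, .inc _ t => t.HasCon c
  | _, _, .app t s => t.HasCon c ∨ s.HasCon c
  | _, _, .lam _ t => t.HasCon c

/-! ### Terms -/

/-- Terms: raw terms up to `λ`-equivalence (equivalently, principal normal forms). -/
def Term (Γ : List (Ty B)) (τ : Ty B) : Type u := Quot (Conv (Γ := Γ) (τ := τ))

/-- Terms without free occurrences of bound variables. -/
abbrev CTerm (τ : Ty B) : Type u := Term ([] : List (Ty B)) τ

namespace Term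

variable {Γ Δ : List (Ty B)} {σ τ α β : Ty B}

def mk (t : Tm Γ τ) : Term Γ τ := Quot.mk _ t

def var (y : Vr Γ τ) : Term Γ τ := mk (.var y)

def con (c : Con τ) : Term Γ τ := mk (.con c)

def lcon (k : LCon τ) : Term Γ τ := mk (.lcon k)

def inc (e : Incl σ τ) : Term Γ σ → Term Γ τ :=
  Quot.map (.inc e) (fun _ _ hc => .inc e hc)

def app : Term Γ (.arr α β) → Term Γ α → Term Γ β :=
  Quot.map₂ .app (fun _ _ _ hc => .app (.refl _) hc) (fun _ _ _ hc => .app hc (.refl _))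

def lam (hα : α.VarTy) : Term (α :: Γ) β → Term Γ (.arr α β) :=
  Quot.map (.lam hα) (fun _ _ hc => .lam hα hc)

/-- Simultaneous substitution on terms. -/
noncomputable def bind (s : ∀ σ, Vr Γ σ → Term Δ σ) : Term Γ τ → Term Δ τ :=
  Quot.map (fun t => t.bind (fun σ y => (s σ y).out)) (fun _ _ hc => hc.bind _)

/-- The substitution replacing the innermost bound variable by `s`. -/
def single (s : Term Γ α) : ∀ τ, Vr (α :: Γ) τ → Term Γ τ
  | _, .zero => s
  | _, .succ y => var y

/-- `t[s/x]` for the innermost bound variable `x` of `t`. -/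
noncomputable def inst (t : Term (α :: Γ) β) (s : Term Γ α) : Term Γ β := t.bind (single s)

/-- The term has level at most `i`, that is, its normal form is over the `i`-th universe. -/
def LevelLE (i : ℕ) (q : Term Γ τ) : Prop := ∃ t, mk t = q ∧ t.LevelLE i

/-- Free logic variables of (the normal form of) a term. -/
def fv (q : Term Γ τ) : Set (AVar B) := {x | ∀ t, mk t = q → t.HasVar x}

/-- Non-logical constants of (the normal form of) a term. -/
def oc (q : Term Γ τ) : Set (ACon B) := {c | ∀ t, mk t = q → t.HasCon c}

def topG : Term Γ .g := lcon .topG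

def andG (G G' : Term Γ .g) : Term Γ .g := app (app (lcon .andG) G) G'

def orG (G G' : Term Γ .g) : Term Γ .g := app (app (lcon .orG) G) G'

/-- The goal `D ⊃ G`. -/
def impG (D : Term Γ .p) (G : Term Γ .g) : Term Γ .g := app (app (lcon .impG) D) G

def exG (hα : α.VarTy) (G : Term (α :: Γ) .g) : Term Γ .g := app (lcon (.sigG hα)) (lam hα G)

def allG (hα : α.VarTy) (G : Term (α :: Γ) .g) : Term Γ .g := app (lcon (.piG hα)) (lam hα G)

def andP (D D' : Term Γ .p) : Term Γ .p := app (app (lcon .andP) D) D'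

/-- The clause `G ⊃ A`. -/
def impP (G : Term Γ .g) (A : Term Γ .r) : Term Γ .p := app (app (lcon .impP) G) A

def allP (hα : α.VarTy) (D : Term (α :: Γ) .p) : Term Γ .p := app (lcon (.piP hα)) (lam hα D)

/-- A rigid atom as a goal. -/
def rigid (A : Term Γ .r) : Term Γ .g := inc .hg (inc .ah (inc .ra A))

end Term

/-- A raw term whose head is a variable or a non-logical constant. -/
inductive Neutral {Γ : List (Ty B)} : ∀ {τ : Ty B}, Tm Γ τ → Prop
  | var {τ : Ty B} (y : Vr Γ τ) : Neutral (.var y)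
  | con {τ : Ty B} (c : Con τ) : Neutral (.con c)
  | app {α β : Ty B} {t : Tm Γ (.arr α β)} (s : Tm Γ α) : Neutral t → Neutral (.app t s)
  | ra {t : Tm Γ .r} : Neutral t → Neutral (.inc .ra t)
  | ah {t : Tm Γ .a} : Neutral t → Neutral (.inc .ah t)

/-- Atomic goals. -/
def Atomic (G : CTerm (B := B) .g) : Prop :=
  ∃ t : Tm ([] : List (Ty B)) .h, Neutral t ∧ G = Term.inc .hg (Term.mk t)

/-! ### Substitutions -/

/-- Assignments of terms to logic variables; substitutions proper are the `Legal` ones. -/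
abbrev Subst (B : Type u) : Type u := ∀ τ : Ty B, LVar τ → CTerm τ

namespace Subst

def id : Subst B := fun _ x => Term.var (.free x)

/-- The variables not fixed by the substitution. -/
def dom (θ : Subst B) : Set (AVar B) := {x | θ x.1 x.2 ≠ id x.1 x.2}

/-- Finite support, and level preservation. (Types are preserved, and ranges are positive,
by construction.) -/
def Legal (θ : Subst B) : Prop :=
  θ.dom.Finite ∧ ∀ (τ : Ty B) (x : LVar τ), (θ τ x).LevelLE x.level

/-- Variables occurring in the substitution. -/
def fv (θ : Subst B) : Set (AVar B) := θ.dom ∪ ⋃ x ∈ θ.dom, (θ x.1 x.2).fv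

/-- Constants occurring in the substitution. -/
def oc (θ : Subst B) : Set (ACon B) := ⋃ x ∈ θ.dom, (θ x.1 x.2).oc

/-- The variables of the empty context are the logic variables. -/
def onVr (θ : Subst B) {τ : Ty B} : Vr [] τ → CTerm τ
  | .free x => θ τ x

/-- Application of a substitution to a term. -/
noncomputable def apply (θ : Subst B) {τ : Ty B} (t : CTerm τ) : CTerm τ :=
  t.bind (fun _ y => θ.onVr y)

/-- Composition in diagrammatic order: first `θ`, then `γ`. -/
noncomputable def comp (θ γ : Subst B) : Subst B := fun τ x => γ.apply (θ τ x)

open Classical in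
/-- Restriction of the domain to `X`. -/
noncomputable def restrict (θ : Subst B) (X : Set (AVar B)) : Subst B :=
  fun τ x => if (⟨τ, x⟩ : AVar B) ∈ X then θ τ x else id τ x

end Subst

/-! ### Elaboration of programs -/

/-- Universally closed facts `A` and rules `G ⊃ A`. -/
inductive Clause : List (Ty B) → Type u
  | fact {Γ : List (Ty B)} (A : Term Γ .r) : Clause Γ
  | rule {Γ : List (Ty B)} (G : Term Γ .g) (A : Term Γ .r) : Clause Γ
  | all {Γ : List (Ty B)} {α : Ty B} (hα : α.VarTy) (K : Clause (α :: Γ)) : Clause Γ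

/-- `InElaboration i D K`: the program formula `D` is over the `i`-th universe and the clause `K`
belongs to the elaboration of `D`. -/
inductive InElaboration (i : ℕ) : ∀ {Γ : List (Ty B)}, Term Γ .p → Clause Γ → Prop
  | fact {Γ : List (Ty B)} {A : Term Γ .r} :
      A.LevelLE i → InElaboration i (Term.inc .rp A) (.fact A)
  | rule {Γ : List (Ty B)} {G : Term Γ .g} {A : Term Γ .r} :
      G.LevelLE i → A.LevelLE i → InElaboration i (Term.impP G A) (.rule G A)
  | left {Γ : List (Ty B)} {D D' : Term Γ .p} {K : Clause Γ} :
      D'.LevelLE i → InElaboration i D K → InElaboration i (Term.andP D D') K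
  | right {Γ : List (Ty B)} {D D' : Term Γ .p} {K : Clause Γ} :
      D.LevelLE i → InElaboration i D' K → InElaboration i (Term.andP D D') K
  | all {Γ : List (Ty B)} {α : Ty B} (hα : α.VarTy) {D : Term (α :: Γ) .p}
      {K : Clause (α :: Γ)} :
      InElaboration i D K → InElaboration i (Term.allP hα D) (.all hα K)

/-- Replacement of the variables of a context by logic variables. -/
noncomputable def Term.renFree {Γ : List (Ty B)} {τ : Ty B} (δ : ∀ σ, Vr Γ σ → LVar σ)
    (t : Term Γ τ) : CTerm τ :=
  t.bind (fun _ y => Term.var (.free (δ _ y)))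

/-- Extension of a replacement by a value for the innermost bound variable. -/
def consVar {Γ : List (Ty B)} {α : Ty B} (w : LVar α) (δ : ∀ σ, Vr Γ σ → LVar σ) :
    ∀ σ, Vr (α :: Γ) σ → LVar σ
  | _, .zero => w
  | _, .succ y => δ _ y

/-- `Apart δ K ws G A`: replacing the quantified variables of the clause `K` by the logic
variables `ws`, in this order, and the variables of its context according to `δ`, yields the
body `G` (`none` for a fact) and the head `A`. -/
inductive Apart : ∀ {Γ : List (Ty B)}, (∀ σ, Vr Γ σ → LVar σ) → Clause Γ → List (AVar B) →
    Option (CTerm (B := B) .g) → CTerm (B := B) .r → Prop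
  | fact {Γ : List (Ty B)} (δ : ∀ σ, Vr Γ σ → LVar σ) (A : Term Γ .r) :
      Apart δ (.fact A) [] none (A.renFree δ)
  | rule {Γ : List (Ty B)} (δ : ∀ σ, Vr Γ σ → LVar σ) (G : Term Γ .g) (A : Term Γ .r) :
      Apart δ (.rule G A) [] (some (G.renFree δ)) (A.renFree δ)
  | all {Γ : List (Ty B)} {δ : ∀ σ, Vr Γ σ → LVar σ} {α : Ty B} (hα : α.VarTy)
      {K : Clause (α :: Γ)} (w : LVar α) {ws : List (AVar B)} {G : Option (CTerm (B := B) .g)}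
      {A : CTerm (B := B) .r} :
      Apart (consVar w δ) K ws G A → Apart δ (.all hα K) (⟨α, w⟩ :: ws) G A

/-- The variables of the empty context are the logic variables. -/
def freeVar : ∀ σ : Ty B, Vr [] σ → LVar σ
  | _, .free x => x

/-! ### Resolution -/

/-- A state: a level, a program and a goal. -/
structure State (B : Type u) : Type u where
  idx : ℕ
  prog : List (CTerm (B := B) .p)
  goal : CTerm (B := B) .g

/-- The program and the goal are over the universe given by the state index. -/
def State.Valid (s : State B) : Prop :=
  (∀ D ∈ s.prog, D.LevelLE s.idx) ∧ s.goal.LevelLE s.idx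

noncomputable def State.apply (θ : Subst B) (s : State B) : State B :=
  ⟨s.idx, s.prog.map θ.apply, θ.apply s.goal⟩

/-- State vectors; the null vector `□` is `[]`. -/
abbrev StateVector (B : Type u) : Type u := List (State B)

namespace StateVector

def Valid (A : StateVector B) : Prop := ∀ s ∈ A, s.Valid

noncomputable def apply (θ : Subst B) (A : StateVector B) : StateVector B :=
  A.map (State.apply θ)

def fv (A : StateVector B) : Set (AVar B) :=
  {x | ∃ s ∈ A, (∃ D ∈ s.prog, x ∈ D.fv) ∨ x ∈ s.goal.fv}

def oc (A : StateVector B) : Set (ACon B) :=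
  {c | ∃ s ∈ A, (∃ D ∈ s.prog, c ∈ D.oc) ∨ c ∈ s.goal.oc}

end StateVector

/-- The names of the resolution rules. -/
inductive Rule : Type
  | null | true | backchain | axm | or | and | instance_ | augment | generic | sub

/-- `Step ρ V C A θ A' W K`: by the rule `ρ`, the vector `A` is transformed into `A'` with the
substitution `θ`, when the variables `V` and the constants `C` have occurred before. `W` and `K`
are the fresh variables and constants introduced by the step. -/
inductive Step : Rule → Set (AVar B) → Set (ACon B) → StateVector B → Subst B → StateVector B →
    Set (AVar B) → Set (ACon B) → Prop
  | null {V : Set (AVar B)} {C : Set (ACon B)} (L R : StateVector B) (i : ℕ)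
      (P : List (CTerm (B := B) .p)) :
      Step .null V C (L ++ ⟨i, P, Term.topG⟩ :: R) Subst.id (L ++ R) ∅ ∅
  | true {V : Set (AVar B)} {C : Set (ACon B)} (L R : StateVector B) (i : ℕ)
      (P : List (CTerm (B := B) .p)) {G : CTerm (B := B) .g} {θ : Subst B} :
      Atomic G → θ.Legal → θ ≠ Subst.id → θ.apply G = Term.topG →
      Step .true V C (L ++ ⟨i, P, G⟩ :: R) θ
        (L.apply θ ++ ⟨i, P.map θ.apply, Term.topG⟩ :: R.apply θ) ∅ ∅
  | backchain {V : Set (AVar B)} {C : Set (ACon B)} (L R : StateVector B) (i : ℕ)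
      (P : List (CTerm (B := B) .p)) {A' A : CTerm (B := B) .r} {D : CTerm (B := B) .p} {K : Clause []}
      {ws : List (AVar B)} {G : CTerm (B := B) .g} {θ : Subst B} :
      A'.LevelLE i → D ∈ P → InElaboration i D K → Apart freeVar K ws (some G) A →
      ws.Nodup → (∀ x ∈ ws, x ∉ V ∧ x.2.level ≤ i) → θ.Legal → θ.apply A' = θ.apply A →
      Step .backchain V C (L ++ ⟨i, P, Term.rigid A'⟩ :: R) θ
        (L.apply θ ++ ⟨i, P.map θ.apply, θ.apply G⟩ :: R.apply θ) {x | x ∈ ws} ∅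
  | axm {V : Set (AVar B)} {C : Set (ACon B)} (L R : StateVector B) (i : ℕ)
      (P : List (CTerm (B := B) .p)) {A' A : CTerm (B := B) .r} {D : CTerm (B := B) .p} {K : Clause []}
      {ws : List (AVar B)} {θ : Subst B} :
      A'.LevelLE i → D ∈ P → InElaboration i D K → Apart freeVar K ws none A →
      ws.Nodup → (∀ x ∈ ws, x ∉ V ∧ x.2.level ≤ i) → θ.Legal → θ.apply A' = θ.apply A →
      Step .axm V C (L ++ ⟨i, P, Term.rigid A'⟩ :: R) θ (L.apply θ ++ R.apply θ)
        {x | x ∈ ws} ∅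
  | orLeft {V : Set (AVar B)} {C : Set (ACon B)} (L R : StateVector B) (i : ℕ)
      (P : List (CTerm (B := B) .p)) {G G' : CTerm (B := B) .g} :
      G.LevelLE i → G'.LevelLE i →
      Step .or V C (L ++ ⟨i, P, Term.orG G G'⟩ :: R) Subst.id (L ++ ⟨i, P, G⟩ :: R) ∅ ∅
  | orRight {V : Set (AVar B)} {C : Set (ACon B)} (L R : StateVector B) (i : ℕ)
      (P : List (CTerm (B := B) .p)) {G G' : CTerm (B := B) .g} :
      G.LevelLE i → G'.LevelLE i →
      Step .or V C (L ++ ⟨i, P, Term.orG G G'⟩ :: R) Subst.id (L ++ ⟨i, P, G'⟩ :: R) ∅ ∅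
  | and {V : Set (AVar B)} {C : Set (ACon B)} (L R : StateVector B) (i : ℕ)
      (P : List (CTerm (B := B) .p)) {G G' : CTerm (B := B) .g} :
      G.LevelLE i → G'.LevelLE i →
      Step .and V C (L ++ ⟨i, P, Term.andG G G'⟩ :: R) Subst.id
        (L ++ ⟨i, P, G⟩ :: ⟨i, P, G'⟩ :: R) ∅ ∅
  | instance_ {V : Set (AVar B)} {C : Set (ACon B)} (L R : StateVector B) (i : ℕ)
      (P : List (CTerm (B := B) .p)) {α : Ty B} (hα : α.VarTy) {G : Term [α] .g} {t : CTerm α} :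
      G.LevelLE i → t.LevelLE i →
      Step .instance_ V C (L ++ ⟨i, P, Term.exG hα G⟩ :: R) Subst.id
        (L ++ ⟨i, P, G.inst t⟩ :: R) ∅ ∅
  | augment {V : Set (AVar B)} {C : Set (ACon B)} (L R : StateVector B) (i : ℕ)
      (P : List (CTerm (B := B) .p)) {D : CTerm (B := B) .p} {G : CTerm (B := B) .g} :
      D.LevelLE i → G.LevelLE i →
      Step .augment V C (L ++ ⟨i, P, Term.impG D G⟩ :: R) Subst.id
        (L ++ ⟨i, P ++ [D], G⟩ :: R) ∅ ∅
  | generic {V : Set (AVar B)} {C : Set (ACon B)} (L R : StateVector B) (i : ℕ)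
      (P : List (CTerm (B := B) .p)) {α : Ty B} (hα : α.VarTy) {G : Term [α] .g} {c : Con α} :
      G.LevelLE i → c.level = i + 1 → (⟨α, c⟩ : ACon B) ∉ C →
      Step .generic V C (L ++ ⟨i, P, Term.allG hα G⟩ :: R) Subst.id
        (L ++ ⟨i + 1, P, G.inst (Term.con c)⟩ :: R) ∅ {⟨α, c⟩}
  | sub {V : Set (AVar B)} {C : Set (ACon B)} (L R : StateVector B) (i : ℕ)
      (P : List (CTerm (B := B) .p)) (G : CTerm (B := B) .g) {θ : Subst B} :
      θ.Legal →
      Step .sub V C (L ++ ⟨i, P, G⟩ :: R) θ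
        (L.apply θ ++ ⟨i, P.map θ.apply, θ.apply G⟩ :: R.apply θ) ∅ ∅

/-- Sequences of resolution steps from `A`, by rules in `S`. `Res S A θ A' V C N`: the sequence
ends in `A'`; the composition of the intervening substitutions is `θ`; the variables `V` and
constants `C` have occurred in it; `N` are the constants introduced by its generic steps. -/
inductive Res (S : Set Rule) (A : StateVector B) : Subst B → StateVector B → Set (AVar B) →
    Set (ACon B) → Set (ACon B) → Prop
  | refl : Res S A Subst.id A A.fv A.oc ∅
  | step {θ γ : Subst B} {A' A'' : StateVector B} {V W : Set (AVar B)} {C N K : Set (ACon B)}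
      {ρ : Rule} :
      Res S A θ A' V C N → ρ ∈ S → Step ρ V C A' γ A'' W K →
      Res S A (θ.comp γ) A'' (V ∪ W ∪ γ.fv ∪ A''.fv) (C ∪ K ∪ γ.oc ∪ A''.oc) (N ∪ K)

/-- There is a resolution from `A` to `A'` by rules in `S` with computed answer `θ` (the
composition of the intervening substitutions, restricted to the free variables of `A`), whose
generic steps introduce the constants `N`. -/
def DerivesWith (S : Set Rule) (A : StateVector B) (θ : Subst B) (A' : StateVector B)
    (N : Set (ACon B)) : Prop :=
  ∃ (η : Subst B) (V : Set (AVar B)) (C : Set (ACon B)),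
    Res S A η A' V C N ∧ θ = η.restrict A.fv

def Derives (S : Set Rule) (A : StateVector B) (θ : Subst B) (A' : StateVector B) : Prop :=
  ∃ N, DerivesWith S A θ A' N

/-- The rules of ordinary resolution. -/
def ordinary : Set Rule := {ρ | ρ ≠ .sub}

/-- The rules of enriched resolution. -/
def enriched : Set Rule := Set.univ

end Types

/-! ### Uniform algebras -/

/-- Uniform applicative structures. -/
structure UniformStructure (B : Type u) : Type (max u (v + 1)) where
  D : ℕ → Ty B → Type v
  app {i : ℕ} {α β : Ty B} : D i (.arr α β) → D i α → D i β
  ext {i : ℕ} {α β : Ty B} (f f' : D i (.arr α β)) : (∀ d, app f d = app f' d) → f = f'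
  const {τ : Ty B} (c : Con τ) : D c.level τ
  lconst {τ : Ty B} (k : LCon τ) : D 0 τ
  /-- The inclusions between levels. -/
  lift {i j : ℕ} {τ : Ty B} (hij : i ≤ j) : D i τ → D j τ
  lift_refl {i : ℕ} {τ : Ty B} (d : D i τ) : lift le_rfl d = d
  lift_trans {i j k : ℕ} {τ : Ty B} (hij : i ≤ j) (hjk : j ≤ k) (d : D i τ) :
    lift hjk (lift hij d) = lift (hij.trans hjk) d
  lift_injective {i j : ℕ} {τ : Ty B} (hij : i ≤ j) :
    Function.Injective (lift (τ := τ) hij)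
  lift_app {i j : ℕ} {α β : Ty B} (hij : i ≤ j) (f : D i (.arr α β)) (d : D i α) :
    lift hij (app f d) = app (lift hij f) (lift hij d)
  /-- The inclusions between the subtypes of the type of formulas. -/
  incl {i : ℕ} {σ τ : Ty B} (e : Incl σ τ) : D i σ → D i τ
  incl_injective {i : ℕ} {σ τ : Ty B} (e : Incl σ τ) : Function.Injective (incl (i := i) e)
  /-- The preorder on the carrier of programs. -/
  le {i : ℕ} : D i .p → D i .p → Prop
  le_refl {i : ℕ} (p : D i .p) : le p p
  le_trans {i : ℕ} (p q s : D i .p) : le p q → le q s → le p s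
  topP {i : ℕ} : D i .p
  top_and {i : ℕ} (p : D i .p) : app (app (lift (Nat.zero_le i) (lconst .andP)) topP) p = p
  and_top {i : ℕ} (p : D i .p) : app (app (lift (Nat.zero_le i) (lconst .andP)) p) topP = p
  le_and {i : ℕ} (p q : D i .p) : le p (app (app (lift (Nat.zero_le i) (lconst .andP)) p) q)
  and_comm {i : ℕ} (p q : D i .p) :
    le (app (app (lift (Nat.zero_le i) (lconst .andP)) p) q)
      (app (app (lift (Nat.zero_le i) (lconst .andP)) q) p)
  app_le_pi {i : ℕ} {α : Ty B} (hα : α.VarTy) (f : D i (.arr α .p)) (d : D i α) :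
    le (app f d) (app (lift (Nat.zero_le i) (lconst (.piP hα))) f)

namespace UniformStructure

variable {B : Type u} (M : UniformStructure.{u, v} B)

/-- The interpretation of a logical constant, included at level `i`. -/
def lc {τ : Ty B} (k : LCon τ) (i : ℕ) : M.D i τ := M.lift (Nat.zero_le i) (M.lconst k)

/-- Application of an interpreted binary connective. -/
def bin {i : ℕ} {α β τ : Ty B} (k : LCon (.arr α (.arr β τ))) (x : M.D i α) (y : M.D i β) :
    M.D i τ := M.app (M.app (M.lc k i) x) y

/-- The inclusion of rigid atoms into goals. -/
def rigid {i : ℕ} (x : M.D i .r) : M.D i .g := M.incl .hg (M.incl .ah (M.incl .ra x))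

/-- Assignments, respecting levels and types. -/
abbrev Assign : Type (max u v) := ∀ (τ : Ty B) (x : LVar τ), M.D x.level τ

end UniformStructure

/-- `Ω`-valuations on a uniform applicative structure. -/
structure Valuation {B : Type u} (M : UniformStructure.{u, v} B) (Ω : Type w)
    [DistribLattice Ω] [OrderTop Ω] : Type (max u v w) where
  I : ∀ i : ℕ, M.D i .p → M.D i .g → Ω
  atom {i : ℕ} (x : M.D i .r) : I i (M.incl .rp x) (M.rigid x) = ⊤
  mono {i : ℕ} (p : M.D i .p) (g : M.D i .g) :
    I i p g ≤ I (i + 1) (M.lift (Nat.le_succ i) p) (M.lift (Nat.le_succ i) g)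
  top {i : ℕ} (p : M.D i .p) : I i p (M.lc .topG i) = ⊤
  and {i : ℕ} (p : M.D i .p) (g g' : M.D i .g) : I i p (M.bin .andG g g') = I i p g ⊓ I i p g'
  or {i : ℕ} (p : M.D i .p) (g g' : M.D i .g) : I i p (M.bin .orG g g') = I i p g ⊔ I i p g'
  imp {i : ℕ} (p q : M.D i .p) (g : M.D i .g) :
    I i p (M.bin .impG q g) = I i (M.bin .andP p q) g
  ex {i : ℕ} {α : Ty B} (hα : α.VarTy) (p : M.D i .p) (f : M.D i (.arr α .g)) :
    IsLUB (Set.range fun d : M.D i α => I i p (M.app f d)) (I i p (M.app (M.lc (.sigG hα) i) f))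
  all {i : ℕ} {α : Ty B} (hα : α.VarTy) (p : M.D i .p) (f : M.D i (.arr α .g)) :
    IsGLB (Set.range fun d : M.D i α => I i p (M.app f d)) (I i p (M.app (M.lc (.piG hα) i) f))
  inclusion {i : ℕ} (p p' : M.D i .p) (g : M.D i .g) : M.le p p' → I i p g ≤ I i p' g
  backchain {i : ℕ} (p : M.D i .p) (g : M.D i .g) (x : M.D i .r) :
    M.le (M.bin .impP g x) p → I i p g ≤ I i p (M.rigid x)

/-- Uniform algebras. `U i t φ` is the interpretation of a term `t` of level at most `i` in the
carriers of level `i`; the values of `U` on other arguments are irrelevant. -/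
structure UniformAlgebra (B : Type u) (Ω : Type w) [DistribLattice Ω] [OrderTop Ω] :
    Type (max u (v + 1) w) where
  M : UniformStructure.{u, v} B
  val : Valuation M Ω
  U {τ : Ty B} (i : ℕ) : CTerm τ → M.Assign → M.D i τ
  /-- The interpretations at different levels are related by the (tacit) inclusions. -/
  U_lift {τ : Ty B} {i j : ℕ} (hij : i ≤ j) (t : CTerm τ) (φ : M.Assign) :
    t.LevelLE i → U j t φ = M.lift hij (U i t φ)
  U_var {τ : Ty B} {i : ℕ} (x : LVar τ) (φ : M.Assign) (hx : x.level ≤ i) :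
    U i (Term.var (.free x)) φ = M.lift hx (φ τ x)
  U_con {τ : Ty B} {i : ℕ} (c : Con τ) (φ : M.Assign) (hc : c.level ≤ i) :
    U i (Term.con c) φ = M.lift hc (M.const c)
  U_lcon {τ : Ty B} {i : ℕ} (k : LCon τ) (φ : M.Assign) : U i (Term.lcon k) φ = M.lc k i
  U_inc {σ τ : Ty B} {i : ℕ} (e : Incl σ τ) (t : CTerm σ) (φ : M.Assign) :
    t.LevelLE i → U i (Term.inc e t) φ = M.incl e (U i t φ)
  U_app {α β : Ty B} {i : ℕ} (t : CTerm (.arr α β)) (s : CTerm α) (φ : M.Assign) :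
    t.LevelLE i → s.LevelLE i → U i (Term.app t s) φ = M.app (U i t φ) (U i s φ)
  /-- The interpretation of `λ x. t` sends every `d` to the interpretation of `t[y/x]` under
  `φ[d/y]`, where `y` is a fresh variable; it is unique by extensionality. -/
  U_lam {α β : Ty B} {i : ℕ} (hα : α.VarTy) (t : Term [α] β) (n : ℕ) (φ φ' : M.Assign) :
    t.LevelLE i → (⟨α, ⟨i, n, hα⟩⟩ : AVar B) ∉ t.fv →
    (∀ x : AVar B, x ≠ ⟨α, ⟨i, n, hα⟩⟩ → φ' x.1 x.2 = φ x.1 x.2) →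
    M.app (U i (Term.lam hα t) φ) (φ' α ⟨i, n, hα⟩) =
      U i (t.inst (Term.var (.free ⟨i, n, hα⟩))) φ'

namespace UniformAlgebra

variable {B : Type u} {Ω : Type w} [DistribLattice Ω] [OrderTop Ω]
  (M : UniformAlgebra.{u, v, w} B Ω)

/-- The interpretation at level `i` of the conjunction of a program (`⊤ₚ` if it is empty). -/
def prog (i : ℕ) (P : List (CTerm (B := B) .p)) (φ : M.M.Assign) : M.M.D i .p :=
  P.foldl (fun d D => M.M.bin .andP d (M.U i D φ)) M.M.topP

def state (s : State B) (φ : M.M.Assign) : Ω :=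
  M.val.I s.idx (M.prog s.idx s.prog φ) (M.U s.idx s.goal φ)

/-- The truth value of a state vector. -/
def vector (A : StateVector B) (φ : M.M.Assign) : Ω :=
  A.foldr (fun s x => M.state s φ ⊓ x) ⊤

end UniformAlgebra

end UCTT

open UCTT

/-! In every resolution step the unification can be separated from the logical content. If a step
with substitution `γ` turns `A` into `A'`, then `A.apply γ` has the form `L ++ s :: R`, `A'` is `L
++ ss ++ R`, and `s` reduces to `ss` by a step that needs no unification (`Ground`, `Step.ground`);
True and Sub become trivial. Ground steps are preserved by substitutions and by level-preserving
replacements of constants by constants (`Ground.tr`).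

Conservativity. A state is provable if a finite tree of ground steps reduces it to nothing. Reading
a resolution of `A` to the null vector backwards, with the later substitutions applied to each step,
shows that all states of `A θ` are provable, where `θ` is the answer (`Res.provable`). Conversely, a
ground step is simulated by an ordinary step whose substitution moves only fresh clause variables
(`Res.ground`), so provable states resolve to the null vector without Sub and without affecting the
answer (`Res.exists_null`); generic constants are renamed on the way to keep them fresh. For the
identity answer this is conservativity. For lifting to the null vector, one Sub step with the
composed substitution comes first.

Lifting to a nonempty `A'`. After a Sub step with `θ`, each given step is replayed as a Sub step
followed by a ground step (`Res.lift`). The obstacle is that variables of `A` or `θ` that disappear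
in `A θ` may be reused as fresh ones by the given resolution. The resolution is therefore conjugated
by an involutive renaming that moves them out of the way, and a last Sub step repairs the end
(`exists_swap`, `derives_of_apply`).

Soundness. For rules other than Generic, the axioms of a valuation show that a ground step read
backwards does not decrease truth values (`UniformAlgebra.vector_le_state`); with the substitution
lemma `UniformAlgebra.U_apply` this gives soundness inside each algebra. For Generic, given an
element `d` of level `i`, another algebra is built in which level `i + 1` is collapsed onto level
`i`, so that the constant of level `i + 1` can denote `d` (`UniformAlgebra.pullback`,
`state_allG_eq_top`). Hence Generic preserves only truth in all algebras. -/

namespace UCTT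

section Terms

variable {B : Type u}

/-! ### Replacement of constants and logic variables in raw terms -/

/-- Weakening of a closed term to an arbitrary context. -/
def Tm.weak {τ : Ty B} : ∀ (Γ : List (Ty B)), Tm [] τ → Tm Γ τ
  | [], t => t
  | α :: Γ, t => (Tm.weak Γ t).wk α

/-- Replacement of the logic variables by closed terms. -/
def Vr.tr (ν : ∀ τ : Ty B, LVar τ → Tm [] τ) : ∀ {Γ : List (Ty B)} {τ : Ty B}, Vr Γ τ → Tm Γ τ
  | _, _, .free x => ν _ x
  | _, _, .zero => .var .zero
  | _, _, .succ y => (y.tr ν).wk _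

/-- Simultaneous replacement of the constants and of the logic variables by closed terms. -/
def Tm.tr (κ : ∀ τ : Ty B, Con τ → Tm [] τ) (ν : ∀ τ : Ty B, LVar τ → Tm [] τ) :
    ∀ {Γ : List (Ty B)} {τ : Ty B}, Tm Γ τ → Tm Γ τ
  | _, _, .var y => y.tr ν
  | Γ, _, .con c => (κ _ c).weak Γ
  | _, _, .lcon k => .lcon k
  | _, _, .inc e t => .inc e (t.tr κ ν)
  | _, _, .app t s => .app (t.tr κ ν) (s.tr κ ν)
  | _, _, .lam hα t => .lam hα (t.tr κ ν)

theorem Tm.ren_eq_bind {Γ : List (Ty B)} {τ : Ty B} (t : Tm Γ τ) :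
    ∀ {Δ : List (Ty B)} (ρ : ∀ σ, Vr Γ σ → Vr Δ σ), t.ren ρ = t.bind (fun _ y => .var (ρ _ y)) := by
  intro Δ ρ
  conv_lhs => rw [← Tm.bind_var (t.ren ρ)]
  rw [Tm.bind_ren]

theorem Conv.ren {Γ Δ : List (Ty B)} {τ : Ty B} {t t' : Tm Γ τ} (hc : Conv t t')
    (ρ : ∀ σ, Vr Γ σ → Vr Δ σ) : Conv (t.ren ρ) (t'.ren ρ) := by
  simpa only [Tm.ren_eq_bind] using hc.bind _

theorem Conv.weak {τ : Ty B} {t t' : Tm [] τ} (hc : Conv t t') :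
    ∀ Γ : List (Ty B), Conv (t.weak Γ) (t'.weak Γ)
  | [] => hc
  | _ :: Γ => (Conv.weak hc Γ).ren _

/-- Makes substitution on `Term` independent of the representatives picked by `Quot.out`. -/
theorem Tm.bind_conv {Γ : List (Ty B)} {τ : Ty B} (t : Tm Γ τ) :
    ∀ {Δ : List (Ty B)} {s s' : ∀ σ, Vr Γ σ → Tm Δ σ}, (∀ σ y, Conv (s σ y) (s' σ y)) →
      Conv (t.bind s) (t.bind s') := by
  induction t with
  | var y => intro Δ s s' h; exact h _ y
  | con c => intros; exact .refl _
  | lcon k => intros; exact .refl _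
  | inc e t ih => intro Δ s s' h; exact .inc e (ih h)
  | app t u iht ihu => intro Δ s s' h; exact .app (iht h) (ihu h)
  | lam hα t ih =>
    intro Δ s s' h
    refine .lam hα (ih fun σ y => ?_)
    cases y with
    | zero => exact .refl _
    | succ y => exact (h _ y).ren _

section Tr

variable (κ : ∀ τ : Ty B, Con τ → Tm [] τ) (ν : ∀ τ : Ty B, LVar τ → Tm [] τ)

/-- Both hypotheses pass to `liftRen ρ` under a binder. The second one takes care of the closed
terms put in place of constants, which `tr` weakens to the ambient context. -/
theorem Tm.tr_ren {Γ : List (Ty B)} {τ : Ty B} (t : Tm Γ τ) :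
    ∀ {Δ : List (Ty B)} (ρ : ∀ σ, Vr Γ σ → Vr Δ σ),
      (∀ σ y, (ρ σ y).tr ν = (y.tr ν).ren ρ) →
      (∀ (σ : Ty B) (u : Tm [] σ), (u.weak Γ).ren ρ = u.weak Δ) →
      (t.ren ρ).tr κ ν = (t.tr κ ν).ren ρ := by
  induction t with
  | var y => intro Δ ρ h _; exact h _ y
  | con c => intro Δ ρ _ h; exact (h _ _).symm
  | lcon k => intros; rfl
  | inc e t ih => intro Δ ρ h h'; simp only [Tm.ren, Tm.tr, ih ρ h h']
  | app t u iht ihu => intro Δ ρ h h'; simp only [Tm.ren, Tm.tr, iht ρ h h', ihu ρ h h']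
  | @lam Γ α β hα t ih =>
    intro Δ ρ h h'
    simp only [Tm.ren, Tm.tr]
    rw [ih (liftRen ρ α)]
    · intro σ y
      cases y with
      | zero => rfl
      | succ y => simp only [liftRen, Vr.tr, Tm.ren_wk, h]
    · intro σ u
      simp only [Tm.weak, Tm.ren_wk, h']

theorem Tm.tr_wk {Γ : List (Ty B)} {τ : Ty B} (t : Tm Γ τ) (α : Ty B) :
    (t.wk α).tr κ ν = (t.tr κ ν).wk α :=
  Tm.tr_ren κ ν t _ (fun _ _ => rfl) (fun _ _ => rfl)

/-- The last hypothesis says that `s'` leaves closed terms alone, that is, acts on bound variables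
only: the replacement of logic variables has already been carried out by `tr`. -/
theorem Tm.tr_bind {Γ : List (Ty B)} {τ : Ty B} (t : Tm Γ τ) :
    ∀ {Δ : List (Ty B)} (s s' : ∀ σ, Vr Γ σ → Tm Δ σ),
      (∀ σ y, (s σ y).tr κ ν = (y.tr ν).bind s') →
      (∀ (σ : Ty B) (u : Tm [] σ), (u.weak Γ).bind s' = u.weak Δ) →
      (t.bind s).tr κ ν = (t.tr κ ν).bind s' := by
  induction t with
  | var y => intro Δ s s' h _; exact h _ y
  | con c => intro Δ s s' _ h; exact (h _ _).symm
  | lcon k => intros; rfl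
  | inc e t ih => intro Δ s s' h h'; simp only [Tm.bind, Tm.tr, ih s s' h h']
  | app t u iht ihu => intro Δ s s' h h'; simp only [Tm.bind, Tm.tr, iht s s' h h', ihu s s' h h']
  | @lam Γ α β hα t ih =>
    intro Δ s s' h h'
    simp only [Tm.bind, Tm.tr]
    rw [ih (liftSub s α) (liftSub s' α)]
    · intro σ y
      cases y with
      | zero => rfl
      | succ y => simp only [liftSub, Vr.tr, Tm.bind_wk, h, Tm.tr_wk]
    · intro σ u
      simp only [Tm.weak, Tm.bind_wk, h']

theorem Tm.wk_bind_instSub {Γ : List (Ty B)} {α τ : Ty B} (t : Tm Γ τ) (u : Tm Γ α) :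
    (t.wk α).bind (instSub u) = t := by
  rw [Tm.wk, Tm.bind_ren]
  exact Tm.bind_var t

theorem Tm.tr_instSub {Γ : List (Ty B)} {α τ : Ty B} (t : Tm (α :: Γ) τ) (u : Tm Γ α) :
    (t.bind (instSub u)).tr κ ν = (t.tr κ ν).bind (instSub (u.tr κ ν)) := by
  apply Tm.tr_bind
  · intro σ y
    cases y with
    | zero => rfl
    | succ y => simp only [instSub, Vr.tr, Tm.wk_bind_instSub, Tm.tr]
  · intro σ v
    exact Tm.wk_bind_instSub _ _

/-- No conversion rule mentions a non-logical constant, so constants can be replaced by terms just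
as variables can. This puts `tr` on the quotient `Term`. -/
theorem Conv.tr {Γ : List (Ty B)} {τ : Ty B} {t t' : Tm Γ τ} (hc : Conv t t') :
    Conv (t.tr κ ν) (t'.tr κ ν) := by
  induction hc with
  | refl t => exact .refl _
  | symm _ ih => exact ih.symm
  | trans _ _ ih ih' => exact ih.trans ih'
  | inc e _ ih => exact .inc e ih
  | app _ _ ih ih' => exact .app ih ih'
  | lam hα _ ih => exact .lam hα ih
  | beta hα t u => rw [Tm.tr_instSub]; exact .beta hα _ _
  | eta hα t => simp only [Tm.tr, Tm.tr_wk]; exact .eta hα _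
  | incTop => exact .incTop
  | incAnd t u => exact .incAnd _ _
  | incOr t u => exact .incOr _ _
  | incSig hα t => exact .incSig hα _

variable {κ ν}

theorem Tm.tr_conv {κ' : ∀ τ : Ty B, Con τ → Tm [] τ} {ν' : ∀ τ : Ty B, LVar τ → Tm [] τ}
    {Γ : List (Ty B)} {τ : Ty B} (t : Tm Γ τ) (hκ : ∀ σ c, Conv (κ σ c) (κ' σ c))
    (hν : ∀ σ x, Conv (ν σ x) (ν' σ x)) : Conv (t.tr κ ν) (t.tr κ' ν') := by
  induction t with
  | var y =>
    simp only [Tm.tr]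
    induction y with
    | free x => exact hν _ x
    | zero => exact .refl _
    | succ y ih => exact ih.ren _
  | con c => exact (hκ _ c).weak _
  | lcon k => exact .refl _
  | inc e t ih => exact .inc e ih
  | app t u iht ihu => exact .app iht ihu
  | lam hα t ih => exact .lam hα ih

theorem Tm.tr_congr {κ' : ∀ τ : Ty B, Con τ → Tm [] τ} {ν' : ∀ τ : Ty B, LVar τ → Tm [] τ}
    {Γ : List (Ty B)} {τ : Ty B} (t : Tm Γ τ)
    (hκ : ∀ c : ACon B, t.HasCon c → κ c.1 c.2 = κ' c.1 c.2)
    (hν : ∀ x : AVar B, t.HasVar x → ν x.1 x.2 = ν' x.1 x.2) : t.tr κ ν = t.tr κ' ν' := by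
  induction t with
  | var y =>
    simp only [Tm.tr]
    induction y with
    | free x => exact hν ⟨_, x⟩ rfl
    | zero => rfl
    | succ y ih =>
      simp only [Vr.tr]
      rw [ih (fun c hc => hκ c hc) (fun x hx => hν x hx)]
  | con c => simp only [Tm.tr]; rw [hκ ⟨_, c⟩ rfl]
  | lcon k => rfl
  | inc e t ih => simp only [Tm.tr]; rw [ih hκ hν]
  | app t u iht ihu =>
    simp only [Tm.tr]
    rw [iht (fun c hc => hκ c (.inl hc)) (fun c hc => hν c (.inl hc)),
      ihu (fun c hc => hκ c (.inr hc)) (fun c hc => hν c (.inr hc))]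
  | lam hα t ih => simp only [Tm.tr]; rw [ih hκ hν]

theorem Tm.weak_con {τ : Ty B} (c : Con τ) : ∀ Γ : List (Ty B), (Tm.con c : Tm [] τ).weak Γ = .con c
  | [] => rfl
  | _ :: Γ => by rw [Tm.weak, Tm.weak_con c Γ]; rfl

theorem Vr.tr_var {Γ : List (Ty B)} {τ : Ty B} (y : Vr Γ τ) :
    y.tr (fun _ x => .var (.free x)) = .var y := by
  induction y with
  | free x => rfl
  | zero => rfl
  | succ y ih => rw [Vr.tr, ih]; rfl

/-- Exhibits ordinary substitution as the case of `tr` that keeps the constants, so that stability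
results need only be proved for `tr`. -/
theorem Tm.tr_con_eq_bind {Γ : List (Ty B)} {τ : Ty B} (t : Tm Γ τ) :
    t.tr (fun _ c => .con c) ν = t.bind (fun _ y => y.tr ν) := by
  induction t with
  | var y => rfl
  | con c => exact Tm.weak_con c _
  | lcon k => rfl
  | inc e t ih => simp only [Tm.tr, Tm.bind, ih]
  | app t u iht ihu => simp only [Tm.tr, Tm.bind, iht, ihu]
  | lam hα t ih =>
    simp only [Tm.tr, Tm.bind, ih]
    congr 2
    funext σ y
    cases y <;> rfl

theorem Tm.tr_id {Γ : List (Ty B)} {τ : Ty B} (t : Tm Γ τ) :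
    t.tr (fun _ c => .con c) (fun _ x => .var (.free x)) = t := by
  rw [Tm.tr_con_eq_bind]
  simp only [Vr.tr_var]
  exact Tm.bind_var t

theorem Tm.tr_weak {τ : Ty B} (t : Tm [] τ) : ∀ Γ : List (Ty B),
    (t.weak Γ).tr κ ν = (t.tr κ ν).weak Γ
  | [] => rfl
  | _ :: Γ => by rw [Tm.weak, Tm.tr_wk, Tm.tr_weak t Γ]; rfl

theorem Tm.tr_tr {κ' : ∀ τ : Ty B, Con τ → Tm [] τ} {ν' : ∀ τ : Ty B, LVar τ → Tm [] τ}
    {Γ : List (Ty B)} {τ : Ty B} (t : Tm Γ τ) :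
    (t.tr κ ν).tr κ' ν' =
      t.tr (fun _ c => (κ _ c).tr κ' ν') (fun _ x => (ν _ x).tr κ' ν') := by
  induction t with
  | var y =>
    simp only [Tm.tr]
    induction y with
    | free x => rfl
    | zero => rfl
    | succ y ih => simp only [Vr.tr, Tm.tr_wk, ih]
  | con c => exact Tm.tr_weak _ _
  | lcon k => rfl
  | inc e t ih => simp only [Tm.tr, ih]
  | app t u iht ihu => simp only [Tm.tr, iht, ihu]
  | lam hα t ih => simp only [Tm.tr, ih]

end Tr

/-! ### Occurrences and levels in raw terms -/

theorem Tm.hasVar_ren_succ {Γ : List (Ty B)} {τ : Ty B} {x : AVar B} (t : Tm Γ τ) :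
    ∀ {Δ : List (Ty B)} {ρ : ∀ σ, Vr Γ σ → Vr Δ σ}, (∀ σ (y : Vr Γ σ), (ρ σ y).Is x ↔ y.Is x) →
      ((t.ren ρ).HasVar x ↔ t.HasVar x) := by
  induction t with
  | var y => intro Δ ρ h; exact h _ y
  | con c => intros; rfl
  | lcon k => intros; rfl
  | inc e t ih => intro Δ ρ h; exact ih h
  | app t u iht ihu => intro Δ ρ h; exact or_congr (iht h) (ihu h)
  | lam hα t ih =>
    intro Δ ρ h
    refine ih fun σ y => ?_
    cases y with
    | zero => rfl
    | succ y => exact h _ y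

theorem Tm.hasVar_wk {Γ : List (Ty B)} {τ α : Ty B} {x : AVar B} (t : Tm Γ τ) :
    (t.wk α).HasVar x ↔ t.HasVar x :=
  Tm.hasVar_ren_succ t fun _ _ => Iff.rfl

theorem Tm.hasCon_ren {Γ : List (Ty B)} {τ : Ty B} {c : ACon B} (t : Tm Γ τ) :
    ∀ {Δ : List (Ty B)} {ρ : ∀ σ, Vr Γ σ → Vr Δ σ}, (t.ren ρ).HasCon c ↔ t.HasCon c := by
  induction t with
  | var y => intros; rfl
  | con c => intros; rfl
  | lcon k => intros; rfl
  | inc e t ih => intros; exact ih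
  | app t u iht ihu => intros; exact or_congr iht ihu
  | lam hα t ih => intros; exact ih

theorem Tm.levelLE_ren {Γ : List (Ty B)} {τ : Ty B} {i : ℕ} (t : Tm Γ τ) :
    ∀ {Δ : List (Ty B)} {ρ : ∀ σ, Vr Γ σ → Vr Δ σ},
      (∀ σ (y : Vr Γ σ), y.LevelLE i → (ρ σ y).LevelLE i) → t.LevelLE i → (t.ren ρ).LevelLE i := by
  induction t with
  | var y => intro Δ ρ h ht; exact h _ y ht
  | con c => intro Δ ρ _ ht; exact ht
  | lcon k => intros; trivial
  | inc e t ih => intro Δ ρ h ht; exact ih h ht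
  | app t u iht ihu => intro Δ ρ h ht; exact ⟨iht h ht.1, ihu h ht.2⟩
  | lam hα t ih =>
    intro Δ ρ h ht
    refine ih (fun σ y hy => ?_) ht
    cases y with
    | zero => trivial
    | succ y => exact h _ y hy

theorem Tm.levelLE_wk {Γ : List (Ty B)} {τ α : Ty B} {i : ℕ} {t : Tm Γ τ} (ht : t.LevelLE i) :
    (t.wk α).LevelLE i :=
  Tm.levelLE_ren t (fun _ _ h => h) ht

theorem Tm.levelLE_weak {τ : Ty B} {i : ℕ} {t : Tm [] τ} (ht : t.LevelLE i) :
    ∀ Γ : List (Ty B), (t.weak Γ).LevelLE i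
  | [] => ht
  | _ :: Γ => Tm.levelLE_wk (Tm.levelLE_weak ht Γ)

theorem Vr.LevelLE.mono {i j : ℕ} (hij : i ≤ j) {Γ : List (Ty B)} {τ : Ty B} {y : Vr Γ τ}
    (hy : y.LevelLE i) : y.LevelLE j := by
  induction y with
  | free x => exact le_trans hy hij
  | zero => trivial
  | succ y ih => exact ih hy

theorem Tm.LevelLE.mono {i j : ℕ} (hij : i ≤ j) {Γ : List (Ty B)} {τ : Ty B} {t : Tm Γ τ}
    (ht : t.LevelLE i) : t.LevelLE j := by
  induction t with
  | var y => exact Vr.LevelLE.mono hij ht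
  | con c => exact le_trans ht hij
  | lcon k => trivial
  | inc e t ih => exact ih ht
  | app t u iht ihu => exact ⟨iht ht.1, ihu ht.2⟩
  | lam hα t ih => exact ih ht

theorem Tm.levelLE_bind {Γ : List (Ty B)} {τ : Ty B} {i j : ℕ} (hij : i ≤ j) (t : Tm Γ τ) :
    ∀ {Δ : List (Ty B)} {s : ∀ σ, Vr Γ σ → Tm Δ σ},
      (∀ σ (y : Vr Γ σ), y.LevelLE i → (s σ y).LevelLE j) → t.LevelLE i → (t.bind s).LevelLE j := by
  induction t with
  | var y => intro Δ s h ht; exact h _ y ht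
  | con c => intro Δ s _ ht; exact le_trans ht hij
  | lcon k => intros; trivial
  | inc e t ih => intro Δ s h ht; exact ih h ht
  | app t u iht ihu => intro Δ s h ht; exact ⟨iht h ht.1, ihu h ht.2⟩
  | lam hα t ih =>
    intro Δ s h ht
    refine ih (fun σ y hy => ?_) ht
    cases y with
    | zero => trivial
    | succ y => exact Tm.levelLE_wk (h _ y hy)

theorem Tm.levelLE_tr {κ : ∀ τ : Ty B, Con τ → Tm [] τ} {ν : ∀ τ : Ty B, LVar τ → Tm [] τ}
    {Γ : List (Ty B)} {τ : Ty B} {i j : ℕ} (t : Tm Γ τ)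
    (hκ : ∀ σ (c : Con σ), c.level ≤ i → (κ σ c).LevelLE j)
    (hν : ∀ σ (x : LVar σ), x.level ≤ i → (ν σ x).LevelLE j) (ht : t.LevelLE i) :
    (t.tr κ ν).LevelLE j := by
  induction t with
  | var y =>
    simp only [Tm.tr]
    induction y with
    | free x => exact hν _ x ht
    | zero => trivial
    | succ y ih => exact Tm.levelLE_wk (ih ht)
  | con c => exact Tm.levelLE_weak (hκ _ c ht) _
  | lcon k => trivial
  | inc e t ih => exact ih ht
  | app t u iht ihu => exact ⟨iht ht.1, ihu ht.2⟩
  | lam hα t ih => exact ih ht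

theorem Tm.LevelLE.hasVar {Γ : List (Ty B)} {τ : Ty B} {i : ℕ} {t : Tm Γ τ} {x : AVar B}
    (ht : t.LevelLE i) (hx : t.HasVar x) : x.2.level ≤ i := by
  induction t with
  | var y =>
    induction y with
    | free z => cases hx; exact ht
    | zero => exact hx.elim
    | succ y ih => exact ih ht hx
  | con c => exact hx.elim
  | lcon k => exact hx.elim
  | inc e t ih => exact ih ht hx
  | app t u iht ihu => exact hx.elim (iht ht.1) (ihu ht.2)
  | lam hα t ih => exact ih ht hx

theorem Tm.LevelLE.hasCon {Γ : List (Ty B)} {τ : Ty B} {i : ℕ} {t : Tm Γ τ} {c : ACon B}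
    (ht : t.LevelLE i) (hc : t.HasCon c) : c.2.level ≤ i := by
  induction t with
  | var y => exact hc.elim
  | con d => cases hc; exact ht
  | lcon k => exact hc.elim
  | inc e t ih => exact ih ht hc
  | app t u iht ihu => exact hc.elim (iht ht.1) (ihu ht.2)
  | lam hα t ih => exact ih ht hc

theorem Tm.hasVar_weak {τ : Ty B} {x : AVar B} (t : Tm [] τ) :
    ∀ Γ : List (Ty B), (t.weak Γ).HasVar x ↔ t.HasVar x
  | [] => Iff.rfl
  | _ :: Γ => (Tm.hasVar_wk _).trans (Tm.hasVar_weak t Γ)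

theorem Tm.hasCon_weak {τ : Ty B} {c : ACon B} (t : Tm [] τ) :
    ∀ Γ : List (Ty B), (t.weak Γ).HasCon c ↔ t.HasCon c
  | [] => Iff.rfl
  | _ :: Γ => (Tm.hasCon_ren _).trans (Tm.hasCon_weak t Γ)

theorem Tm.hasVar_tr {κ : ∀ τ : Ty B, Con τ → Tm [] τ} {ν : ∀ τ : Ty B, LVar τ → Tm [] τ}
    {Γ : List (Ty B)} {τ : Ty B} {x : AVar B} (t : Tm Γ τ) (hx : (t.tr κ ν).HasVar x) :
    (∃ z : AVar B, t.HasVar z ∧ (ν z.1 z.2).HasVar x) ∨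
      ∃ c : ACon B, t.HasCon c ∧ (κ c.1 c.2).HasVar x := by
  induction t with
  | var y =>
    simp only [Tm.tr] at hx
    induction y with
    | free z => exact .inl ⟨⟨_, z⟩, rfl, hx⟩
    | zero => exact hx.elim
    | succ y ih => exact ih ((Tm.hasVar_wk _).1 hx)
  | con c => exact .inr ⟨⟨_, c⟩, rfl, (Tm.hasVar_weak _ _).1 hx⟩
  | lcon k => exact hx.elim
  | inc e t ih => exact ih hx
  | app t u iht ihu =>
    rcases hx with hx | hx
    · exact (iht hx).imp (fun ⟨z, h, h'⟩ => ⟨z, .inl h, h'⟩) (fun ⟨z, h, h'⟩ => ⟨z, .inl h, h'⟩)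
    · exact (ihu hx).imp (fun ⟨z, h, h'⟩ => ⟨z, .inr h, h'⟩) (fun ⟨z, h, h'⟩ => ⟨z, .inr h, h'⟩)
  | lam hα t ih => exact ih hx

theorem Tm.hasCon_tr {κ : ∀ τ : Ty B, Con τ → Tm [] τ} {ν : ∀ τ : Ty B, LVar τ → Tm [] τ}
    {Γ : List (Ty B)} {τ : Ty B} {d : ACon B} (t : Tm Γ τ) (hx : (t.tr κ ν).HasCon d) :
    (∃ z : AVar B, t.HasVar z ∧ (ν z.1 z.2).HasCon d) ∨
      ∃ c : ACon B, t.HasCon c ∧ (κ c.1 c.2).HasCon d := by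
  induction t with
  | var y =>
    simp only [Tm.tr] at hx
    induction y with
    | free z => exact .inl ⟨⟨_, z⟩, rfl, hx⟩
    | zero => exact hx.elim
    | succ y ih => exact ih ((Tm.hasCon_ren _).1 hx)
  | con c => exact .inr ⟨⟨_, c⟩, rfl, (Tm.hasCon_weak _ _).1 hx⟩
  | lcon k => exact hx.elim
  | inc e t ih => exact ih hx
  | app t u iht ihu =>
    rcases hx with hx | hx
    · exact (iht hx).imp (fun ⟨z, h, h'⟩ => ⟨z, .inl h, h'⟩) (fun ⟨z, h, h'⟩ => ⟨z, .inl h, h'⟩)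
    · exact (ihu hx).imp (fun ⟨z, h, h'⟩ => ⟨z, .inr h, h'⟩) (fun ⟨z, h, h'⟩ => ⟨z, .inr h, h'⟩)
  | lam hα t ih => exact ih hx

theorem Tm.bind_congr {Γ : List (Ty B)} {τ : Ty B} (t : Tm Γ τ) :
    ∀ {Δ : List (Ty B)} {s s' : ∀ σ, Vr Γ σ → Tm Δ σ},
      (∀ σ (y : Vr Γ σ), (∀ x, y.Is x → t.HasVar x) → s σ y = s' σ y) → t.bind s = t.bind s' := by
  induction t with
  | var y => intro Δ s s' h; exact h _ y fun _ hx => hx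
  | con c => intros; rfl
  | lcon k => intros; rfl
  | inc e t ih => intro Δ s s' h; simp only [Tm.bind]; rw [ih h]
  | app t u iht ihu =>
    intro Δ s s' h
    simp only [Tm.bind]
    rw [iht fun σ y hy => h σ y fun x hx => .inl (hy x hx),
      ihu fun σ y hy => h σ y fun x hx => .inr (hy x hx)]
  | lam hα t ih =>
    intro Δ s s' h
    simp only [Tm.bind]
    rw [ih fun σ y hy => ?_]
    cases y with
    | zero => rfl
    | succ y => simp only [liftSub]; rw [h _ y hy]

theorem Vr.is_unique {Γ : List (Ty B)} {τ : Ty B} {y : Vr Γ τ} {x x' : AVar B} (hx : y.Is x)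
    (hx' : y.Is x') : x = x' := by
  induction y with
  | free z => exact hx.symm.trans hx'
  | zero => exact hx.elim
  | succ y ih => exact ih hx hx'

theorem Tm.finite_hasVar {Γ : List (Ty B)} {τ : Ty B} (t : Tm Γ τ) :
    {x : AVar B | t.HasVar x}.Finite := by
  induction t with
  | var y => exact Set.Subsingleton.finite fun x hx x' hx' => Vr.is_unique hx hx'
  | con c => exact Set.finite_empty
  | lcon k => exact Set.finite_empty
  | inc e t ih => exact ih
  | app t u iht ihu => exact iht.union ihu
  | lam hα t ih => exact ih

theorem Tm.finite_hasCon {Γ : List (Ty B)} {τ : Ty B} (t : Tm Γ τ) :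
    {c : ACon B | t.HasCon c}.Finite := by
  induction t with
  | var y => exact Set.finite_empty
  | con c => exact Set.Subsingleton.finite fun x hx x' hx' => hx.symm.trans hx'
  | lcon k => exact Set.finite_empty
  | inc e t ih => exact ih
  | app t u iht ihu => exact iht.union ihu
  | lam hα t ih => exact ih

end Terms


/-! ### Terms modulo conversion and their translations. -/

section Terms

variable {B : Type u}

theorem Ty.VarTy.conTy {τ : Ty B} (h : τ.VarTy) : τ.ConTy := by
  induction τ with
  | arr α β _ ih => exact ⟨h.1, ih h.2⟩
  | _ => trivial

theorem Conv.equivalence (Γ : List (Ty B)) (τ : Ty B) :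
    Equivalence (Conv : Tm Γ τ → Tm Γ τ → Prop) :=
  ⟨Conv.refl, Conv.symm, Conv.trans⟩

namespace Term

variable {Γ Δ Θ : List (Ty B)} {σ τ α β : Ty B}

theorem mk_eq_mk {t t' : Tm Γ τ} : mk t = mk t' ↔ Conv t t' :=
  ⟨fun h => ((Conv.equivalence Γ τ).quot_mk_eq_iff t t').1 h, fun h => Quot.sound h⟩

theorem mk_out (q : Term Γ τ) : mk q.out = q := Quot.out_eq q

theorem bind_mk {s : ∀ σ, Vr Γ σ → Term Δ σ} {s' : ∀ σ, Vr Γ σ → Tm Δ σ}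
    (h : ∀ σ y, mk (s' σ y) = s σ y) (t : Tm Γ τ) : (mk t).bind s = mk (t.bind s') :=
  mk_eq_mk.2 (Tm.bind_conv t fun σ y => mk_eq_mk.1 ((mk_out _).trans (h σ y).symm))

theorem bind_bind (q : Term Γ τ) (s : ∀ σ, Vr Γ σ → Term Δ σ) (s' : ∀ σ, Vr Δ σ → Term Θ σ) :
    (q.bind s).bind s' = q.bind (fun σ y => (s σ y).bind s') := by
  induction q using Quot.ind with | mk t =>
  change (mk (t.bind fun σ y => (s σ y).out)).bind s' = (mk t).bind _
  rw [bind_mk (fun σ y => mk_out (s' σ y)), Tm.bind_bind, bind_mk]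
  intro σ y
  conv_rhs => rw [← mk_out (s σ y)]
  rfl

theorem bind_var (q : Term Γ τ) : q.bind (fun _ y => var y) = q := by
  induction q using Quot.ind with | mk t =>
  change (mk t).bind _ = mk t
  exact (bind_mk (s' := fun _ y => .var y) (fun _ _ => rfl) t).trans (congrArg mk (Tm.bind_var t))

theorem inst_mk (t : Tm (α :: Γ) β) (s : Tm Γ α) :
    (mk t).inst (mk s) = mk (t.bind (instSub s)) := by
  apply bind_mk
  intro σ y
  cases y <;> rfl

theorem beta (hα : α.VarTy) (q : Term (α :: Γ) β) (s : Term Γ α) :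
    app (lam hα q) s = q.inst s := by
  induction q using Quot.ind with | mk t =>
  induction s using Quot.ind with | mk s =>
  exact (mk_eq_mk.2 (.beta hα t s)).trans (inst_mk t s).symm

/-- Simultaneous replacement of the constants and of the logic variables by closed terms. -/
noncomputable def tr (κ : ∀ τ : Ty B, Con τ → CTerm τ) (ν : Subst B) : Term Γ τ → Term Γ τ :=
  Quot.map (Tm.tr (fun _ c => (κ _ c).out) (fun _ x => (ν _ x).out)) (fun _ _ hc => hc.tr _ _)

variable {κ κ' : ∀ τ : Ty B, Con τ → CTerm τ} {ν ν' : Subst B}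

theorem tr_mk {κ₀ : ∀ τ : Ty B, Con τ → Tm [] τ} {ν₀ : ∀ τ : Ty B, LVar τ → Tm [] τ}
    (hκ : ∀ τ c, mk (κ₀ τ c) = κ τ c) (hν : ∀ τ x, mk (ν₀ τ x) = ν τ x) (t : Tm Γ τ) :
    (mk t).tr κ ν = mk (t.tr κ₀ ν₀) :=
  mk_eq_mk.2 (Tm.tr_conv t (fun _ c => mk_eq_mk.1 ((mk_out _).trans (hκ _ c).symm))
    (fun _ x => mk_eq_mk.1 ((mk_out _).trans (hν _ x).symm)))

theorem tr_app (q : Term Γ (.arr α β)) (r : Term Γ α) :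
    (app q r).tr κ ν = app (q.tr κ ν) (r.tr κ ν) := by
  induction q using Quot.ind
  induction r using Quot.ind
  rfl

theorem tr_inc (e : Incl σ τ) (q : Term Γ σ) : (inc e q).tr κ ν = inc e (q.tr κ ν) := by
  induction q using Quot.ind
  rfl

theorem tr_lam (hα : α.VarTy) (q : Term (α :: Γ) β) :
    (lam hα q).tr κ ν = lam hα (q.tr κ ν) := by
  induction q using Quot.ind
  rfl

theorem tr_lcon (k : LCon τ) : (lcon k : Term Γ τ).tr κ ν = lcon k := rfl

theorem tr_con (c : Con τ) : (con c : CTerm τ).tr κ ν = κ τ c := mk_out _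

theorem tr_free (x : LVar τ) : (var (.free x) : CTerm τ).tr κ ν = ν τ x := mk_out _

theorem tr_inst (q : Term (α :: Γ) β) (s : Term Γ α) :
    (q.inst s).tr κ ν = (q.tr κ ν).inst (s.tr κ ν) := by
  induction q using Quot.ind with | mk t =>
  induction s using Quot.ind with | mk s =>
  change ((mk t).inst (mk s)).tr κ ν = (mk (t.tr _ _)).inst (mk (s.tr _ _))
  rw [inst_mk, inst_mk, ← Tm.tr_instSub]
  rfl

theorem tr_tr (q : Term Γ τ) : (q.tr κ ν).tr κ' ν' =
    q.tr (fun _ c => (κ _ c).tr κ' ν') (fun _ x => (ν _ x).tr κ' ν') := by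
  induction q using Quot.ind with | mk t =>
  change (mk (t.tr _ _)).tr κ' ν' = (mk t).tr _ _
  rw [tr_mk (fun _ c => mk_out (κ' _ c)) (fun _ x => mk_out (ν' _ x)), Tm.tr_tr, tr_mk]
  · intro σ c
    conv_rhs => rw [← mk_out (κ σ c)]
    rfl
  · intro σ x
    conv_rhs => rw [← mk_out (ν σ x)]
    rfl

theorem tr_id (q : Term Γ τ) : q.tr (fun _ c => con c) Subst.id = q := by
  induction q using Quot.ind with | mk t =>
  change (mk t).tr _ _ = mk t
  exact (tr_mk (κ₀ := fun _ c => .con c) (ν₀ := fun _ x => .var (.free x)) (fun _ _ => rfl)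
    (fun _ _ => rfl) t).trans (congrArg mk (Tm.tr_id t))

/-! ### Levels of terms -/

theorem LevelLE.mono {i j : ℕ} (hij : i ≤ j) {q : Term Γ τ} : q.LevelLE i → q.LevelLE j
  | ⟨t, h, h'⟩ => ⟨t, h, h'.mono hij⟩

theorem levelLE_lcon (i : ℕ) (k : LCon τ) : (lcon k : Term Γ τ).LevelLE i := ⟨_, rfl, trivial⟩

theorem levelLE_var {i : ℕ} {y : Vr Γ τ} (hy : y.LevelLE i) : (var y).LevelLE i := ⟨_, rfl, hy⟩

theorem levelLE_con {i : ℕ} {c : Con τ} (hc : c.level ≤ i) : (con c : Term Γ τ).LevelLE i :=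
  ⟨_, rfl, hc⟩

theorem LevelLE.app {i : ℕ} {q : Term Γ (.arr α β)} {r : Term Γ α} :
    q.LevelLE i → r.LevelLE i → (q.app r).LevelLE i
  | ⟨t, h, h'⟩, ⟨s, hs, hs'⟩ => ⟨.app t s, by rw [← h, ← hs]; rfl, h', hs'⟩

theorem LevelLE.inc {i : ℕ} (e : Incl σ τ) {q : Term Γ σ} : q.LevelLE i → (inc e q).LevelLE i
  | ⟨t, h, h'⟩ => ⟨.inc e t, by rw [← h]; rfl, h'⟩

theorem LevelLE.lam {i : ℕ} (hα : α.VarTy) {q : Term (α :: Γ) β} :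
    q.LevelLE i → (lam hα q).LevelLE i
  | ⟨t, h, h'⟩ => ⟨.lam hα t, by rw [← h]; rfl, h'⟩

/-- Level bounds and non-occurrence assert the existence of a good representative; here these are
chosen for a whole family at once. Where `P` fails, any representative will do. -/
theorem exists_rep_family {ι : Ty B → Type*} {Δ : Ty B → List (Ty B)}
    (f : ∀ τ, ι τ → Term (Δ τ) τ) {P : ∀ τ, ι τ → Prop} {Q : ∀ τ, Tm (Δ τ) τ → Prop}
    (h : ∀ τ x, P τ x → ∃ t, mk t = f τ x ∧ Q τ t) :
    ∃ f₀ : ∀ τ, ι τ → Tm (Δ τ) τ, (∀ τ x, mk (f₀ τ x) = f τ x) ∧ ∀ τ x, P τ x → Q τ (f₀ τ x) := by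
  have h' : ∀ τ x, ∃ t, mk t = f τ x ∧ (P τ x → Q τ t) := by
    intro τ x
    by_cases hP : P τ x
    · obtain ⟨t, ht, ht'⟩ := h τ x hP
      exact ⟨t, ht, fun _ => ht'⟩
    · exact ⟨(f τ x).out, mk_out _, fun h => absurd h hP⟩
  choose f₀ h₁ h₂ using h'
  exact ⟨f₀, h₁, h₂⟩

theorem LevelLE.bind {i j : ℕ} (hij : i ≤ j) {q : Term Γ τ} {s : ∀ σ, Vr Γ σ → Term Δ σ}
    (hq : q.LevelLE i) (hs : ∀ σ (y : Vr Γ σ), y.LevelLE i → (s σ y).LevelLE j) :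
    (q.bind s).LevelLE j := by
  obtain ⟨t, rfl, ht⟩ := hq
  obtain ⟨s', hs₁, hs₂⟩ := exists_rep_family (Δ := fun _ => Δ) s hs
  exact ⟨_, (bind_mk hs₁ t).symm, Tm.levelLE_bind hij t hs₂ ht⟩

theorem LevelLE.inst {i : ℕ} {q : Term (α :: Γ) β} {s : Term Γ α} (hq : q.LevelLE i)
    (hs : s.LevelLE i) : (q.inst s).LevelLE i := by
  refine hq.bind le_rfl fun σ y hy => ?_
  cases y with
  | zero => exact hs
  | succ y => exact levelLE_var hy

theorem LevelLE.tr {i j : ℕ} {q : Term Γ τ} (hq : q.LevelLE i)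
    (hκ : ∀ σ (c : Con σ), c.level ≤ i → (κ σ c).LevelLE j)
    (hν : ∀ σ (x : LVar σ), x.level ≤ i → (ν σ x).LevelLE j) : (q.tr κ ν).LevelLE j := by
  obtain ⟨t, rfl, ht⟩ := hq
  obtain ⟨κ₀, hκ₁, hκ₂⟩ := exists_rep_family (Δ := fun _ => []) κ hκ
  obtain ⟨ν₀, hν₁, hν₂⟩ := exists_rep_family (Δ := fun _ => []) ν hν
  exact ⟨_, (tr_mk hκ₁ hν₁ t).symm, Tm.levelLE_tr t hκ₂ hν₂ ht⟩

/-- Some representative has only symbols of level at most `i`, so the treatment of symbols of higher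
level, such as a generic constant, is irrelevant. -/
theorem LevelLE.tr_congr {i : ℕ} {q : Term Γ τ} (hq : q.LevelLE i)
    (hκ : ∀ σ (c : Con σ), c.level ≤ i → κ σ c = κ' σ c)
    (hν : ∀ σ (x : LVar σ), x.level ≤ i → ν σ x = ν' σ x) : q.tr κ ν = q.tr κ' ν' := by
  obtain ⟨t, rfl, ht⟩ := hq
  refine congrArg mk (Tm.tr_congr t (fun c hc => ?_) (fun x hx => ?_))
  · rw [hκ _ _ (ht.hasCon hc)]
  · rw [hν _ _ (ht.hasVar hx)]

/-! ### Free variables and constants of terms -/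

/-- As `fv` is an intersection over all representatives, a single one attaining it has to be found;
no normal forms are needed. If `x` occurs in `t` but not in another representative, replacing `x` by
a constant in both leaves the latter unchanged. The result is thus still convertible to it and has
fewer variables than `t`. -/
theorem exists_rep_fv (q : Term Γ τ) : ∃ t, mk t = q ∧ ∀ x, t.HasVar x → x ∈ q.fv := by
  classical
  have key : ∀ (n : ℕ) (t : Tm Γ τ), mk t = q → {x | t.HasVar x}.ncard ≤ n →
      ∃ t, mk t = q ∧ ∀ x, t.HasVar x → x ∈ q.fv := by
    intro n
    induction n with
    | zero =>
      intro t ht hn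
      refine ⟨t, ht, fun x hx => ?_⟩
      have := (Set.ncard_eq_zero t.finite_hasVar).1 (Nat.le_zero.1 hn)
      exact (Set.eq_empty_iff_forall_notMem.1 this x hx).elim
    | succ n ih =>
      intro t ht hn
      by_cases h : ∀ x, t.HasVar x → x ∈ q.fv
      · exact ⟨t, ht, h⟩
      push Not at h
      obtain ⟨x, hx, hxq⟩ := h
      obtain ⟨t₁, ht₁, hxt₁⟩ : ∃ t₁, mk t₁ = q ∧ ¬ t₁.HasVar x := by
        simpa [fv] using hxq
      -- A constant of the required type exists because every variable type is a constant type; its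
      -- level and index are immaterial.
      let ν₀ : ∀ τ : Ty B, LVar τ → Tm [] τ := fun τ z =>
        if (⟨τ, z⟩ : AVar B) = x then .con ⟨0, 0, z.ok.conTy⟩ else .var (.free z)
      have hc : Conv (t.tr (fun _ c => .con c) ν₀) (t₁.tr (fun _ c => .con c) ν₀) :=
        (mk_eq_mk.1 (ht.trans ht₁.symm)).tr _ _
      have h₁ : t₁.tr (fun _ c => .con c) ν₀ = t₁ := by
        conv_rhs => rw [← Tm.tr_id t₁]
        refine Tm.tr_congr t₁ (fun _ _ => rfl) fun z hz => if_neg ?_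
        rintro rfl
        exact hxt₁ hz
      refine ih (t.tr (fun _ c => .con c) ν₀) ?_ ?_
      · rw [h₁] at hc
        rw [← ht₁]
        exact mk_eq_mk.2 hc
      · have hlt : {y | (t.tr (fun _ c => .con c) ν₀).HasVar y}.ncard < {y | t.HasVar y}.ncard := by
          refine Set.ncard_lt_ncard ?_ t.finite_hasVar
          have hz : ∀ y, (t.tr (fun _ c => .con c) ν₀).HasVar y → t.HasVar y ∧ y ≠ x := by
            intro y hy
            rcases Tm.hasVar_tr t hy with ⟨z, hz, hzy⟩ | ⟨c, -, hc⟩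
            · by_cases hzx : z = x
              · simp only [ν₀, if_pos hzx] at hzy
                exact hzy.elim
              · simp only [ν₀, if_neg hzx] at hzy
                have hzy' : z = y := hzy
                exact ⟨hzy' ▸ hz, hzy' ▸ hzx⟩
            · exact hc.elim
          exact ⟨fun y hy => (hz y hy).1, fun hsub => (hz x (hsub hx)).2 rfl⟩
        omega
  obtain ⟨t, ht⟩ := q.exists_rep
  exact key _ t ht le_rfl

theorem finite_fv (q : Term Γ τ) : q.fv.Finite := by
  refine (Tm.finite_hasVar q.out).subset fun x hx => hx _ (mk_out q)

theorem finite_oc (q : Term Γ τ) : q.oc.Finite := by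
  refine (Tm.finite_hasCon q.out).subset fun x hx => hx _ (mk_out q)

theorem fv_var_subset (x : LVar τ) : (var (.free x) : CTerm τ).fv ⊆ {⟨τ, x⟩} :=
  fun _ hz => (hz _ rfl : (⟨τ, x⟩ : AVar B) = _).symm

theorem oc_var (x : LVar τ) : (var (.free x) : CTerm τ).oc = ∅ :=
  Set.eq_empty_iff_forall_notMem.2 fun _ hc => hc _ rfl

theorem tr_congr_fv (q : Term Γ τ) (h : ∀ x ∈ q.fv, ν x.1 x.2 = ν' x.1 x.2) :
    q.tr κ ν = q.tr κ ν' := by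
  obtain ⟨t, rfl, ht⟩ := q.exists_rep_fv
  refine congrArg mk (Tm.tr_congr t (fun _ _ => rfl) (fun x hx => ?_))
  rw [h x (ht x hx)]

theorem fv_tr_subset (q : Term Γ τ) :
    (q.tr (fun _ c => con c) ν).fv ⊆ ⋃ x ∈ q.fv, (ν x.1 x.2).fv := by
  intro z hz
  by_contra hcon
  simp only [Set.mem_iUnion, not_exists] at hcon
  obtain ⟨t, rfl, ht⟩ := q.exists_rep_fv
  obtain ⟨ν₀, hν₁, hν₂⟩ := exists_rep_family (Δ := fun _ => [])
    (P := fun τ x => (⟨τ, x⟩ : AVar B) ∈ (mk t).fv) (Q := fun _ t => ¬ t.HasVar z) ν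
    (fun τ x hx => by simpa [fv] using hcon ⟨τ, x⟩ hx)
  have := hz _ (tr_mk (κ₀ := fun _ c => .con c) (fun _ _ => rfl) hν₁ t).symm
  rcases Tm.hasVar_tr t this with ⟨y, hy, hyz⟩ | ⟨c, -, hc⟩
  · exact hν₂ _ _ (ht y hy) hyz
  · exact hc

theorem notMem_oc_tr {c : ACon B} (q : Term Γ τ) (hq : c ∉ q.oc)
    (hν : ∀ τ x, c ∉ (ν τ x).oc) : c ∉ (q.tr (fun _ c => con c) ν).oc := by
  intro hc
  obtain ⟨t, rfl, ht⟩ : ∃ t, mk t = q ∧ ¬ t.HasCon c := by simpa [oc] using hq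
  obtain ⟨ν₀, hν₁, hν₂⟩ := exists_rep_family (Δ := fun _ => [])
    (P := fun _ _ => True) (Q := fun _ t => ¬ t.HasCon c) ν
    (fun τ x _ => by simpa [oc] using hν τ x)
  have := hc _ (tr_mk (κ₀ := fun _ c => .con c) (fun _ _ => rfl) hν₁ t).symm
  rcases Tm.hasCon_tr t this with ⟨y, hy, hyz⟩ | ⟨d, hd, hdc⟩
  · exact hν₂ _ _ trivial hyz
  · have hdc' : d = c := hdc
    exact ht (hdc' ▸ hd)

theorem bind_congr_fv (q : Term Γ τ) {s s' : ∀ σ, Vr Γ σ → Term Δ σ}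
    (h : ∀ σ (y : Vr Γ σ), (∀ x, y.Is x → x ∈ q.fv) → s σ y = s' σ y) :
    q.bind s = q.bind s' := by
  obtain ⟨t, rfl, ht⟩ := q.exists_rep_fv
  refine congrArg mk (Tm.bind_congr t fun σ y hy => ?_)
  rw [h σ y fun x hx => ht x (hy x hx)]

end Term

/-! ### Substitutions -/

namespace Subst

theorem apply_eq_tr (θ : Subst B) {τ : Ty B} (q : CTerm τ) :
    θ.apply q = q.tr (fun _ c => Term.con c) θ := by
  induction q using Quot.ind with | mk t =>
  change (Term.mk t).bind _ = (Term.mk t).tr _ _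
  refine Eq.trans ?_ (Term.tr_mk (κ₀ := fun _ c => .con c) (fun _ _ => rfl)
    (fun _ x => Term.mk_out (θ _ x)) t).symm
  rw [Tm.tr_con_eq_bind]
  apply Term.bind_mk
  intro σ y
  cases y
  exact Term.mk_out _

theorem apply_id {τ : Ty B} (q : CTerm τ) : Subst.id.apply q = q := by
  rw [apply_eq_tr, Term.tr_id]

theorem apply_comp (θ γ : Subst B) {τ : Ty B} (q : CTerm τ) :
    (θ.comp γ).apply q = γ.apply (θ.apply q) := by
  simp only [apply_eq_tr, Term.tr_tr, Term.tr_con]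
  congr 1
  funext σ x
  exact apply_eq_tr γ _

theorem apply_var (θ : Subst B) {τ : Ty B} (x : LVar τ) :
    θ.apply (Term.var (.free x)) = θ τ x := by
  rw [apply_eq_tr, Term.tr_free]

theorem apply_congr {θ θ' : Subst B} {τ : Ty B} (q : CTerm τ)
    (h : ∀ x ∈ q.fv, θ x.1 x.2 = θ' x.1 x.2) : θ.apply q = θ'.apply q := by
  rw [apply_eq_tr, apply_eq_tr, Term.tr_congr_fv q h]

theorem id_comp (θ : Subst B) : Subst.id.comp θ = θ := by
  funext τ x
  exact apply_var θ x

theorem comp_id (θ : Subst B) : θ.comp Subst.id = θ := by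
  funext τ x
  exact apply_id _

theorem dom_id : (Subst.id : Subst B).dom = ∅ :=
  Set.eq_empty_iff_forall_notMem.2 fun _ h => h rfl

theorem oc_id : (Subst.id : Subst B).oc = ∅ := by
  simp [oc, dom_id]

theorem legal_id : (Subst.id : Subst B).Legal :=
  ⟨by rw [dom_id]; exact Set.finite_empty, fun _ _ => Term.levelLE_var le_rfl⟩

theorem Legal.levelLE {θ : Subst B} (hθ : θ.Legal) {τ : Ty B} {i : ℕ} {x : LVar τ}
    (hx : x.level ≤ i) : (θ τ x).LevelLE i := (hθ.2 τ x).mono hx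

theorem Legal.apply {θ : Subst B} (hθ : θ.Legal) {τ : Ty B} {i : ℕ} {q : CTerm τ}
    (hq : q.LevelLE i) : (θ.apply q).LevelLE i := by
  rw [apply_eq_tr]
  exact hq.tr (fun _ _ => Term.levelLE_con) (fun _ _ => hθ.levelLE)

theorem Legal.comp {θ γ : Subst B} (hθ : θ.Legal) (hγ : γ.Legal) : (θ.comp γ).Legal := by
  refine ⟨(hθ.1.union hγ.1).subset fun x hx => ?_, fun τ x => hγ.apply (hθ.2 τ x)⟩
  by_contra h
  simp only [Set.mem_union, not_or, dom, Set.mem_ofPred_eq, not_not] at h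
  refine hx ?_
  change γ.apply (θ x.1 x.2) = _
  rw [h.1]
  exact (apply_var γ x.2).trans h.2

theorem restrict_of_mem {θ : Subst B} {X : Set (AVar B)} {τ : Ty B} {x : LVar τ}
    (hx : (⟨τ, x⟩ : AVar B) ∈ X) : θ.restrict X τ x = θ τ x := if_pos hx

theorem restrict_of_notMem {θ : Subst B} {X : Set (AVar B)} {τ : Ty B} {x : LVar τ}
    (hx : (⟨τ, x⟩ : AVar B) ∉ X) : θ.restrict X τ x = Term.var (.free x) := if_neg hx

theorem Legal.restrict {θ : Subst B} (hθ : θ.Legal) (X : Set (AVar B)) : (θ.restrict X).Legal := by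
  refine ⟨hθ.1.subset fun x hx h => hx ?_, fun τ x => ?_⟩
  · by_cases hX : x ∈ X
    · exact (restrict_of_mem hX).trans h
    · exact restrict_of_notMem hX
  · by_cases hX : (⟨τ, x⟩ : AVar B) ∈ X
    · rw [restrict_of_mem hX]
      exact hθ.2 τ x
    · rw [restrict_of_notMem hX]
      exact Term.levelLE_var le_rfl

theorem Legal.finite_fv {θ : Subst B} (hθ : θ.Legal) : θ.fv.Finite :=
  hθ.1.union (hθ.1.biUnion fun _ _ => Term.finite_fv _)

theorem Legal.finite_oc {θ : Subst B} (hθ : θ.Legal) : θ.oc.Finite :=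
  hθ.1.biUnion fun _ _ => Term.finite_oc _

theorem fv_value_subset (θ : Subst B) {τ : Ty B} (x : LVar τ) :
    (θ τ x).fv ⊆ θ.fv ∪ {⟨τ, x⟩} := by
  by_cases hx : (⟨τ, x⟩ : AVar B) ∈ θ.dom
  · exact fun z hz => .inl (.inr (Set.mem_iUnion₂.2 ⟨_, hx, hz⟩))
  · have : θ τ x = Term.var (.free x) := not_not.1 hx
    rw [this]
    exact (Term.fv_var_subset x).trans Set.subset_union_right

theorem oc_value_subset (θ : Subst B) {τ : Ty B} (x : LVar τ) : (θ τ x).oc ⊆ θ.oc := by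
  by_cases hx : (⟨τ, x⟩ : AVar B) ∈ θ.dom
  · exact fun z hz => Set.mem_iUnion₂.2 ⟨_, hx, hz⟩
  · have : θ τ x = Term.var (.free x) := not_not.1 hx
    rw [this, Term.oc_var]
    exact Set.empty_subset _

theorem oc_apply_subset (θ : Subst B) {τ : Ty B} (q : CTerm τ) :
    (θ.apply q).oc ⊆ q.oc ∪ θ.oc := by
  intro c hc
  by_contra h
  simp only [Set.mem_union, not_or] at h
  rw [apply_eq_tr] at hc
  exact Term.notMem_oc_tr q h.1 (fun τ x hx => h.2 (oc_value_subset θ x hx)) hc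

theorem fv_apply_subset (θ : Subst B) {τ : Ty B} (q : CTerm τ) :
    (θ.apply q).fv ⊆ θ.fv ∪ q.fv := by
  rw [apply_eq_tr]
  refine (Term.fv_tr_subset q).trans (Set.iUnion₂_subset fun x hx => ?_)
  refine (fv_value_subset θ x.2).trans (Set.union_subset_union_right _ ?_)
  rintro _ rfl
  exact hx

end Subst

end Terms


section Terms

variable {B : Type u}

/-! ### Closing environments -/

/-- Values for the bound variables of a context. -/
inductive Env (F : Ty B → Type u) : List (Ty B) → Type u
  | nil : Env F []
  | cons {Γ : List (Ty B)} {α : Ty B} (t : F α) (e : Env F Γ) : Env F (α :: Γ)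

/-- The values of all variables of a context, given those of the logic variables. -/
def Env.get {F : Ty B → Type u} (v : ∀ τ, LVar τ → F τ) :
    ∀ {Γ : List (Ty B)}, Env F Γ → ∀ σ, Vr Γ σ → F σ
  | _, .nil, _, .free x => v _ x
  | _, .cons t _, _, .zero => t
  | _, .cons _ e, _, .succ y => e.get v _ y

def Env.map {F F' : Ty B → Type u} (g : ∀ τ, F τ → F' τ) :
    ∀ {Γ : List (Ty B)}, Env F Γ → Env F' Γ
  | _, .nil => .nil
  | _, .cons t e => .cons (g _ t) (e.map g)

theorem Env.get_map {F F' : Ty B → Type u} {v : ∀ τ, LVar τ → F τ} {v' : ∀ τ, LVar τ → F' τ}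
    (g : ∀ τ, F τ → F' τ) (hv : ∀ τ x, v' τ x = g τ (v τ x)) {Γ : List (Ty B)} (e : Env F Γ) :
    ∀ (σ : Ty B) (y : Vr Γ σ), (e.map g).get v' σ y = g σ (e.get v σ y) := by
  induction e with
  | nil => intro σ y; cases y; exact hv _ _
  | cons t e ih =>
    intro σ y
    cases y with
    | zero => rfl
    | succ y => exact ih _ y

theorem Env.exists_map_mk {Γ : List (Ty B)} (e : Env CTerm Γ) :
    ∃ e₀ : Env (Tm []) Γ, e₀.map (fun _ => Term.mk) = e := by
  induction e with
  | nil => exact ⟨.nil, rfl⟩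
  | cons t e ih =>
    obtain ⟨e₀, rfl⟩ := ih
    exact ⟨.cons t.out e₀, by simp only [Env.map, Term.mk_out]⟩

/-- The substitution of raw terms given by an environment. -/
abbrev Env.raw {Γ : List (Ty B)} (e : Env (Tm []) Γ) : ∀ σ, Vr Γ σ → Tm [] σ :=
  e.get fun _ x => .var (.free x)

/-- The substitution given by an environment. -/
abbrev Env.sub {Γ : List (Ty B)} (e : Env CTerm Γ) : ∀ σ, Vr Γ σ → CTerm σ :=
  e.get fun _ x => Term.var (.free x)

theorem Env.raw_nil : (Env.nil : Env (Tm (B := B) []) []).raw = fun _ y => .var y := by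
  funext σ y
  cases y
  rfl

theorem Env.sub_nil : (Env.nil : Env (CTerm (B := B)) []).sub = fun _ y => Term.var y := by
  funext σ y
  cases y
  rfl

theorem Env.wk_bind_raw {Γ : List (Ty B)} {α τ : Ty B} (t : Tm [] α) (e : Env (Tm []) Γ)
    (u : Tm Γ τ) : (u.wk α).bind (Env.cons t e).raw = u.bind e.raw := by
  rw [Tm.wk, Tm.bind_ren]
  rfl

theorem Env.weak_bind_raw {τ : Ty B} (u : Tm [] τ) {Γ : List (Ty B)} (e : Env (Tm []) Γ) :
    (u.weak Γ).bind e.raw = u := by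
  induction e with
  | nil => rw [Env.raw_nil]; exact Tm.bind_var u
  | cons t e ih => exact (Env.wk_bind_raw t e _).trans ih

theorem Env.tr_raw (κ : ∀ τ : Ty B, Con τ → Tm [] τ) (ν : ∀ τ : Ty B, LVar τ → Tm [] τ)
    {Γ : List (Ty B)} (e : Env (Tm []) Γ) : ∀ (σ : Ty B) (y : Vr Γ σ),
      (e.raw σ y).tr κ ν = (y.tr ν).bind (e.map fun _ t => t.tr κ ν).raw := by
  induction e with
  | nil =>
    intro σ y
    cases y
    change _ = Tm.bind Env.nil.raw _
    rw [Env.raw_nil, Tm.bind_var]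
    rfl
  | cons t e ih =>
    intro σ y
    cases y with
    | zero => rfl
    | succ y => exact (ih _ y).trans (Env.wk_bind_raw _ _ _).symm

theorem Tm.tr_bind_raw (κ : ∀ τ : Ty B, Con τ → Tm [] τ) (ν : ∀ τ : Ty B, LVar τ → Tm [] τ)
    {Γ : List (Ty B)} {τ : Ty B} (t : Tm Γ τ) (e : Env (Tm []) Γ) :
    (t.bind e.raw).tr κ ν = (t.tr κ ν).bind (e.map fun _ t => t.tr κ ν).raw :=
  Tm.tr_bind κ ν t _ _ (Env.tr_raw κ ν e) fun _ u => Env.weak_bind_raw u _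

namespace Term

variable {Γ Δ : List (Ty B)} {σ τ α β : Ty B}

/-- Replacement of the bound variables by the values in an environment. -/
noncomputable def close (e : Env CTerm Γ) (q : Term Γ τ) : CTerm τ := q.bind e.sub

theorem close_mk (e : Env (Tm []) Γ) (t : Tm Γ τ) :
    (mk t).close (e.map fun _ => mk) = mk (t.bind e.raw) :=
  bind_mk (fun σ y => (Env.get_map (fun _ => mk) (fun _ _ => rfl) e σ y).symm) t

theorem close_nil (q : CTerm τ) : q.close .nil = q := by
  rw [close, Env.sub_nil, bind_var]

theorem close_app (e : Env CTerm Γ) (q : Term Γ (.arr α β)) (r : Term Γ α) :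
    (app q r).close e = app (q.close e) (r.close e) := by
  induction q using Quot.ind
  induction r using Quot.ind
  rfl

theorem close_inc (e : Env CTerm Γ) (ε : Incl σ τ) (q : Term Γ σ) :
    (inc ε q).close e = inc ε (q.close e) := by
  induction q using Quot.ind
  rfl

theorem close_lcon (e : Env CTerm Γ) (k : LCon τ) : (lcon k : Term Γ τ).close e = lcon k := rfl

/-- Allows a clause to be instantiated one quantifier at a time: the new head of the environment is
the argument of a β-redex. -/
theorem app_close_lam (e : Env CTerm Γ) (hα : α.VarTy) (q : Term (α :: Γ) β) (t : CTerm α) :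
    app ((lam hα q).close e) t = q.close (.cons t e) := by
  obtain ⟨e, rfl⟩ := e.exists_map_mk
  induction q using Quot.ind with | mk q =>
  induction t using Quot.ind with | mk t =>
  have h₁ : (lam hα (mk q)).close (e.map fun _ => mk) = mk (.lam hα (q.bind (liftSub e.raw α))) :=
    close_mk e (.lam hα q)
  have h₂ : (mk q).close (.cons (mk t) (e.map fun _ => mk)) = mk (q.bind (Env.cons t e).raw) :=
    close_mk (.cons t e) q
  change app ((lam hα (mk q)).close _) (mk t) = (mk q).close (.cons (mk t) _)
  rw [h₁, h₂]
  refine (mk_eq_mk.2 (Conv.beta hα _ t)).trans (congrArg mk ?_)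
  rw [Tm.bind_bind]
  congr 1
  funext σ y
  cases y with
  | zero => rfl
  | succ y => exact Tm.wk_bind_instSub _ _

variable {κ : ∀ τ : Ty B, Con τ → CTerm τ} {ν : Subst B}

theorem tr_close (q : Term Γ τ) (e : Env CTerm Γ) :
    (q.close e).tr κ ν = (q.tr κ ν).close (e.map fun _ t => t.tr κ ν) := by
  obtain ⟨e, rfl⟩ := e.exists_map_mk
  induction q using Quot.ind with | mk q =>
  change ((mk q).close _).tr κ ν = ((mk q).tr κ ν).close _
  rw [close_mk]
  change mk ((q.bind e.raw).tr _ _) = (mk (q.tr _ _)).close _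
  have h : ((e.map fun _ => mk).map fun _ t => t.tr κ ν) = (e.map fun _ t =>
      Tm.tr (fun _ c => (κ _ c).out) (fun _ x => (ν _ x).out) t).map fun _ => mk := by
    clear q
    induction e with
    | nil => rfl
    | cons t e ih => simp only [Env.map, ih]; rfl
  rw [h, close_mk, Tm.tr_bind_raw]

theorem LevelLE.close {i : ℕ} {q : Term Γ τ} {e : Env CTerm Γ} (hq : q.LevelLE i)
    (he : ∀ σ (y : Vr Γ σ), y.LevelLE i → (e.sub σ y).LevelLE i) : (q.close e).LevelLE i :=
  hq.bind le_rfl he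

/-- Renaming a clause apart and then applying the unifier amounts to applying the unifier under the
quantifiers and then instantiating these by the values of the fresh variables. -/
theorem apply_renFree {γ : Subst B} {δ : ∀ σ, Vr Γ σ → LVar σ} {e : Env CTerm Γ} (q : Term Γ τ)
    (h : ∀ σ y, γ σ (δ σ y) = ((var y).tr (fun _ c => con c) γ).close e) :
    γ.apply (q.renFree δ) = (q.tr (fun _ c => con c) γ).close e := by
  obtain ⟨e, rfl⟩ := e.exists_map_mk
  induction q using Quot.ind with | mk q =>
  have hκ : ∀ (τ : Ty B) (c : Con τ), mk (.con c : Tm [] τ) = con c := fun _ _ => rfl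
  have hγ : ∀ (τ : Ty B) (x : LVar τ), mk (γ τ x).out = γ τ x := fun _ _ => mk_out _
  have h₁ : (mk q).renFree δ = mk (q.bind fun _ y => .var (.free (δ _ y))) :=
    bind_mk (fun _ _ => rfl) q
  change γ.apply ((mk q).renFree δ) = ((mk q).tr _ _).close _
  rw [h₁, Subst.apply_eq_tr, tr_mk hκ hγ, tr_mk hκ hγ, close_mk, Tm.tr_con_eq_bind,
    Tm.tr_con_eq_bind, Tm.bind_bind, Tm.bind_bind]
  refine mk_eq_mk.2 (Tm.bind_conv q fun σ y => mk_eq_mk.1 ?_)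
  have h₂ := h σ y
  rw [var, tr_mk hκ hγ, close_mk] at h₂
  exact (mk_out _).trans h₂

/-- Agreement is demanded only on variables that can occur in `q`, so that the set of names avoided
in `InstAt.exists_apart` can be finite. -/
theorem apply_renFree_of_fv {ψ : Subst B} {δ : ∀ σ, Vr Γ σ → LVar σ} {e : Env CTerm Γ}
    (q : Term Γ τ)
    (h : ∀ σ (y : Vr Γ σ), (∀ x, y.Is x → x ∈ q.fv) → ψ σ (δ σ y) = e.sub σ y) :
    ψ.apply (q.renFree δ) = q.close e := by
  rw [renFree, Subst.apply, bind_bind, close]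
  exact bind_congr_fv q fun σ y hy => (Subst.apply_var ψ (δ σ y)).trans (h σ y hy)

end Term

/-! ### Clauses and their instances -/

noncomputable def Clause.tr (κ : ∀ τ : Ty B, Con τ → CTerm τ) (ν : Subst B) :
    ∀ {Γ : List (Ty B)}, Clause Γ → Clause Γ
  | _, .fact A => .fact (A.tr κ ν)
  | _, .rule G A => .rule (G.tr κ ν) (A.tr κ ν)
  | _, .all hα K => .all hα (K.tr κ ν)

def Clause.fv : ∀ {Γ : List (Ty B)}, Clause Γ → Set (AVar B)
  | _, .fact A => A.fv
  | _, .rule G A => G.fv ∪ A.fv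
  | _, .all _ K => K.fv

theorem Clause.finite_fv {Γ : List (Ty B)} (K : Clause Γ) : K.fv.Finite := by
  induction K with
  | fact A => exact A.finite_fv
  | rule G A => exact G.finite_fv.union A.finite_fv
  | all hα K ih => exact ih

theorem InElaboration.tr {κ : ∀ τ : Ty B, Con τ → CTerm τ} {ν : Subst B} {i : ℕ}
    (hκ : ∀ σ (c : Con σ), c.level ≤ i → (κ σ c).LevelLE i)
    (hν : ∀ σ (x : LVar σ), x.level ≤ i → (ν σ x).LevelLE i)
    {Γ : List (Ty B)} {D : Term Γ .p} {K : Clause Γ} (h : InElaboration i D K) :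
    InElaboration i (D.tr κ ν) (K.tr κ ν) := by
  induction h with
  | fact hA => rw [Term.tr_inc]; exact .fact (hA.tr hκ hν)
  | rule hG hA =>
    simp only [Term.impP, Term.tr_app, Term.tr_lcon]
    exact .rule (hG.tr hκ hν) (hA.tr hκ hν)
  | left hD _ ih =>
    simp only [Term.andP, Term.tr_app, Term.tr_lcon]
    exact .left (hD.tr hκ hν) ih
  | right hD _ ih =>
    simp only [Term.andP, Term.tr_app, Term.tr_lcon]
    exact .right (hD.tr hκ hν) ih
  | all hα _ ih =>
    simp only [Term.allP, Term.tr_app, Term.tr_lcon, Term.tr_lam]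
    exact .all hα ih

/-- `InstAt T i e K G A`: the body `G` and the head `A` are those of an instance of the clause
`K`, with the values `e` for the variables of its context, and terms of level at most `i` with
constants in `T` for the quantified variables. -/
inductive InstAt (T : Set (ACon B)) (i : ℕ) : ∀ {Γ : List (Ty B)}, Env CTerm Γ → Clause Γ →
    Option (CTerm (B := B) .g) → CTerm (B := B) .r → Prop
  | fact {Γ : List (Ty B)} (e : Env CTerm Γ) (A : Term Γ .r) :
      InstAt T i e (.fact A) none (A.close e)
  | rule {Γ : List (Ty B)} (e : Env CTerm Γ) (G : Term Γ .g) (A : Term Γ .r) :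
      InstAt T i e (.rule G A) (some (G.close e)) (A.close e)
  | all {Γ : List (Ty B)} {e : Env CTerm Γ} {α : Ty B} (hα : α.VarTy) {K : Clause (α :: Γ)}
      {t : CTerm α} {G : Option (CTerm (B := B) .g)} {A : CTerm (B := B) .r} :
      t.LevelLE i → t.oc ⊆ T → InstAt T i (.cons t e) K G A → InstAt T i e (.all hα K) G A

theorem InstAt.tr {κ : ∀ τ : Ty B, Con τ → CTerm τ} {ν : Subst B} {T T' : Set (ACon B)} {i : ℕ}
    (hκ : ∀ σ (c : Con σ), c.level ≤ i → (κ σ c).LevelLE i)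
    (hν : ∀ σ (x : LVar σ), x.level ≤ i → (ν σ x).LevelLE i)
    (hT : ∀ (τ : Ty B) (q : CTerm τ), q.oc ⊆ T → (q.tr κ ν).oc ⊆ T')
    {Γ : List (Ty B)} {e : Env CTerm Γ} {K : Clause Γ} {G : Option (CTerm (B := B) .g)}
    {A : CTerm (B := B) .r} (h : InstAt T i e K G A) :
    InstAt T' i (e.map fun _ t => t.tr κ ν) (K.tr κ ν) (G.map fun q => q.tr κ ν) (A.tr κ ν) := by
  induction h with
  | fact e A => rw [Term.tr_close]; exact .fact _ _
  | rule e G A => rw [Option.map_some, Term.tr_close, Term.tr_close]; exact .rule _ _ _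
  | all hα ht hc _ ih => exact .all hα (ht.tr hκ hν) (hT _ _ hc) ih

theorem InElaboration.levelLE_body {T : Set (ACon B)} {i : ℕ} {Γ : List (Ty B)} {D : Term Γ .p}
    {K : Clause Γ} (h : InElaboration i D K) : ∀ {e : Env CTerm Γ} {G : CTerm (B := B) .g}
    {A : CTerm (B := B) .r}, (∀ σ (y : Vr Γ σ), y.LevelLE i → (e.sub σ y).LevelLE i) →
      InstAt T i e K (some G) A → G.LevelLE i := by
  induction h with
  | fact hA => intro e G A he h; cases h
  | rule hG hA => intro e G A he h; cases h; exact hG.close he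
  | left _ _ ih => exact ih
  | right _ _ ih => exact ih
  | all hα _ ih =>
    intro e G A he h
    cases h with
    | all _ ht _ h =>
      refine ih (fun σ y hy => ?_) h
      cases y with
      | zero => exact ht
      | succ y => exact he _ y hy

/-- Each fresh variable `w` supplies its value `γ α w` as the instance of its quantifier. The
constants of that value lie in `γ.oc`, which accounts for the parameter `T`. -/
theorem Apart.instAt {γ : Subst B} (hγ : γ.Legal) {i : ℕ} {Γ : List (Ty B)}
    {δ : ∀ σ, Vr Γ σ → LVar σ} {K : Clause Γ} {ws : List (AVar B)}
    {G : Option (CTerm (B := B) .g)} {A : CTerm (B := B) .r} (h : Apart δ K ws G A) :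
    ∀ {e : Env CTerm Γ}, (∀ x ∈ ws, x.2.level ≤ i) →
      (∀ σ y, γ σ (δ σ y) = ((Term.var y).tr (fun _ c => Term.con c) γ).close e) →
      InstAt γ.oc i e (K.tr (fun _ c => Term.con c) γ) (G.map γ.apply) (γ.apply A) := by
  induction h with
  | fact δ A => intro e _ h; rw [Term.apply_renFree A h]; exact .fact _ _
  | rule δ G A =>
    intro e _ h
    rw [Option.map_some, Term.apply_renFree A h, Term.apply_renFree G h]
    exact .rule _ _ _
  | @all Γ δ α hα K w ws G A _ ih =>
    intro e hws h
    refine .all hα (t := γ α w) (hγ.levelLE (hws _ (List.mem_cons_self ..)))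
      (Subst.oc_value_subset γ w) (ih (fun x hx => hws x (List.mem_cons_of_mem _ hx)) ?_)
    intro σ y
    obtain ⟨e, rfl⟩ := e.exists_map_mk
    have hκ : ∀ (τ : Ty B) (c : Con τ), Term.mk (.con c : Tm [] τ) = Term.con c := fun _ _ => rfl
    have hγ' : ∀ (τ : Ty B) (x : LVar τ), Term.mk (γ τ x).out = γ τ x := fun _ _ => Term.mk_out _
    have h' : ∀ {σ : Ty B} (y : Vr (α :: Γ) σ),
        ((Term.var y).tr (fun _ c => Term.con c) γ).close
          (.cons (γ α w) (e.map fun _ => Term.mk)) =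
        Term.mk ((y.tr fun τ x => (γ τ x).out).bind (Env.cons (γ α w).out e).raw) := by
      intro σ y
      rw [← Term.close_mk, Term.var, Term.tr_mk hκ hγ']
      simp only [Env.map, Term.mk_out]
      rfl
    rw [h']
    cases y with
    | zero => exact (Term.mk_out _).symm
    | succ y =>
      simp only [consVar, h, Vr.tr, Env.wk_bind_raw]
      rw [Term.var, Term.tr_mk hκ hγ', Term.close_mk]
      rfl

/-! ### Updates and fresh names -/

open Classical in
/-- The substitution with the value at `w` replaced by `t`. -/
noncomputable def Subst.update (ψ : Subst B) {α : Ty B} (w : LVar α) (t : CTerm α) : Subst B :=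
  fun τ x => Function.update (β := fun a : AVar B => CTerm a.1) (fun a => ψ a.1 a.2) ⟨α, w⟩ t ⟨τ, x⟩

namespace Subst

theorem update_self (ψ : Subst B) {α : Ty B} (w : LVar α) (t : CTerm α) :
    ψ.update w t α w = t := by
  classical
  exact Function.update_self ..

theorem update_of_ne (ψ : Subst B) {α : Ty B} {w : LVar α} (t : CTerm α) {τ : Ty B} {x : LVar τ}
    (h : (⟨τ, x⟩ : AVar B) ≠ ⟨α, w⟩) : ψ.update w t τ x = ψ τ x := by
  classical
  exact Function.update_of_ne (β := fun a : AVar B => CTerm a.1) h ..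

theorem Legal.update {ψ : Subst B} (hψ : ψ.Legal) {α : Ty B} {w : LVar α} {t : CTerm α}
    (ht : t.LevelLE w.level) : (ψ.update w t).Legal := by
  constructor
  · refine (hψ.1.insert ⟨α, w⟩).subset fun x hx => ?_
    by_contra h
    simp only [Set.mem_insert_iff, not_or] at h
    exact h.2 fun h' => hx ((update_of_ne ψ t h.1).trans h')
  · intro τ x
    by_cases h : (⟨τ, x⟩ : AVar B) = ⟨α, w⟩
    · cases h
      rw [update_self]
      exact ht
    · rw [update_of_ne ψ t h]
      exact hψ.2 τ x

theorem oc_update_subset (ψ : Subst B) {α : Ty B} {w : LVar α} {t : CTerm α} :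
    (ψ.update w t).oc ⊆ ψ.oc ∪ t.oc := by
  intro c hc
  obtain ⟨⟨τ, x⟩, -, hc⟩ := Set.mem_iUnion₂.1 hc
  by_cases h : (⟨τ, x⟩ : AVar B) = ⟨α, w⟩
  · cases h
    rw [update_self] at hc
    exact .inr hc
  · simp only [update_of_ne ψ t h] at hc
    exact .inl (oc_value_subset ψ x hc)

end Subst

theorem exists_fresh_var {V : Set (AVar B)} (hV : V.Finite) {α : Ty B} (hα : α.VarTy) (i : ℕ) :
    ∃ w : LVar α, w.level = i ∧ (⟨α, w⟩ : AVar B) ∉ V := by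
  have hinj : Function.Injective fun n : ℕ => (⟨α, ⟨i, n, hα⟩⟩ : AVar B) := by
    intro n m h
    simpa using h
  obtain ⟨_, ⟨n, rfl⟩, hn⟩ := (Set.infinite_range_of_injective hinj).exists_notMem_finite hV
  exact ⟨⟨i, n, hα⟩, rfl, hn⟩

theorem exists_fresh_con {C : Set (ACon B)} (hC : C.Finite) {α : Ty B} (hα : α.VarTy) (i : ℕ) :
    ∃ c : Con α, c.level = i ∧ (⟨α, c⟩ : ACon B) ∉ C := by
  have hinj : Function.Injective fun n : ℕ => (⟨α, ⟨i, n, hα.conTy⟩⟩ : ACon B) := by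
    intro n m h
    simpa using h
  obtain ⟨_, ⟨n, rfl⟩, hn⟩ := (Set.infinite_range_of_injective hinj).exists_notMem_finite hC
  exact ⟨⟨i, n, hα.conTy⟩, rfl, hn⟩

/-- Converse of `Apart.instAt`: every quantifier receives a fresh variable, whose value under `ψ'`
is the instantiating term. The avoided set contains the images of all relevant variables and grows
with each choice, so later updates leave earlier values intact. -/
theorem InstAt.exists_apart {T : Set (ACon B)} {i : ℕ} {Γ : List (Ty B)} {e : Env CTerm Γ}
    {K : Clause Γ} {G : Option (CTerm (B := B) .g)} {A : CTerm (B := B) .r}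
    (h : InstAt T i e K G A) :
    ∀ {δ : ∀ σ, Vr Γ σ → LVar σ} {ψ : Subst B} {V : Set (AVar B)}, V.Finite → ψ.Legal →
      (∀ σ (y : Vr Γ σ), (∀ x, y.Is x → x ∈ K.fv) →
        (⟨σ, δ σ y⟩ : AVar B) ∈ V ∧ ψ σ (δ σ y) = e.sub σ y) →
      ∃ (ws : List (AVar B)) (ψ' : Subst B) (G' : Option (CTerm (B := B) .g))
        (A' : CTerm (B := B) .r), Apart δ K ws G' A' ∧ ws.Nodup ∧
          (∀ x ∈ ws, x ∉ V ∧ x.2.level ≤ i) ∧ ψ'.Legal ∧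
          (∀ x ∉ ws, ψ' x.1 x.2 = ψ x.1 x.2) ∧ ψ'.oc ⊆ ψ.oc ∪ T ∧ ψ'.apply A' = A ∧
          G'.map ψ'.apply = G := by
  induction h with
  | fact e A =>
    intro δ ψ V hV hψ h
    exact ⟨[], ψ, none, _, .fact δ A, List.nodup_nil, by simp, hψ, fun _ _ => rfl,
      Set.subset_union_left, Term.apply_renFree_of_fv A fun σ y hy => (h σ y hy).2, rfl⟩
  | rule e G A =>
    intro δ ψ V hV hψ h
    exact ⟨[], ψ, some _, _, .rule δ G A, List.nodup_nil, by simp, hψ, fun _ _ => rfl,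
      Set.subset_union_left,
      Term.apply_renFree_of_fv A fun σ y hy => (h σ y fun x hx => .inr (hy x hx)).2,
      congrArg some (Term.apply_renFree_of_fv G fun σ y hy =>
        (h σ y fun x hx => .inl (hy x hx)).2)⟩
  | @all Γ e α hα K t G A ht hT _ ih =>
    intro δ ψ V hV hψ h
    -- Level exactly `i` makes every instantiating term a legal value of `w`.
    obtain ⟨w, hwi, hwV⟩ := exists_fresh_var hV hα i
    obtain ⟨ws, ψ', G', A', h₁, h₂, h₃, h₄, h₅, h₆, h₇, h₈⟩ :=
      ih (δ := consVar w δ) (ψ := ψ.update w t) (V := insert ⟨α, w⟩ V) (hV.insert _)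
        (hψ.update (by rw [hwi]; exact ht)) (by
          intro σ y hy
          cases y with
          | zero => exact ⟨Set.mem_insert _ _, Subst.update_self ..⟩
          | succ y =>
            obtain ⟨ha, hb⟩ := h σ y hy
            refine ⟨Set.mem_insert_of_mem _ ha, (Subst.update_of_ne ψ t ?_).trans hb⟩
            intro heq
            have heq' : (⟨σ, δ σ y⟩ : AVar B) = ⟨α, w⟩ := heq
            exact hwV (heq' ▸ ha))
    refine ⟨⟨α, w⟩ :: ws, ψ', G', A', .all hα w h₁, List.nodup_cons.2 ⟨fun hw =>
      (h₃ _ hw).1 (Set.mem_insert _ _), h₂⟩, ?_, h₄, ?_, ?_, h₇, h₈⟩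
    · intro x hx
      rcases List.mem_cons.1 hx with rfl | hx
      · exact ⟨hwV, hwi.le⟩
      · exact ⟨fun hV => (h₃ x hx).1 (Set.mem_insert_of_mem _ hV), (h₃ x hx).2⟩
    · intro x hx
      simp only [List.mem_cons, not_or] at hx
      exact (h₅ x hx.2).trans (Subst.update_of_ne ψ t hx.1)
    · refine h₆.trans (Set.union_subset ((Subst.oc_update_subset ψ).trans
        (Set.union_subset_union_right _ hT)) Set.subset_union_right)

end Terms


section Terms

variable {B : Type u}

/-! ### States -/

noncomputable def State.tr (κ : ∀ τ : Ty B, Con τ → CTerm τ) (ν : Subst B) (s : State B) :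
    State B :=
  ⟨s.idx, s.prog.map fun D => D.tr κ ν, s.goal.tr κ ν⟩

theorem State.apply_eq_tr (θ : Subst B) : State.apply θ = State.tr (fun _ c => Term.con c) θ := by
  funext s
  simp only [State.apply, State.tr, Subst.apply_eq_tr]
  congr 1
  exact congrArg (fun f => List.map f s.prog) (funext fun D => Subst.apply_eq_tr θ D)

theorem State.apply_id (s : State B) : s.apply Subst.id = s := by
  have h : (Subst.id : Subst B).apply (τ := .p) = _root_.id := funext Subst.apply_id
  rw [State.apply, Subst.apply_id, h, List.map_id]

theorem State.apply_comp (θ γ : Subst B) (s : State B) :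
    s.apply (θ.comp γ) = (s.apply θ).apply γ := by
  simp only [State.apply, Subst.apply_comp, List.map_map]
  congr 1
  exact congrArg (fun f => List.map f s.prog) (funext fun D => Subst.apply_comp θ γ D)

theorem State.Valid.apply {θ : Subst B} (hθ : θ.Legal) {s : State B} (hs : s.Valid) :
    (s.apply θ).Valid := by
  refine ⟨fun D hD => ?_, hθ.apply hs.2⟩
  obtain ⟨D', hD', rfl⟩ := List.mem_map.1 hD
  exact hθ.apply (hs.1 D' hD')

/-- The free logic variables of a state. -/
def State.fv (s : State B) : Set (AVar B) := {x | (∃ D ∈ s.prog, x ∈ D.fv) ∨ x ∈ s.goal.fv}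

theorem State.apply_congr {θ θ' : Subst B} {s : State B}
    (h : ∀ x ∈ s.fv, θ x.1 x.2 = θ' x.1 x.2) : s.apply θ = s.apply θ' := by
  simp only [State.apply]
  congr 1
  · exact List.map_congr_left fun D hD => Subst.apply_congr D fun x hx => h x (.inl ⟨D, hD, hx⟩)
  · exact Subst.apply_congr _ fun x hx => h x (.inr hx)

namespace StateVector

theorem apply_append (θ : Subst B) (L R : StateVector B) :
    apply θ (L ++ R) = apply θ L ++ apply θ R := List.map_append ..

theorem apply_cons (θ : Subst B) (s : State B) (R : StateVector B) :
    apply θ (s :: R) = s.apply θ :: apply θ R := rfl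

theorem apply_id (A : StateVector B) : A.apply Subst.id = A :=
  (List.map_congr_left fun s _ => State.apply_id s).trans (List.map_id A)

theorem apply_comp (θ γ : Subst B) (A : StateVector B) :
    A.apply (θ.comp γ) = (A.apply θ).apply γ := by
  simp only [apply, List.map_map]
  exact List.map_congr_left fun s _ => State.apply_comp θ γ s

theorem apply_congr {θ θ' : Subst B} {A : StateVector B}
    (h : ∀ x ∈ A.fv, θ x.1 x.2 = θ' x.1 x.2) : A.apply θ = A.apply θ' :=
  List.map_congr_left fun s hs => State.apply_congr fun x hx => h x ⟨s, hs, hx⟩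

theorem apply_eq_self {θ : Subst B} {A : StateVector B}
    (h : ∀ x ∈ A.fv, θ x.1 x.2 = Term.var (.free x.2)) : A.apply θ = A :=
  (apply_congr (θ' := Subst.id) h).trans A.apply_id

theorem apply_restrict (θ : Subst B) (A : StateVector B) : A.apply (θ.restrict A.fv) = A.apply θ :=
  apply_congr fun _ hx => Subst.restrict_of_mem hx

theorem Valid.apply {θ : Subst B} (hθ : θ.Legal) {A : StateVector B} (hA : A.Valid) :
    (A.apply θ).Valid := by
  intro s hs
  obtain ⟨s', hs', rfl⟩ := List.mem_map.1 hs
  exact (hA s' hs').apply hθ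

theorem finite_fv (A : StateVector B) : A.fv.Finite := by
  have : A.fv = ⋃ s ∈ {s | s ∈ A}, ((⋃ D ∈ {D | D ∈ s.prog}, D.fv) ∪ s.goal.fv) := by
    ext x
    simp [fv]
  rw [this]
  exact A.finite_toSet.biUnion fun s _ =>
    (s.prog.finite_toSet.biUnion fun D _ => D.finite_fv).union s.goal.finite_fv

theorem finite_oc (A : StateVector B) : A.oc.Finite := by
  have : A.oc = ⋃ s ∈ {s | s ∈ A}, ((⋃ D ∈ {D | D ∈ s.prog}, D.oc) ∪ s.goal.oc) := by
    ext x
    simp [oc]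
  rw [this]
  exact A.finite_toSet.biUnion fun s _ =>
    (s.prog.finite_toSet.biUnion fun D _ => D.finite_oc).union s.goal.finite_oc

theorem oc_apply_subset (θ : Subst B) (A : StateVector B) : (A.apply θ).oc ⊆ A.oc ∪ θ.oc := by
  rintro c ⟨s, hs, hc⟩
  obtain ⟨s', hs', rfl⟩ := List.mem_map.1 hs
  by_contra h
  simp only [Set.mem_union, not_or] at h
  have key : ∀ {τ : Ty B} (q : CTerm τ), c ∈ (θ.apply q).oc → c ∈ q.oc := fun q hq =>
    (Subst.oc_apply_subset θ q hq).resolve_right h.2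
  refine h.1 ⟨s', hs', hc.imp ?_ (key _)⟩
  rintro ⟨D, hD, hc⟩
  obtain ⟨D', hD', rfl⟩ := List.mem_map.1 hD
  exact ⟨D', hD', key _ hc⟩

end StateVector

/-! ### Ground steps -/

/-- Resolution steps on a single state that need no unification: `Ground T s ss K` replaces the
state `s` by the states `ss`, introducing the constants `K`; clauses are instantiated with terms
whose constants belong to `T`. -/
inductive Ground (T : Set (ACon B)) : State B → List (State B) → Set (ACon B) → Prop
  | stay (s : State B) : Ground T s [s] ∅
  | null (i : ℕ) (P : List (CTerm (B := B) .p)) : Ground T ⟨i, P, Term.topG⟩ [] ∅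
  | backchain (i : ℕ) (P : List (CTerm (B := B) .p)) {A : CTerm (B := B) .r}
      {D : CTerm (B := B) .p} {K : Clause []} {G : CTerm (B := B) .g} :
      A.LevelLE i → D ∈ P → InElaboration i D K → InstAt T i .nil K (some G) A →
      Ground T ⟨i, P, Term.rigid A⟩ [⟨i, P, G⟩] ∅
  | axm (i : ℕ) (P : List (CTerm (B := B) .p)) {A : CTerm (B := B) .r}
      {D : CTerm (B := B) .p} {K : Clause []} :
      A.LevelLE i → D ∈ P → InElaboration i D K → InstAt T i .nil K none A →
      Ground T ⟨i, P, Term.rigid A⟩ [] ∅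
  | orLeft (i : ℕ) (P : List (CTerm (B := B) .p)) {G G' : CTerm (B := B) .g} :
      G.LevelLE i → G'.LevelLE i → Ground T ⟨i, P, Term.orG G G'⟩ [⟨i, P, G⟩] ∅
  | orRight (i : ℕ) (P : List (CTerm (B := B) .p)) {G G' : CTerm (B := B) .g} :
      G.LevelLE i → G'.LevelLE i → Ground T ⟨i, P, Term.orG G G'⟩ [⟨i, P, G'⟩] ∅
  | and (i : ℕ) (P : List (CTerm (B := B) .p)) {G G' : CTerm (B := B) .g} :
      G.LevelLE i → G'.LevelLE i → Ground T ⟨i, P, Term.andG G G'⟩ [⟨i, P, G⟩, ⟨i, P, G'⟩] ∅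
  | instance_ (i : ℕ) (P : List (CTerm (B := B) .p)) {α : Ty B} (hα : α.VarTy) {G : Term [α] .g}
      {t : CTerm α} : G.LevelLE i → t.LevelLE i →
      Ground T ⟨i, P, Term.exG hα G⟩ [⟨i, P, G.inst t⟩] ∅
  | augment (i : ℕ) (P : List (CTerm (B := B) .p)) {D : CTerm (B := B) .p}
      {G : CTerm (B := B) .g} : D.LevelLE i → G.LevelLE i →
      Ground T ⟨i, P, Term.impG D G⟩ [⟨i, P ++ [D], G⟩] ∅
  | generic (i : ℕ) (P : List (CTerm (B := B) .p)) {α : Ty B} (hα : α.VarTy) {G : Term [α] .g}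
      {c : Con α} : (∀ D ∈ P, D.LevelLE i) → G.LevelLE i → c.level = i + 1 →
      Ground T ⟨i, P, Term.allG hα G⟩ [⟨i + 1, P, G.inst (Term.con c)⟩] {⟨α, c⟩}

/-- Constants go to constants, so that a generic step remains one. The map `f` need not be
injective, because ground steps carry no freshness condition. -/
theorem Ground.tr {f : ∀ τ : Ty B, Con τ → Con τ} {ν : Subst B} {T T' : Set (ACon B)}
    (hf : ∀ τ c, (f τ c).level = c.level) (hν : ∀ τ x, (ν τ x).LevelLE x.level)
    (hT : ∀ (τ : Ty B) (q : CTerm τ), q.oc ⊆ T → (q.tr (fun _ c => Term.con (f _ c)) ν).oc ⊆ T')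
    {s : State B} {ss : List (State B)} {K : Set (ACon B)} (h : Ground T s ss K) :
    Ground T' (s.tr (fun _ c => Term.con (f _ c)) ν)
      (ss.map (State.tr (fun _ c => Term.con (f _ c)) ν)) ((fun c => ⟨c.1, f c.1 c.2⟩) '' K) := by
  have hκ : ∀ (i : ℕ) (σ : Ty B) (c : Con σ), c.level ≤ i →
      (Term.con (f σ c) : CTerm σ).LevelLE i :=
    fun i σ c hc => Term.levelLE_con (by rw [hf]; exact hc)
  have hν' : ∀ (i : ℕ) (σ : Ty B) (x : LVar σ), x.level ≤ i → (ν σ x).LevelLE i :=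
    fun i σ x hx => (hν σ x).mono hx
  rw [Set.image]
  cases h with
  | stay => simpa using .stay _
  | null i P => simpa using .null i _
  | backchain i P hA hD hK hI =>
    simpa [State.tr, Term.rigid, Term.tr_inc] using .backchain i _ (hA.tr (hκ i) (hν' i))
      (List.mem_map_of_mem hD) (hK.tr (hκ i) (hν' i)) (hI.tr (hκ i) (hν' i) hT)
  | axm i P hA hD hK hI =>
    simpa [State.tr, Term.rigid, Term.tr_inc] using .axm i _ (hA.tr (hκ i) (hν' i))
      (List.mem_map_of_mem hD) (hK.tr (hκ i) (hν' i)) (hI.tr (hκ i) (hν' i) hT)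
  | orLeft i P hG hG' =>
    simpa [State.tr, Term.orG, Term.tr_app, Term.tr_lcon] using
      .orLeft i _ (hG.tr (hκ i) (hν' i)) (hG'.tr (hκ i) (hν' i))
  | orRight i P hG hG' =>
    simpa [State.tr, Term.orG, Term.tr_app, Term.tr_lcon] using
      .orRight i _ (hG.tr (hκ i) (hν' i)) (hG'.tr (hκ i) (hν' i))
  | and i P hG hG' =>
    simpa [State.tr, Term.andG, Term.tr_app, Term.tr_lcon] using
      .and i _ (hG.tr (hκ i) (hν' i)) (hG'.tr (hκ i) (hν' i))
  | instance_ i P hα hG ht =>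
    simpa [State.tr, Term.exG, Term.tr_app, Term.tr_lcon, Term.tr_lam, Term.tr_inst] using
      .instance_ i _ hα (hG.tr (hκ i) (hν' i)) (ht.tr (hκ i) (hν' i))
  | augment i P hD hG =>
    simpa [State.tr, Term.impG, Term.tr_app, Term.tr_lcon] using
      .augment i _ (hD.tr (hκ i) (hν' i)) (hG.tr (hκ i) (hν' i))
  | generic i P hα hP hG hc =>
    simpa [State.tr, Term.allG, Term.tr_app, Term.tr_lcon, Term.tr_lam, Term.tr_inst,
      Term.tr_con] using
      .generic i _ hα (List.forall_mem_map.2 fun D hD => (hP D hD).tr (hκ i) (hν' i))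
        (hG.tr (hκ i) (hν' i)) ((hf _ _).trans hc)

theorem Ground.apply {ν : Subst B} {T T' : Set (ACon B)} (hν : ν.Legal)
    (hT : ∀ (τ : Ty B) (q : CTerm τ), q.oc ⊆ T → (ν.apply q).oc ⊆ T')
    {s : State B} {ss : List (State B)} {K : Set (ACon B)} (h : Ground T s ss K) :
    Ground T' (s.apply ν) (ss.map (State.apply ν)) K := by
  rw [State.apply_eq_tr]
  have h' := h.tr (f := fun _ c => c) (ν := ν) (T' := T') (fun _ _ => rfl) hν.2
    (fun τ q hq => by rw [← Subst.apply_eq_tr]; exact hT τ q hq)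
  simpa using h'

theorem Ground.valid {T : Set (ACon B)} {s : State B} {ss : List (State B)} {K : Set (ACon B)}
    (h : Ground T s ss K) (hs : s.Valid) : ∀ s' ∈ ss, s'.Valid := by
  have one : ∀ {s' : State B}, s'.Valid → ∀ s ∈ [s'], s.Valid := by
    intro s' h s hs
    rw [List.mem_singleton.1 hs]
    exact h
  cases h with
  | stay => exact one hs
  | null i P => exact fun _ h => (List.not_mem_nil h).elim
  | axm i P hA hD hK hI => exact fun _ h => (List.not_mem_nil h).elim
  | backchain i P hA hD hK hI =>
    exact one ⟨hs.1, hK.levelLE_body (fun σ y hy => by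
      rw [Env.sub_nil]; exact Term.levelLE_var hy) hI⟩
  | orLeft i P hG hG' => exact one ⟨hs.1, hG⟩
  | orRight i P hG hG' => exact one ⟨hs.1, hG'⟩
  | and i P hG hG' =>
    intro s hs'
    rcases List.mem_cons.1 hs' with rfl | hs'
    · exact ⟨hs.1, hG⟩
    · rw [List.mem_singleton.1 hs']
      exact ⟨hs.1, hG'⟩
  | instance_ i P hα hG ht => exact one ⟨hs.1, hG.inst ht⟩
  | augment i P hD hG =>
    refine one ⟨fun D' hD' => ?_, hG⟩
    rcases List.mem_append.1 hD' with h | h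
    · exact hs.1 _ h
    · rw [List.mem_singleton.1 h]
      exact hD
  | generic i P hα hP hG hc =>
    exact one ⟨fun D hD => (hs.1 D hD).mono (Nat.le_succ i),
      (hG.mono (Nat.le_succ i)).inst (Term.levelLE_con hc.le)⟩

/-! ### Resolution steps in terms of ground steps -/

theorem Step.legal {ρ : Rule} {V W : Set (AVar B)} {C K : Set (ACon B)} {A A' : StateVector B}
    {γ : Subst B} (h : Step ρ V C A γ A' W K) : γ.Legal := by
  cases h <;> first | assumption | exact Subst.legal_id

theorem Step.finite {ρ : Rule} {V W : Set (AVar B)} {C K : Set (ACon B)} {A A' : StateVector B}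
    {γ : Subst B} (h : Step ρ V C A γ A' W K) : W.Finite ∧ K.Finite := by
  cases h <;>
    first
    | exact ⟨Set.finite_empty, Set.finite_empty⟩
    | exact ⟨Set.finite_empty, Set.finite_singleton _⟩
    | exact ⟨List.finite_toSet _, Set.finite_empty⟩

theorem Step.disjoint {ρ : Rule} {V W : Set (AVar B)} {C K : Set (ACon B)} {A A' : StateVector B}
    {γ : Subst B} (h : Step ρ V C A γ A' W K) : Disjoint K C := by
  cases h <;> simp [*]

theorem Step.eq_empty_or_eq_id {ρ : Rule} {V W : Set (AVar B)} {C K : Set (ACon B)}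
    {A A' : StateVector B} {γ : Subst B} (h : Step ρ V C A γ A' W K) :
    K = ∅ ∨ γ = Subst.id := by
  cases h <;> simp

theorem Step.ne_nil {ρ : Rule} {V W : Set (AVar B)} {C K : Set (ACon B)} {A A' : StateVector B}
    {γ : Subst B} (h : Step ρ V C A γ A' W K) : A ≠ [] := by
  cases h <;> simp

/-- Once the unifier has been applied to the whole vector, only an instance of a clause or a logical
rule remains; True and Sub leave nothing to do and give `stay`. -/
theorem Step.ground {ρ : Rule} {V W : Set (AVar B)} {C K : Set (ACon B)} {A A' : StateVector B}
    {γ : Subst B} (h : Step ρ V C A γ A' W K) (hA : A.Valid) :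
    ∃ (L R : StateVector B) (s : State B) (ss : List (State B)),
      A.apply γ = L ++ s :: R ∧ A' = L ++ ss ++ R ∧ Ground γ.oc s ss K := by
  have hfree : ∀ (γ : Subst B) (σ : Ty B) (y : Vr [] σ), γ σ (freeVar σ y) =
      ((Term.var y).tr (fun _ c => Term.con c) γ).close .nil := by
    intro γ σ y
    cases y
    rw [Term.close_nil, Term.tr_free]
    rfl
  cases h with
  | null L R i P =>
    exact ⟨L, R, _, [], StateVector.apply_id _, by simp, .null i P⟩
  | @true _ _ L R i P _ _ hG hγ hne hG' =>
    exact ⟨L.apply γ, R.apply γ, ⟨i, P.map γ.apply, Term.topG⟩, _, by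
      rw [StateVector.apply_append, StateVector.apply_cons, State.apply, hG'], by simp, .stay _⟩
  | @backchain _ _ L R i P _ _ _ _ _ G _ hA' hD hK hap hnd hws hγ heq =>
    refine ⟨L.apply γ, R.apply γ, ⟨i, P.map γ.apply, Term.rigid (γ.apply _)⟩,
      [⟨i, P.map γ.apply, γ.apply G⟩], ?_, by simp,
      .backchain i _ (hγ.apply hA') (List.mem_map_of_mem hD)
        (by rw [Subst.apply_eq_tr]
            exact hK.tr (fun _ _ => Term.levelLE_con) fun _ _ => hγ.levelLE)
        (by rw [heq]; exact hap.instAt hγ (fun x hx => (hws x hx).2) (hfree γ))⟩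
    rw [StateVector.apply_append, StateVector.apply_cons, State.apply]
    simp only [Term.rigid, Subst.apply_eq_tr, Term.tr_inc]
  | axm L R i P hA' hD hK hap hnd hws hγ heq =>
    refine ⟨L.apply γ, R.apply γ, ⟨i, P.map γ.apply, Term.rigid (γ.apply _)⟩,
      [], ?_, by simp,
      .axm i _ (hγ.apply hA') (List.mem_map_of_mem hD)
        (by rw [Subst.apply_eq_tr]
            exact hK.tr (fun _ _ => Term.levelLE_con) fun _ _ => hγ.levelLE)
        (by rw [heq]; exact hap.instAt hγ (fun x hx => (hws x hx).2) (hfree γ))⟩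
    rw [StateVector.apply_append, StateVector.apply_cons, State.apply]
    simp only [Term.rigid, Subst.apply_eq_tr, Term.tr_inc]
  | orLeft L R i P hG hG' =>
    exact ⟨L, R, _, [_], StateVector.apply_id _, by simp, .orLeft i P hG hG'⟩
  | orRight L R i P hG hG' =>
    exact ⟨L, R, _, [_], StateVector.apply_id _, by simp, .orRight i P hG hG'⟩
  | and L R i P hG hG' =>
    exact ⟨L, R, _, [_, _], StateVector.apply_id _, by simp, .and i P hG hG'⟩
  | instance_ L R i P hα hG ht =>
    exact ⟨L, R, _, [_], StateVector.apply_id _, by simp, .instance_ i P hα hG ht⟩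
  | augment L R i P hD hG =>
    exact ⟨L, R, _, [_], StateVector.apply_id _, by simp, .augment i P hD hG⟩
  | generic L R i P hα hG hc hC =>
    exact ⟨L, R, _, [_], StateVector.apply_id _, by simp,
      .generic i P hα (hA ⟨i, P, _⟩ (List.mem_append_right _ (List.mem_cons_self ..))).1 hG hc⟩
  | sub L R i P G hγ =>
    exact ⟨L.apply γ, R.apply γ, ⟨i, P.map γ.apply, γ.apply G⟩, _, by
      rw [StateVector.apply_append, StateVector.apply_cons, State.apply], by simp, .stay _⟩

theorem Step.valid {ρ : Rule} {V W : Set (AVar B)} {C K : Set (ACon B)} {A A' : StateVector B}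
    {γ : Subst B} (h : Step ρ V C A γ A' W K) (hA : A.Valid) : A'.Valid := by
  obtain ⟨L, R, s, ss, hAγ, rfl, hg⟩ := h.ground hA
  have hv := hA.apply h.legal
  rw [hAγ] at hv
  intro s' hs'
  rcases List.mem_append.1 hs' with hs' | hs'
  · rcases List.mem_append.1 hs' with hs' | hs'
    · exact hv s' (List.mem_append_left _ hs')
    · exact hg.valid (hv s (by simp)) s' hs'
  · exact hv s' (List.mem_append_right _ (List.mem_cons_of_mem _ hs'))

/-! ### Sequences of steps -/

section Res

variable {S : Set Rule} {A A' : StateVector B} {η : Subst B} {V : Set (AVar B)}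
  {C N : Set (ACon B)}

theorem Res.finite (h : Res S A η A' V C N) : V.Finite ∧ C.Finite := by
  induction h with
  | refl => exact ⟨A.finite_fv, A.finite_oc⟩
  | step _ _ hs ih =>
    exact ⟨((ih.1.union hs.finite.1).union hs.legal.finite_fv).union (StateVector.finite_fv _),
      ((ih.2.union hs.finite.2).union hs.legal.finite_oc).union (StateVector.finite_oc _)⟩

theorem Res.fv_subset (h : Res S A η A' V C N) : A'.fv ⊆ V := by
  cases h with
  | refl => exact subset_rfl
  | step _ _ hs => exact Set.subset_union_right

theorem Res.oc_subset (h : Res S A η A' V C N) : A'.oc ⊆ C := by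
  cases h with
  | refl => exact subset_rfl
  | step _ _ hs => exact Set.subset_union_right

theorem Res.start_fv_subset (h : Res S A η A' V C N) : A.fv ⊆ V := by
  induction h with
  | refl => exact subset_rfl
  | step _ _ hs ih => exact fun x hx => .inl (.inl (.inl (ih hx)))

theorem Res.legal (h : Res S A η A' V C N) : η.Legal := by
  induction h with
  | refl => exact Subst.legal_id
  | step _ _ hs ih => exact ih.comp hs.legal

theorem Res.valid (h : Res S A η A' V C N) (hA : A.Valid) : A'.Valid := by
  induction h with
  | refl => exact hA
  | step _ _ hs ih => exact hs.valid ih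

theorem Res.value_of_notMem (h : Res S A η A' V C N) :
    ∀ x ∉ V, η x.1 x.2 = Term.var (.free x.2) := by
  induction h with
  | refl => exact fun _ _ => rfl
  | step _ _ hs ih =>
    intro x hx
    simp only [Set.mem_union, not_or] at hx
    change Subst.apply _ _ = _
    rw [ih x hx.1.1.1, Subst.apply_var]
    exact not_not.1 fun h => hx.1.2 (.inl h)

/-- Implies that a later substitution fixing `V` does not disturb the answer accumulated so far. -/
theorem Res.fv_value_subset (h : Res S A η A' V C N) :
    ∀ x ∈ V, (η x.1 x.2).fv ⊆ V := by
  induction h with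
  | refl =>
    intro x hx z hz
    rw [Set.mem_singleton_iff.1 (Term.fv_var_subset x.2 hz)]
    exact hx
  | @step η γ A' A'' V W C N K ρ hr _ hs ih =>
    intro x hx z hz
    have hz' : z ∈ (γ.apply (η x.1 x.2)).fv := hz
    by_cases hxV : x ∈ V
    · rcases Subst.fv_apply_subset γ _ hz' with hz | hz
      · exact .inl (.inr hz)
      · exact .inl (.inl (.inl (ih x hxV hz)))
    · rw [hr.value_of_notMem x hxV, Subst.apply_var] at hz'
      rcases Subst.fv_value_subset γ _ hz' with hz | hz
      · exact .inl (.inr hz)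
      · rw [Set.mem_singleton_iff.1 hz]
        exact hx

end Res

end Terms


section Terms

variable {B : Type u}

section Res

variable {S : Set Rule} {A A' : StateVector B} {η : Subst B} {V : Set (AVar B)}
  {C N : Set (ACon B)}

/-! ### Simulation of ground steps by resolution steps -/

theorem Res.step_of_fix {ρ : Rule} {γ : Subst B} {A'' : StateVector B} {W : Set (AVar B)}
    {K T : Set (ACon B)} (h : Res S A η A' V C N) (hρ : ρ ∈ S) (hs : Step ρ V C A' γ A'' W K)
    (hγ : ∀ x ∈ V, γ x.1 x.2 = Term.var (.free x.2)) (hT : γ.oc ⊆ T) :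
    ∃ (η' : Subst B) (V' : Set (AVar B)) (C' : Set (ACon B)),
      Res S A η' A'' V' C' (N ∪ K) ∧ (∀ x ∈ A.fv, η' x.1 x.2 = η x.1 x.2) ∧
        C' ⊆ C ∪ K ∪ T ∪ A''.oc := by
  refine ⟨_, _, _, .step h hρ hs, fun x hx => ?_, ?_⟩
  · change γ.apply _ = _
    refine (Subst.apply_congr (θ' := Subst.id) _ fun z hz => hγ z ?_).trans (Subst.apply_id _)
    exact h.fv_value_subset x (h.start_fv_subset hx) hz
  · exact Set.union_subset_union_left _ (Set.union_subset_union_right _ hT)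

/-- A ground use of a clause is realised by Backchain or Axiom with a substitution moving only fresh
clause variables, hence changing neither the other states nor the answer. The bound on `C'` serves
to keep generic constants fresh in `Res.lift`. -/
theorem Res.ground (hS : ordinary ⊆ S) {L R : StateVector B} {s : State B} {ss : List (State B)}
    {K T : Set (ACon B)} (h : Res S A η (L ++ s :: R) V C N) (hg : Ground T s ss K)
    (hK : Disjoint K C) :
    ∃ (η' : Subst B) (V' : Set (AVar B)) (C' : Set (ACon B)),
      Res S A η' (L ++ ss ++ R) V' C' (N ∪ K) ∧ (∀ x ∈ A.fv, η' x.1 x.2 = η x.1 x.2) ∧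
        C' ⊆ C ∪ K ∪ T ∪ (L ++ ss ++ R).oc := by
  have hid : ∀ x ∈ V, Subst.id x.1 x.2 = Term.var (.free x.2) := fun _ _ => rfl
  have hid' : (Subst.id : Subst B).oc ⊆ T := by rw [Subst.oc_id]; exact Set.empty_subset T
  have hord : ∀ {ρ : Rule}, ρ ≠ .sub → ρ ∈ S := fun hρ => hS hρ
  have hfv : ∀ {i P G}, s = ⟨i, P, G⟩ → (∀ x ∈ StateVector.fv L, x ∈ V) ∧
      (∀ x ∈ StateVector.fv R, x ∈ V) ∧ ∀ D ∈ P, ∀ x ∈ D.fv, x ∈ V := by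
    rintro i P G rfl
    exact ⟨fun x ⟨s, hs, hx⟩ => h.fv_subset ⟨s, List.mem_append_left _ hs, hx⟩,
      fun x ⟨s, hs, hx⟩ => h.fv_subset
        ⟨s, List.mem_append_right _ (List.mem_cons_of_mem _ hs), hx⟩,
      fun D hD x hx => h.fv_subset
        ⟨_, List.mem_append_right _ (List.mem_cons_self ..), .inl ⟨D, hD, hx⟩⟩⟩
  have hfree : ∀ (V : Set (AVar B)) (K : Clause []) (σ : Ty B) (y : Vr [] σ),
      (∀ x, y.Is x → x ∈ K.fv) → (⟨σ, freeVar σ y⟩ : AVar B) ∈ V ∪ K.fv ∧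
        Subst.id σ (freeVar σ y) = (Env.nil : Env CTerm []).sub σ y := by
    intro V K σ y hy
    cases y with
    | free x => exact ⟨.inr (hy _ rfl), rfl⟩
  cases hg with
  | stay s =>
    refine ⟨η, V, C, ?_, fun _ _ => rfl, fun c hc => .inl (.inl (.inl hc))⟩
    rw [List.append_assoc, Set.union_empty]
    exact h
  | null i P =>
    rw [List.append_assoc]
    exact h.step_of_fix (hord (by simp)) (.null L R i P) hid hid'
  | @backchain i P a D K' G hA hD hK' hI =>
    obtain ⟨hL, hR, hP⟩ := hfv rfl
    -- Avoiding the variables of the atom as well makes `ψ` fix the atom, so that `ψ` unifies it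
    -- with the renamed head. Avoiding those of the clause keeps its free variables fixed.
    obtain ⟨ws, ψ, G', a', h₁, h₂, h₃, h₄, h₅, h₆, h₇, h₈⟩ :=
      hI.exists_apart (δ := freeVar) (ψ := Subst.id) (V := (V ∪ a.fv) ∪ K'.fv)
        ((h.finite.1.union a.finite_fv).union K'.finite_fv) Subst.legal_id (hfree _ K')
    obtain ⟨G', rfl, rfl⟩ : ∃ G'', G' = some G'' ∧ ψ.apply G'' = G := by
      cases G' with
      | none => cases h₈
      | some G' => exact ⟨G', rfl, Option.some_injective _ h₈⟩
    have hψ : ∀ x ∈ V ∪ a.fv, ψ x.1 x.2 = Term.var (.free x.2) := fun x hx =>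
      h₅ x fun hw => (h₃ x hw).1 (.inl hx)
    have ha : ψ.apply a = ψ.apply a' := by
      rw [h₇]
      exact (Subst.apply_congr (θ' := Subst.id) _ fun z hz => hψ z (.inr hz)).trans
        (Subst.apply_id _)
    have hstep := Step.backchain (C := C) L R i P hA hD hK' h₁ h₂
      (fun x hx => ⟨fun hV => (h₃ x hx).1 (.inl (.inl hV)), (h₃ x hx).2⟩) h₄ ha
    rw [StateVector.apply_eq_self fun x hx => hψ x (.inl (hL x hx)),
      StateVector.apply_eq_self fun x hx => hψ x (.inl (hR x hx)),
      List.map_congr_left (g := _root_.id) fun D hD => (Subst.apply_congr (θ' := Subst.id) D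
        fun z hz => hψ z (.inl (hP D hD z hz))).trans (Subst.apply_id D), List.map_id] at hstep
    rw [List.append_assoc]
    exact h.step_of_fix (hord (by simp)) hstep (fun x hx => hψ x (.inl hx))
      (h₆.trans (by rw [Subst.oc_id, Set.empty_union]))
  | @axm i P a D K' hA hD hK' hI =>
    obtain ⟨hL, hR, hP⟩ := hfv rfl
    obtain ⟨ws, ψ, G', a', h₁, h₂, h₃, h₄, h₅, h₆, h₇, h₈⟩ :=
      hI.exists_apart (δ := freeVar) (ψ := Subst.id) (V := (V ∪ a.fv) ∪ K'.fv)
        ((h.finite.1.union a.finite_fv).union K'.finite_fv) Subst.legal_id (hfree _ K')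
    obtain rfl : G' = none := Option.map_eq_none_iff.1 h₈
    have hψ : ∀ x ∈ V ∪ a.fv, ψ x.1 x.2 = Term.var (.free x.2) := fun x hx =>
      h₅ x fun hw => (h₃ x hw).1 (.inl hx)
    have ha : ψ.apply a = ψ.apply a' := by
      rw [h₇]
      exact (Subst.apply_congr (θ' := Subst.id) _ fun z hz => hψ z (.inr hz)).trans
        (Subst.apply_id _)
    have hstep := Step.axm (C := C) L R i P hA hD hK' h₁ h₂
      (fun x hx => ⟨fun hV => (h₃ x hx).1 (.inl (.inl hV)), (h₃ x hx).2⟩) h₄ ha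
    rw [StateVector.apply_eq_self fun x hx => hψ x (.inl (hL x hx)),
      StateVector.apply_eq_self fun x hx => hψ x (.inl (hR x hx))] at hstep
    rw [List.append_assoc]
    exact h.step_of_fix (hord (by simp)) hstep (fun x hx => hψ x (.inl hx))
      (h₆.trans (by rw [Subst.oc_id, Set.empty_union]))
  | orLeft i P hG hG' =>
    rw [List.append_assoc]
    exact h.step_of_fix (hord (by simp)) (.orLeft L R i P hG hG') hid hid'
  | orRight i P hG hG' =>
    rw [List.append_assoc]
    exact h.step_of_fix (hord (by simp)) (.orRight L R i P hG hG') hid hid'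
  | and i P hG hG' =>
    rw [List.append_assoc]
    exact h.step_of_fix (hord (by simp)) (.and L R i P hG hG') hid hid'
  | instance_ i P hα hG ht =>
    rw [List.append_assoc]
    exact h.step_of_fix (hord (by simp)) (.instance_ L R i P hα hG ht) hid hid'
  | augment i P hD hG =>
    rw [List.append_assoc]
    exact h.step_of_fix (hord (by simp)) (.augment L R i P hD hG) hid hid'
  | generic i P hα hP hG hc =>
    rw [List.append_assoc]
    exact h.step_of_fix (hord (by simp))
      (.generic L R i P hα hG hc (Set.disjoint_singleton_left.1 hK)) hid hid'

end Res

/-! ### Provable states -/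

/-- States that can be resolved to the null vector by ground steps. -/
inductive Provable : State B → Prop
  | mk {T K : Set (ACon B)} {s : State B} {ss : List (State B)} :
      Ground T s ss K → (∀ s' ∈ ss, Provable s') → Provable s

/-- The resolution is read backwards. The substitution `ζ` stands for everything that happens later;
ground steps are stable under it, so the induction can pass through each unifier. -/
theorem Res.provable {S : Set Rule} {A A' : StateVector B} {η : Subst B} {V : Set (AVar B)}
    {C N : Set (ACon B)} (h : Res S A η A' V C N) (hA : A.Valid) :
    ∀ {ζ : Subst B}, ζ.Legal → (∀ s ∈ A'.apply ζ, Provable s) →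
      ∀ s ∈ A.apply (η.comp ζ), Provable s := by
  induction h with
  | refl => intro ζ _ h; rwa [Subst.id_comp]
  | @step η γ A' A'' V W C N K ρ hr _ hs ih =>
    intro ζ hζ h
    have hassoc : (η.comp γ).comp ζ = η.comp (γ.comp ζ) := by
      funext τ x
      exact (Subst.apply_comp γ ζ (η τ x)).symm
    rw [hassoc]
    refine ih (hs.legal.comp hζ) ?_
    obtain ⟨L, R, s, ss, hγ, rfl, hg⟩ := hs.ground (hr.valid hA)
    rw [StateVector.apply_comp, hγ, StateVector.apply_append, StateVector.apply_cons]
    rw [StateVector.apply_append, StateVector.apply_append] at h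
    intro s' hs'
    rcases List.mem_append.1 hs' with hs' | hs'
    · exact h s' (List.mem_append_left _ (List.mem_append_left _ hs'))
    · rcases List.mem_cons.1 hs' with rfl | hs'
      · exact .mk (hg.apply (T' := Set.univ) hζ fun _ _ _ => Set.subset_univ _)
          fun s'' hs'' => h s'' (List.mem_append_left _ (List.mem_append_right _ hs''))
      · exact h s' (List.mem_append_right _ hs')

-- Freshness can be arranged afterwards: a generic constant has level `i + 1`, above everything in
-- the state it is introduced from, so the renaming may be changed at this constant without altering
-- that state.
open Classical in
theorem Ground.exists_rename {T K : Set (ACon B)} {s : State B} {ss : List (State B)}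
    (h : Ground T s ss K) {f : ∀ τ : Ty B, Con τ → Con τ} (hf : ∀ τ c, (f τ c).level = c.level)
    {C : Set (ACon B)} (hC : C.Finite) :
    ∃ f' : ∀ τ : Ty B, Con τ → Con τ, (∀ τ c, (f' τ c).level = c.level) ∧
      s.tr (fun _ c => Term.con (f' _ c)) Subst.id =
        s.tr (fun _ c => Term.con (f _ c)) Subst.id ∧
      Disjoint ((fun c : ACon B => (⟨c.1, f' c.1 c.2⟩ : ACon B)) '' K) C := by
  cases h with
  | @generic i P α hα G c hP hG hc =>
    obtain ⟨c', hc', hcC⟩ := exists_fresh_con hC hα (i + 1)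
    have hlt : ∀ (τ : Ty B) (d : Con τ), d.level ≤ i → (⟨τ, d⟩ : ACon B) ≠ ⟨α, c⟩ := by
      rintro τ d hd h
      cases h
      omega
    obtain ⟨f', hf₁, hf₂⟩ : ∃ f' : ∀ τ : Ty B, Con τ → Con τ, f' α c = c' ∧
        ∀ τ d, (⟨τ, d⟩ : ACon B) ≠ ⟨α, c⟩ → f' τ d = f τ d :=
      ⟨fun τ d => Function.update (β := fun a : ACon B => Con a.1) (fun a => f a.1 a.2)
        ⟨α, c⟩ c' ⟨τ, d⟩, Function.update_self .., fun τ d h =>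
        Function.update_of_ne (β := fun a : ACon B => Con a.1) h ..⟩
    refine ⟨f', ?_, ?_, ?_⟩
    · intro τ d
      by_cases h : (⟨τ, d⟩ : ACon B) = ⟨α, c⟩
      · cases h
        rw [hf₁]
        exact hc'.trans hc.symm
      · rw [hf₂ τ d h]
        exact hf τ d
    · have key : ∀ {Γ : List (Ty B)} {τ : Ty B} (q : Term Γ τ), q.LevelLE i →
          q.tr (fun τ d => Term.con (f' τ d)) Subst.id =
          q.tr (fun τ d => Term.con (f τ d)) Subst.id := fun q hq =>
        hq.tr_congr (fun σ d hd => by rw [hf₂ σ d (hlt σ d hd)]) fun _ _ _ => rfl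
      simp only [State.tr, Term.allG, Term.tr_app, Term.tr_lcon, Term.tr_lam]
      rw [key G hG, List.map_congr_left fun D hD => key D (hP D hD)]
    · rw [Set.image_singleton, Set.disjoint_singleton_left, hf₁]
      exact hcC
  | _ => exact ⟨f, hf, rfl, by simp⟩

/-- Depth-first resolution: the head state is eliminated while the states of `R` wait. The renaming
`f` records the replacement of generic constants, which is needed because separate branches of a
proof tree may introduce the same constant. -/
theorem Provable.exists_res {S : Set Rule} (hS : ordinary ⊆ S) {A : StateVector B} {s : State B}
    (h : Provable s) : ∀ {f : ∀ τ : Ty B, Con τ → Con τ}, (∀ τ c, (f τ c).level = c.level) →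
      ∀ {η : Subst B} {R : StateVector B} {V : Set (AVar B)} {C N : Set (ACon B)},
        Res S A η (s.tr (fun _ c => Term.con (f _ c)) Subst.id :: R) V C N →
        ∃ (η' : Subst B) (V' : Set (AVar B)) (C' N' : Set (ACon B)),
          Res S A η' R V' C' N' ∧ ∀ x ∈ A.fv, η' x.1 x.2 = η x.1 x.2 := by
  induction h with
  | @mk T K s ss hg _ ih =>
    intro f hf η R V C N hr
    obtain ⟨f', hf', hs, hK⟩ := hg.exists_rename hf hr.finite.2
    rw [← hs] at hr
    obtain ⟨η₁, V₁, C₁, hr₁, hη₁, -⟩ := Res.ground hS (L := []) hr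
      (hg.tr (T' := Set.univ) hf' (fun _ _ => Term.levelLE_var le_rfl)
        fun _ _ _ => Set.subset_univ _) hK
    generalize N ∪ _ = N₁ at hr₁
    -- The subgoals are eliminated one after the other, all starting from the same renaming `f'`.
    have key : ∀ (l : List (State B)), (∀ s ∈ l, s ∈ ss) → ∀ {η₁ : Subst B} {V₁ : Set (AVar B)}
        {C₁ N₁ : Set (ACon B)},
        Res S A η₁ (l.map (State.tr (fun _ c => Term.con (f' _ c)) Subst.id) ++ R) V₁ C₁ N₁ →
        ∃ (η' : Subst B) (V' : Set (AVar B)) (C' N' : Set (ACon B)),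
          Res S A η' R V' C' N' ∧ ∀ x ∈ A.fv, η' x.1 x.2 = η₁ x.1 x.2 := by
      intro l
      induction l with
      | nil => intro _ η₁ V₁ C₁ N₁ hr; exact ⟨η₁, V₁, C₁, N₁, hr, fun _ _ => rfl⟩
      | cons s l ihl =>
        intro hl η₁ V₁ C₁ N₁ hr
        obtain ⟨η₂, V₂, C₂, N₂, hr₂, hη₂⟩ := ih s (hl s (List.mem_cons_self ..)) hf' hr
        obtain ⟨η₃, V₃, C₃, N₃, hr₃, hη₃⟩ :=
          ihl (fun s hs => hl s (List.mem_cons_of_mem _ hs)) hr₂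
        exact ⟨η₃, V₃, C₃, N₃, hr₃, fun x hx => (hη₃ x hx).trans (hη₂ x hx)⟩
    obtain ⟨η₂, V₂, C₂, N₂, hr₂, hη₂⟩ := key ss (fun _ h => h) hr₁
    exact ⟨η₂, V₂, C₂, N₂, hr₂, fun x hx => (hη₂ x hx).trans (hη₁ x hx)⟩

theorem Res.exists_null {S : Set Rule} (hS : ordinary ⊆ S) {A : StateVector B} :
    ∀ {A' : StateVector B}, (∀ s ∈ A', Provable s) →
      ∀ {η : Subst B} {V : Set (AVar B)} {C N : Set (ACon B)}, Res S A η A' V C N →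
        ∃ (η' : Subst B) (V' : Set (AVar B)) (C' N' : Set (ACon B)),
          Res S A η' [] V' C' N' ∧ ∀ x ∈ A.fv, η' x.1 x.2 = η x.1 x.2
  | [], _, η, V, C, N, hr => ⟨η, V, C, N, hr, fun _ _ => rfl⟩
  | s :: A', h, η, V, C, N, hr => by
    have hs : s.tr (fun _ c => Term.con c) Subst.id = s := by
      rw [← State.apply_eq_tr, State.apply_id]
    rw [← hs] at hr
    obtain ⟨η₁, V₁, C₁, N₁, hr₁, hη₁⟩ := (h s (List.mem_cons_self ..)).exists_res hS
      (f := fun _ c => c) (fun _ _ => rfl) hr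
    obtain ⟨η₂, V₂, C₂, N₂, hr₂, hη₂⟩ :=
      Res.exists_null hS (fun s hs => h s (List.mem_cons_of_mem _ hs)) hr₁
    exact ⟨η₂, V₂, C₂, N₂, hr₂, fun x hx => (hη₂ x hx).trans (hη₁ x hx)⟩

/-! ### Conservativity, and lifting to the null vector. -/

theorem Subst.restrict_congr {θ θ' : Subst B} {X : Set (AVar B)}
    (h : ∀ x ∈ X, θ x.1 x.2 = θ' x.1 x.2) : θ.restrict X = θ'.restrict X := by
  funext τ x
  by_cases hx : (⟨τ, x⟩ : AVar B) ∈ X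
  · rw [Subst.restrict_of_mem hx, Subst.restrict_of_mem hx]
    exact h _ hx
  · rw [Subst.restrict_of_notMem hx, Subst.restrict_of_notMem hx]

theorem Subst.restrict_restrict (θ : Subst B) (X : Set (AVar B)) :
    (θ.restrict X).restrict X = θ.restrict X :=
  Subst.restrict_congr fun _ hx => Subst.restrict_of_mem hx

theorem Subst.id_restrict (X : Set (AVar B)) : (Subst.id : Subst B).restrict X = Subst.id := by
  funext τ x
  exact ite_self _

theorem derives_null_of_provable {S : Set Rule} (hS : ordinary ⊆ S) {A : StateVector B}
    (h : ∀ s ∈ A, Provable s) : Derives S A Subst.id [] := by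
  obtain ⟨η, V, C, N, hr, hη⟩ := Res.exists_null hS h .refl
  exact ⟨N, η, V, C, hr, by rw [Subst.restrict_congr hη, Subst.id_restrict]⟩

theorem Derives.provable {S : Set Rule} {A : StateVector B} {θ : Subst B} (hA : A.Valid)
    (h : Derives S A θ []) : ∀ s ∈ A.apply θ, Provable s := by
  obtain ⟨N, η, V, C, hr, rfl⟩ := h
  rw [StateVector.apply_restrict, ← Subst.comp_id η]
  exact hr.provable hA Subst.legal_id fun s hs => (List.not_mem_nil hs).elim

theorem derives_ordinary_of_enriched {A : StateVector B} (hA : A.Valid)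
    (h : Derives enriched A Subst.id []) : Derives ordinary A Subst.id [] := by
  have h' := h.provable hA
  rw [StateVector.apply_id] at h'
  exact derives_null_of_provable subset_rfl h'

/-- Sub has to act through some state of the vector, which is why the null vector is excluded. -/
theorem Res.sub {S : Set Rule} (hS : Rule.sub ∈ S) {A A' : StateVector B} {η γ : Subst B}
    {V : Set (AVar B)} {C N : Set (ACon B)} (h : Res S A η A' V C N) (hne : A' ≠ [])
    (hγ : γ.Legal) : ∃ V' : Set (AVar B),
      Res S A (η.comp γ) (A'.apply γ) V' (C ∪ γ.oc ∪ (A'.apply γ).oc) N := by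
  obtain ⟨⟨i, P, G⟩, R, rfl⟩ := List.exists_cons_of_ne_nil hne
  have h' := Res.step h hS (.sub [] R i P G hγ)
  simp only [Set.union_empty] at h'
  exact ⟨_, h'⟩

/-- One Sub step with the composed substitution produces provable states, and these vanish without
changing the answer. If `A` is empty, no Sub step is available, but the restricted substitution is
the identity anyway. -/
theorem derives_null_of_apply {A : StateVector B} {θ φ : Subst B} (hA : A.Valid) (hθ : θ.Legal)
    (h : Derives enriched (A.apply θ) φ []) :
    Derives enriched A ((θ.comp φ).restrict A.fv) [] := by
  have hp := h.provable (hA.apply hθ)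
  rw [← StateVector.apply_comp, ← StateVector.apply_restrict] at hp
  by_cases hne : A = []
  · subst hne
    refine ⟨∅, Subst.id, _, _, .refl, ?_⟩
    rw [Subst.id_restrict]
    funext τ x
    refine Subst.restrict_of_notMem ?_
    rintro ⟨s, hs, -⟩
    exact List.not_mem_nil hs
  · have hφ : φ.Legal := by
      obtain ⟨N, η, V, C, hr, rfl⟩ := h
      exact hr.legal.restrict _
    obtain ⟨V, hr⟩ := Res.sub (S := enriched) (Set.mem_univ _) .refl hne
      ((hθ.comp hφ).restrict A.fv)
    obtain ⟨η, V, C, N, hr, hη⟩ := Res.exists_null (fun _ _ => Set.mem_univ _) hp hr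
    refine ⟨N, η, V, C, hr, ?_⟩
    rw [Subst.restrict_congr hη, Subst.id_comp, Subst.restrict_restrict]

end Terms


section Terms

variable {B : Type u}

/-! ### Lifting -/

/-- The substitution given by a renaming of the logic variables. -/
def Subst.ofRen (p : ∀ τ : Ty B, LVar τ → LVar τ) : Subst B := fun τ x => Term.var (.free (p τ x))

theorem Subst.oc_ofRen (p : ∀ τ : Ty B, LVar τ → LVar τ) : (Subst.ofRen p).oc = ∅ := by
  refine Set.eq_empty_iff_forall_notMem.2 fun c hc => ?_
  obtain ⟨x, -, hc⟩ := Set.mem_iUnion₂.1 hc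
  have : (Subst.ofRen p x.1 x.2).oc = ∅ := Term.oc_var _
  rw [this] at hc
  exact hc

theorem Subst.legal_ofRen {p : ∀ τ : Ty B, LVar τ → LVar τ} {X : Set (AVar B)} (hX : X.Finite)
    (hp : ∀ x ∉ X, p x.1 x.2 = x.2) (hl : ∀ τ x, (p τ x).level = x.level) :
    (Subst.ofRen p).Legal := by
  refine ⟨hX.subset fun x hx => ?_, fun τ x => Term.levelLE_var (hl τ x).le⟩
  by_contra h
  refine hx ?_
  rw [Subst.ofRen, hp x h]
  rfl

open Classical in
/-- A renaming that exchanges the variables in `Z` with variables outside `V`, and a renaming that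
undoes this for the variables outside `Z`. -/
theorem exists_swap {Z V : Set (AVar B)} (hZ : Z.Finite) (hV : V.Finite) :
    ∃ (p q : ∀ τ : Ty B, LVar τ → LVar τ) (X : Set (AVar B)), X.Finite ∧
      (∀ x ∉ X, p x.1 x.2 = x.2) ∧ (∀ x ∉ X, q x.1 x.2 = x.2) ∧
      (∀ τ x, (p τ x).level = x.level) ∧ (∀ τ x, (q τ x).level = x.level) ∧
      (∀ τ x, p τ (p τ x) = x) ∧
      (∀ x ∈ Z, (⟨x.1, p x.1 x.2⟩ : AVar B) ∉ V ∧ q x.1 x.2 = x.2) ∧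
      (∀ x ∈ V, x ∉ Z → p x.1 x.2 = x.2) ∧ ∀ x ∈ V, q x.1 (p x.1 x.2) = x.2 := by
  -- All indices in use are at most `n`, so a shift by `n + 1` leads outside `Z ∪ V`.
  obtain ⟨n, hn⟩ := ((hZ.union hV).image fun x : AVar B => x.2.idx).bddAbove
  have hle : ∀ (τ : Ty B) (x : LVar τ), (⟨τ, x⟩ : AVar B) ∈ Z ∪ V → x.idx ≤ n := fun τ x hx =>
    hn ⟨⟨τ, x⟩, hx, rfl⟩
  let up : ∀ τ : Ty B, LVar τ → LVar τ := fun _ x => ⟨x.level, x.idx + (n + 1), x.ok⟩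
  let down : ∀ τ : Ty B, LVar τ → LVar τ := fun _ x => ⟨x.level, x.idx - (n + 1), x.ok⟩
  have hdu : ∀ τ x, down τ (up τ x) = x := by
    intro τ x
    simp [down, up]
  have hud : ∀ τ (x : LVar τ), n < x.idx → up τ (down τ x) = x := by
    rintro τ ⟨l, k, ok⟩ h
    have h' : n < k := h
    simp only [down, up, LVar.mk.injEq, true_and]
    omega
  -- `q` works in one direction only: it brings the shifted copy of `Z` back and fixes `Z` itself,
  -- while `p` exchanges the two.
  let q : ∀ τ : Ty B, LVar τ → LVar τ := fun τ x =>
    if n < x.idx ∧ (⟨τ, down τ x⟩ : AVar B) ∈ Z then down τ x else x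
  let p : ∀ τ : Ty B, LVar τ → LVar τ := fun τ x =>
    if (⟨τ, x⟩ : AVar B) ∈ Z then up τ x else q τ x
  have hup : ∀ τ (x : LVar τ), n < (up τ x).idx := fun τ x => by simp only [up]; omega
  have hupn : ∀ τ (x : LVar τ), (⟨τ, up τ x⟩ : AVar B) ∉ Z ∪ V := fun τ x h =>
    absurd (hle τ _ h) (not_le.2 (hup τ x))
  have hqu : ∀ τ (x : LVar τ), (⟨τ, x⟩ : AVar B) ∈ Z → q τ (up τ x) = x := by
    intro τ x hx
    have h : n < (up τ x).idx ∧ (⟨τ, down τ (up τ x)⟩ : AVar B) ∈ Z := by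
      rw [hdu]
      exact ⟨hup τ x, hx⟩
    exact (if_pos h).trans (hdu τ x)
  have hq : ∀ τ (x : LVar τ), (⟨τ, x⟩ : AVar B) ∈ Z ∪ V → q τ x = x := fun τ x hx =>
    if_neg fun h => absurd (hle τ x hx) (not_le.2 h.1)
  refine ⟨p, q, Z ∪ (fun x : AVar B => (⟨x.1, up x.1 x.2⟩ : AVar B)) '' Z, hZ.union (hZ.image _),
    ?_, ?_, ?_, ?_, ?_, ?_, ?_, ?_⟩
  · intro x hx
    simp only [Set.mem_union, not_or] at hx
    refine (if_neg hx.1).trans (if_neg fun h => hx.2 ⟨_, h.2, ?_⟩)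
    simp only [hud _ _ h.1]
  · intro x hx
    simp only [Set.mem_union, not_or] at hx
    refine if_neg fun h => hx.2 ⟨_, h.2, ?_⟩
    simp only [hud _ _ h.1]
  · intro τ x
    simp only [p, q]
    split_ifs <;> rfl
  · intro τ x
    simp only [q]
    split_ifs <;> rfl
  · intro τ x
    by_cases hx : (⟨τ, x⟩ : AVar B) ∈ Z
    · have h₁ : p τ x = up τ x := if_pos hx
      rw [h₁]
      exact (if_neg fun h => hupn τ x (.inl h)).trans (hqu τ x hx)
    · have h₁ : p τ x = q τ x := if_neg hx
      by_cases h : n < x.idx ∧ (⟨τ, down τ x⟩ : AVar B) ∈ Z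
      · have h₂ : q τ x = down τ x := if_pos h
        rw [h₁, h₂]
        exact (if_pos h.2).trans (hud τ x h.1)
      · have h₂ : q τ x = x := if_neg h
        rw [h₁, h₂, h₁, h₂]
  · intro x hx
    have h₁ : p x.1 x.2 = up x.1 x.2 := if_pos hx
    rw [h₁]
    exact ⟨fun h => hupn _ _ (.inr h), hq _ _ (.inl hx)⟩
  · intro x hx hxZ
    exact (if_neg hxZ).trans (hq _ _ (.inr hx))
  · intro x hx
    by_cases hxZ : x ∈ Z
    · have h₁ : p x.1 x.2 = up x.1 x.2 := if_pos hxZ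
      rw [h₁]
      exact hqu _ _ hxZ
    · have h₁ : p x.1 x.2 = q x.1 x.2 := if_neg hxZ
      rw [h₁, hq _ _ (.inr hx), hq _ _ (.inr hx)]

theorem Res.eq_nil {S : Set Rule} {A' : StateVector B} {η : Subst B} {V : Set (AVar B)}
    {C N : Set (ACon B)} (h : Res S [] η A' V C N) : A' = [] := by
  induction h with
  | refl => rfl
  | step _ _ hs ih => exact (hs.ne_nil ih).elim

/-- The given resolution is followed through its image under the involution `π`, after an initial
Sub step with `θ`. Conjugation by `π` keeps the erased variables of `A` and `θ` apart from the names
used in the resolution. Constants are not touched, so the generic ones stay fresh as soon as they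
avoid `A` and `θ`. -/
theorem Res.lift {A A' : StateVector B} {θ η : Subst B} {V : Set (AVar B)} {C N : Set (ACon B)}
    (hA : A.Valid) (hne : A ≠ []) (hθ : θ.Legal) {p : ∀ τ : Ty B, LVar τ → LVar τ}
    (hπ : (Subst.ofRen p).Legal) (hp : ∀ τ x, p τ (p τ x) = x)
    (hfix : ∀ x ∈ (A.apply θ).fv, p x.1 x.2 = x.2)
    (h : Res enriched (A.apply θ) η A' V C N) :
    Disjoint N (A.oc ∪ θ.oc) → ∃ (η' : Subst B) (V' : Set (AVar B)) (C' : Set (ACon B)),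
      Res enriched A η' (A'.apply (Subst.ofRen p)) V' C' N ∧
      (∀ x ∈ A.fv, η' x.1 x.2 = (Subst.ofRen p).apply (η.apply ((Subst.ofRen p).apply (θ x.1 x.2))))
      ∧ C' ⊆ C ∪ (A.oc ∪ θ.oc) := by
  set π := Subst.ofRen p with hπdef
  have hππ : π.comp π = Subst.id := by
    funext τ x
    change π.apply (Term.var (.free (p τ x))) = _
    rw [Subst.apply_var]
    change Term.var (.free (p τ (p τ x))) = _
    rw [hp]
    rfl
  have hππ' : ∀ {τ : Ty B} (t : CTerm τ), π.apply (π.apply t) = t := fun t => by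
    rw [← Subst.apply_comp, hππ, Subst.apply_id]
  have hπoc : π.oc = ∅ := Subst.oc_ofRen p
  have hocπ : ∀ A : StateVector B, (A.apply π).oc ⊆ A.oc := fun A => by
    simpa [hπoc] using StateVector.oc_apply_subset π A
  have hocπ' : ∀ {τ : Ty B} (q : CTerm τ), (π.apply q).oc ⊆ q.oc := fun q => by
    simpa [hπoc] using Subst.oc_apply_subset π q
  induction h with
  | refl =>
    intro _
    obtain ⟨V', h'⟩ := Res.sub (S := enriched) (Set.mem_univ _) .refl hne hθ
    rw [Subst.id_comp] at h'
    have hfix' : (A.apply θ).apply π = A.apply θ :=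
      StateVector.apply_eq_self fun x hx => congrArg (fun y => Term.var (.free y)) (hfix x hx)
    refine ⟨θ, V', _, by rw [hfix']; exact h', fun x _ => ?_, ?_⟩
    · rw [Subst.apply_id, hππ']
    · rintro c ((hc | hc) | hc)
      · exact .inr (.inl hc)
      · exact .inr (.inr hc)
      · exact .inl hc
  | @step η γ A' A'' V W C N K ρ hr _ hs ih =>
    intro hN
    obtain ⟨η₁, V₁, C₁, hr₁, hη₁, hC₁⟩ := ih (hN.mono_left Set.subset_union_left)
    -- The image of a step with substitution `γ` is a Sub step with the conjugate of `γ`, followed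
    -- by a ground step renamed by `π`.
    have hγ' : (π.comp (γ.comp π)).Legal := hπ.comp (hs.legal.comp hπ)
    obtain ⟨V₂, hr₂⟩ := hr₁.sub (Set.mem_univ _)
      (fun h => hs.ne_nil (List.map_eq_nil_iff.1 h)) hγ'
    have hvec : (A'.apply π).apply (π.comp (γ.comp π)) = (A'.apply γ).apply π := by
      rw [StateVector.apply_comp, ← StateVector.apply_comp π π, hππ, StateVector.apply_id,
        StateVector.apply_comp]
    have hoc : (π.comp (γ.comp π)).oc ⊆ γ.oc := by
      intro c hc
      obtain ⟨x, -, hc⟩ := Set.mem_iUnion₂.1 hc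
      have hc' : c ∈ ((γ.comp π).apply (Term.var (.free (p x.1 x.2)))).oc := hc
      rw [Subst.apply_var] at hc'
      exact Subst.oc_value_subset γ _ (hocπ' _ hc')
    rw [hvec] at hr₂
    obtain ⟨L, R, s, ss, hAγ, rfl, hg⟩ := hs.ground (hr.valid (hA.apply hθ))
    have hgπ := hg.apply (T' := γ.oc) hπ fun τ q hq => (hocπ' q).trans hq
    have hocγ : ((A'.apply γ).apply π).oc ⊆ C ∪ γ.oc :=
      ((hocπ _).trans (StateVector.oc_apply_subset γ A')).trans
        (Set.union_subset_union_left _ hr.oc_subset)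
    have hC₂ : C₁ ∪ (π.comp (γ.comp π)).oc ∪ ((A'.apply γ).apply π).oc ⊆
        C ∪ γ.oc ∪ (A.oc ∪ θ.oc) := by
      rintro c ((hc | hc) | hc)
      · exact (hC₁ hc).imp .inl id
      · exact .inl (.inr (hoc hc))
      · exact .inl (hocγ hc)
    -- Only Generic introduces constants, and its substitution is the identity; so `γ` adds no
    -- constants in the case where freshness matters.
    have hK : Disjoint K (C₁ ∪ (π.comp (γ.comp π)).oc ∪ ((A'.apply γ).apply π).oc) := by
      rcases hs.eq_empty_or_eq_id with rfl | hid
      · exact Set.empty_disjoint _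
      · refine Set.disjoint_of_subset_right hC₂ ?_
        rw [hid, Subst.oc_id, Set.union_empty]
        exact hs.disjoint.union_right (hN.mono_left Set.subset_union_right)
    rw [hAγ, StateVector.apply_append, StateVector.apply_cons] at hr₂ hK hC₂
    obtain ⟨η₃, V₃, C₃, hr₃, hη₃, hC₃⟩ := hr₂.ground (fun _ _ => Set.mem_univ _) hgπ hK
    refine ⟨η₃, V₃, C₃, ?_, fun x hx => (hη₃ x hx).trans ?_, ?_⟩
    · rw [StateVector.apply_append, StateVector.apply_append]
      exact hr₃
    · change Subst.apply _ (η₁ x.1 x.2) = _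
      rw [hη₁ x hx, Subst.apply_comp, hππ', Subst.apply_comp, Subst.apply_comp]
    · have hA'' : (StateVector.apply π (L ++ ss ++ R)).oc ⊆ (L ++ ss ++ R : StateVector B).oc :=
        hocπ _
      rw [StateVector.apply_append, StateVector.apply_append] at hA''
      intro c hc
      rcases hC₃ hc with ((hc | hc) | hc) | hc
      · rcases hC₂ hc with (hc | hc) | hc
        · exact .inl (.inl (.inl (.inl hc)))
        · exact .inl (.inl (.inr hc))
        · exact .inr hc
      · exact .inl (.inl (.inl (.inr hc)))
      · exact .inl (.inl (.inr hc))
      · exact .inl (.inr (hA'' hc))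

/-- Normalisation may erase variables from `A θ`, and the given resolution may then take them as
fresh and bind them, whereas its restricted answer fixes them. The renaming `p` protects exactly
these variables. -/
theorem derives_of_apply {A A' : StateVector B} {θ φ : Subst B} {N : Set (ACon B)} (hA : A.Valid)
    (hθ : θ.Legal) (h : DerivesWith enriched (A.apply θ) φ A' N) (hne : A' ≠ [])
    (hN : Disjoint N (A.oc ∪ (θ.restrict A.fv).oc)) :
    Derives enriched A ((θ.comp φ).restrict A.fv) A' := by
  obtain ⟨η, V, C, hr, rfl⟩ := h
  have hθ' := hθ.restrict A.fv
  have hvec := StateVector.apply_restrict θ A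
  set θ' := θ.restrict A.fv with hθdef
  rw [← hvec] at hr ⊢
  have hAne : A ≠ [] := by
    rintro rfl
    exact hne hr.eq_nil
  obtain ⟨p, q, X, hX, hpX, hqX, hpl, hql, hpp, hpZ, hpV, hqp⟩ :=
    exists_swap (((A.finite_fv.union hθ'.finite_fv)).sdiff (t := (A.apply θ').fv)) hr.finite.1
  obtain ⟨η', V', C', hr', hη', -⟩ := hr.lift hA hAne hθ' (Subst.legal_ofRen hX hpX hpl) hpp
    (fun x hx => hpV x (hr.start_fv_subset hx) fun h => h.2 hx) hN
  obtain ⟨V'', hr''⟩ := hr'.sub (Set.mem_univ _) (fun h => hne (List.map_eq_nil_iff.1 h))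
    (Subst.legal_ofRen hX hqX hql)
  have hback : ∀ x ∈ V, ((Subst.ofRen p).comp (Subst.ofRen q)) x.1 x.2 =
      Term.var (.free x.2) := by
    intro x hx
    refine (Subst.apply_var _ (p x.1 x.2)).trans ?_
    exact congrArg (fun y => Term.var (.free y)) (hqp x hx)
  rw [← StateVector.apply_comp,
    StateVector.apply_eq_self fun x hx => hback x (hr.fv_subset hx)] at hr''
  refine ⟨N, _, _, _, hr'', Subst.restrict_congr fun x hx => ?_⟩
  change Subst.apply _ (θ x.1 x.2) = Subst.apply _ (η' x.1 x.2)
  have hθx : θ x.1 x.2 = θ' x.1 x.2 := (Subst.restrict_of_mem hx).symm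
  rw [hη' x hx, ← Subst.apply_comp, ← Subst.apply_comp, ← Subst.apply_comp, hθx]
  refine Subst.apply_congr _ fun z hz => ?_
  change _ = Subst.apply (η.comp _) (Term.var (.free (p z.1 z.2)))
  rw [Subst.apply_var]
  change _ = Subst.apply ((Subst.ofRen p).comp (Subst.ofRen q)) (η z.1 (p z.1 z.2))
  by_cases hzA : z ∈ (A.apply θ').fv
  · have hzV := hr.start_fv_subset hzA
    rw [Subst.restrict_of_mem hzA, hpV z hzV fun h => h.2 hzA]
    refine ((Subst.apply_congr (θ' := Subst.id) _ fun y hy => ?_).trans (Subst.apply_id _)).symm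
    exact hback y (hr.fv_value_subset z hzV hy)
  · have hzZ : z ∈ (A.fv ∪ θ'.fv) \ (A.apply θ').fv := by
      refine ⟨?_, hzA⟩
      rcases Subst.fv_value_subset θ' _ hz with hz | hz
      · exact .inr hz
      · rw [Set.mem_singleton_iff.1 hz]
        exact .inl hx
    rw [Subst.restrict_of_notMem hzA, hr.value_of_notMem ⟨z.1, p z.1 z.2⟩ (hpZ z hzZ).1,
      Subst.apply_var]
    change _ = Subst.apply _ (Term.var (.free (p z.1 (p z.1 z.2))))
    rw [Subst.apply_var, hpp]
    exact congrArg (fun y => Term.var (.free y)) (hpZ z hzZ).2.symm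

end Terms


/-! ### Occurrences after substitution, and levels of elaborated programs. -/

section Occurrences

variable {B : Type u}

theorem Tm.hasVar_bind {Γ : List (Ty B)} {τ : Ty B} {x : AVar B} (t : Tm Γ τ) :
    ∀ {Δ : List (Ty B)} {s : ∀ σ, Vr Γ σ → Tm Δ σ}, (t.bind s).HasVar x →
      ∃ σ, ∃ y : Vr Γ σ, (∀ z, y.Is z → t.HasVar z) ∧ (s σ y).HasVar x := by
  induction t with
  | var y => intro Δ s h; exact ⟨_, y, fun _ h => h, h⟩
  | con c => intro Δ s h; exact h.elim
  | lcon k => intro Δ s h; exact h.elim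
  | inc e t ih => intro Δ s h; exact ih h
  | app t u iht ihu =>
    intro Δ s h
    rcases h with h | h
    · obtain ⟨σ, y, hy, hx⟩ := iht h
      exact ⟨σ, y, fun z hz => .inl (hy z hz), hx⟩
    · obtain ⟨σ, y, hy, hx⟩ := ihu h
      exact ⟨σ, y, fun z hz => .inr (hy z hz), hx⟩
  | lam hα t ih =>
    intro Δ s h
    obtain ⟨σ, y, hy, hx⟩ := ih (s := liftSub s _) h
    cases y with
    | zero => exact hx.elim
    | succ y => exact ⟨σ, y, hy, (Tm.hasVar_wk _).1 hx⟩

/-- Bound variables satisfy the condition vacuously, but a context has finitely many. Thus a fresh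
variable has only finitely many substituted terms to avoid. -/
theorem Vr.finite_setOf_is {X : Set (AVar B)} (hX : X.Finite) : ∀ Γ : List (Ty B),
    {y : Σ σ : Ty B, Vr Γ σ | ∀ x, y.2.Is x → x ∈ X}.Finite
  | [] => by
    refine (hX.image fun x => (⟨x.1, .free x.2⟩ : Σ σ : Ty B, Vr [] σ)).subset ?_
    rintro ⟨σ, y⟩ hy
    cases y with
    | free x => exact ⟨⟨σ, x⟩, hy _ rfl, rfl⟩
  | α :: Γ => by
    refine (((Vr.finite_setOf_is hX Γ).image fun y =>
      (⟨y.1, .succ y.2⟩ : Σ σ : Ty B, Vr (α :: Γ) σ)).insert ⟨α, .zero⟩).subset ?_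
    rintro ⟨σ, y⟩ hy
    cases y with
    | zero => exact .inl rfl
    | succ y => exact .inr ⟨⟨σ, y⟩, hy, rfl⟩

theorem InElaboration.levelLE {i : ℕ} {Γ : List (Ty B)} {D : Term Γ .p} {K : Clause Γ}
    (h : InElaboration i D K) : D.LevelLE i := by
  induction h with
  | fact hA => exact hA.inc _
  | rule hG hA => exact ((Term.levelLE_lcon i _).app hG).app hA
  | left hD _ ih => exact ((Term.levelLE_lcon i _).app ih).app hD
  | right hD _ ih => exact ((Term.levelLE_lcon i _).app hD).app ih
  | all hα _ ih => exact (Term.levelLE_lcon i _).app (ih.lam hα)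

end Occurrences

section Semantics

variable {B : Type u} {Ω : Type w} [DistribLattice Ω] [OrderTop Ω]

open Classical in
/-- The assignment with the value at `y` replaced by `d`. -/
noncomputable def UniformStructure.Assign.update {M : UniformStructure.{u, v} B} (φ : M.Assign)
    {α : Ty B} (y : LVar α) (d : M.D y.level α) : M.Assign := fun τ x =>
  Function.update (β := fun a : AVar B => M.D a.2.level a.1) (fun a => φ a.1 a.2) ⟨α, y⟩ d ⟨τ, x⟩

theorem UniformStructure.Assign.update_self {M : UniformStructure.{u, v} B} (φ : M.Assign)
    {α : Ty B} (y : LVar α) (d : M.D y.level α) :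
    UniformStructure.Assign.update φ y d α y = d := by
  classical
  exact Function.update_self ..

theorem UniformStructure.Assign.update_of_ne {M : UniformStructure.{u, v} B} (φ : M.Assign)
    {α : Ty B} {y : LVar α} (d : M.D y.level α) {x : AVar B} (h : x ≠ ⟨α, y⟩) :
    UniformStructure.Assign.update φ y d x.1 x.2 = φ x.1 x.2 := by
  classical
  exact Function.update_of_ne (β := fun a : AVar B => M.D a.2.level a.1) h ..

namespace UniformAlgebra

variable (M : UniformAlgebra.{u, v, w} B Ω)

/-! ### Coincidence and substitution -/

/-- Coincidence and substitution lemma in one. An abstraction is known only through its value at a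
fresh variable, so both sides are carried under the binder with the same fresh variable and both
assignments are updated there. The last hypothesis quantifies over all assignments agreeing on the
occurring variables in order to survive these updates. -/
theorem U_bind_congr {i : ℕ} {Γ : List (Ty B)} {τ : Ty B} (t : Tm Γ τ) (ht : t.LevelLE i) :
    ∀ {s s' : ∀ σ, Vr Γ σ → Tm [] σ} {φ φ' : M.M.Assign},
      (∀ σ (y : Vr Γ σ), y.LevelLE i → (s σ y).LevelLE i) →
      (∀ σ (y : Vr Γ σ), y.LevelLE i → (s' σ y).LevelLE i) →
      (∀ σ (y : Vr Γ σ), (∀ x, y.Is x → t.HasVar x) → ∀ φ₁ φ₁' : M.M.Assign,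
        (∀ x, (s σ y).HasVar x → φ₁ x.1 x.2 = φ x.1 x.2) →
        (∀ x, (s' σ y).HasVar x → φ₁' x.1 x.2 = φ' x.1 x.2) →
        M.U i (Term.mk (s σ y)) φ₁ = M.U i (Term.mk (s' σ y)) φ₁') →
      M.U i (Term.mk (t.bind s)) φ = M.U i (Term.mk (t.bind s')) φ' := by
  induction t with
  | var y =>
    intro s s' φ φ' _ _ h
    exact h _ y (fun _ h => h) φ φ' (fun _ _ => rfl) fun _ _ => rfl
  | con c =>
    intro s s' φ φ' _ _ _
    exact (M.U_con c φ ht).trans (M.U_con c φ' ht).symm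
  | lcon k =>
    intro s s' φ φ' _ _ _
    exact (M.U_lcon k φ).trans (M.U_lcon k φ').symm
  | inc e t ih =>
    intro s s' φ φ' hs hs' h
    refine (M.U_inc e (Term.mk (t.bind s)) φ ⟨_, rfl, Tm.levelLE_bind le_rfl t hs ht⟩).trans
      (Eq.trans ?_ (M.U_inc e (Term.mk (t.bind s')) φ'
        ⟨_, rfl, Tm.levelLE_bind le_rfl t hs' ht⟩).symm)
    rw [ih ht hs hs' h]
  | app t u iht ihu =>
    intro s s' φ φ' hs hs' h
    refine (M.U_app (Term.mk (t.bind s)) (Term.mk (u.bind s)) φ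
      ⟨_, rfl, Tm.levelLE_bind le_rfl t hs ht.1⟩
      ⟨_, rfl, Tm.levelLE_bind le_rfl u hs ht.2⟩).trans
      (Eq.trans ?_ (M.U_app (Term.mk (t.bind s')) (Term.mk (u.bind s')) φ'
        ⟨_, rfl, Tm.levelLE_bind le_rfl t hs' ht.1⟩
        ⟨_, rfl, Tm.levelLE_bind le_rfl u hs' ht.2⟩).symm)
    rw [iht ht.1 hs hs' fun σ y hy => h σ y fun x hx => .inl (hy x hx),
      ihu ht.2 hs hs' fun σ y hy => h σ y fun x hx => .inr (hy x hx)]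
  | @lam Γ α β hα t ih =>
    intro s s' φ φ' hs hs' h
    refine M.M.ext _ _ fun d => ?_
    let O : Set (Σ σ : Ty B, Vr Γ σ) := {y | ∀ x, y.2.Is x → x ∈ {x | t.HasVar x}}
    have hO : O.Finite := Vr.finite_setOf_is t.finite_hasVar Γ
    -- `U_lam` needs a variable of level exactly `i`, and it must not occur in the images under `s`
    -- or `s'` of any variable that can occur in `t`.
    obtain ⟨⟨l, n, hok⟩, rfl, hw⟩ := exists_fresh_var
      ((hO.biUnion fun y _ => (s y.1 y.2).finite_hasVar).union
        (hO.biUnion fun y _ => (s' y.1 y.2).finite_hasVar)) hα i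
    simp only [Set.mem_union, not_or, Set.mem_iUnion, not_exists] at hw
    have key : ∀ (s : ∀ σ, Vr Γ σ → Tm [] σ) (φ : M.M.Assign),
        (∀ σ (y : Vr Γ σ), y.LevelLE l → (s σ y).LevelLE l) →
        (∀ y ∈ O, ¬ (s y.1 y.2).HasVar ⟨α, ⟨l, n, hα⟩⟩) →
        M.M.app (M.U l (Term.mk ((Tm.lam hα t).bind s)) φ) d =
          M.U l (Term.mk (t.bind fun σ y =>
            (liftSub s α σ y).bind (instSub (.var (.free ⟨l, n, hα⟩)))))
            (UniformStructure.Assign.update φ ⟨l, n, hα⟩ d) := by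
      intro s φ hs hw
      have h₁ := M.U_lam (i := l) hα (Term.mk (t.bind (liftSub s α))) n φ
        (UniformStructure.Assign.update φ ⟨l, n, hα⟩ d)
        ⟨_, rfl, Tm.levelLE_bind le_rfl t (fun σ y hy => by
          cases y with
          | zero => trivial
          | succ y => exact Tm.levelLE_wk (hs _ y hy)) ht⟩
        (fun hfv => by
          obtain ⟨σ, y, hy, hx⟩ := Tm.hasVar_bind t (hfv _ rfl)
          cases y with
          | zero => exact hx
          | succ y => exact hw ⟨σ, y⟩ hy ((Tm.hasVar_wk _).1 hx))
        (fun x hx => UniformStructure.Assign.update_of_ne φ d hx)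
      rw [UniformStructure.Assign.update_self, Term.var, Term.inst_mk, Tm.bind_bind] at h₁
      exact h₁
    rw [key s φ hs fun y hy => hw.1 y hy, key s' φ' hs' fun y hy => hw.2 y hy]
    have lev : ∀ s : ∀ σ, Vr Γ σ → Tm [] σ,
        (∀ σ (y : Vr Γ σ), y.LevelLE l → (s σ y).LevelLE l) →
        ∀ σ (y : Vr (α :: Γ) σ), y.LevelLE l →
          ((liftSub s α σ y).bind (instSub (.var (.free ⟨l, n, hα⟩)))).LevelLE l := by
      intro s hs σ y hy
      cases y with
      | zero => exact le_refl l
      | succ y =>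
        rw [liftSub, Tm.wk_bind_instSub]
        exact hs σ y hy
    refine ih ht (lev s hs) (lev s' hs') fun σ y hy φ₁ φ₁' h₁ h₁' => ?_
    cases y with
    | zero =>
      refine (M.U_var ⟨l, n, hα⟩ φ₁ le_rfl).trans
        (Eq.trans ?_ (M.U_var ⟨l, n, hα⟩ φ₁' le_rfl).symm)
      have e₁ := h₁ ⟨α, ⟨l, n, hα⟩⟩ rfl
      have e₁' := h₁' ⟨α, ⟨l, n, hα⟩⟩ rfl
      simp only [UniformStructure.Assign.update_self] at e₁ e₁'
      rw [e₁, e₁']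
    | succ y =>
      simp only [liftSub, Tm.wk_bind_instSub] at h₁ h₁' ⊢
      refine h σ y hy φ₁ φ₁' (fun x hx => (h₁ x hx).trans ?_) (fun x hx => (h₁' x hx).trans ?_)
      · refine UniformStructure.Assign.update_of_ne φ d ?_
        rintro rfl
        exact hw.1 ⟨σ, y⟩ hy hx
      · refine UniformStructure.Assign.update_of_ne φ' d ?_
        rintro rfl
        exact hw.2 ⟨σ, y⟩ hy hx

theorem U_congr_of_hasVar {i : ℕ} {τ : Ty B} (t : Tm [] τ) (ht : t.LevelLE i)
    {φ φ' : M.M.Assign} (h : ∀ x, t.HasVar x → φ x.1 x.2 = φ' x.1 x.2) :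
    M.U i (Term.mk t) φ = M.U i (Term.mk t) φ' := by
  have := M.U_bind_congr t ht (s := fun _ y => .var y) (s' := fun _ y => .var y) (φ := φ)
    (φ' := φ') (fun _ _ h => h) (fun _ _ h => h) (fun σ y hy φ₁ φ₁' h₁ h₁' => by
      cases y with
      | free x =>
        have hx := hy ⟨σ, x⟩ rfl
        refine (M.U_var x φ₁ (ht.hasVar hx)).trans (Eq.trans ?_ (M.U_var x φ₁' (ht.hasVar hx)).symm)
        rw [h₁ ⟨σ, x⟩ rfl, h₁' ⟨σ, x⟩ rfl, h ⟨σ, x⟩ hx])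
  rwa [Tm.bind_var] at this

theorem U_congr {i : ℕ} {τ : Ty B} {q : CTerm τ} (hq : q.LevelLE i)
    {φ φ' : M.M.Assign} (h : ∀ τ (x : LVar τ), x.level ≤ i → φ τ x = φ' τ x) :
    M.U i q φ = M.U i q φ' := by
  obtain ⟨t, rfl, ht⟩ := hq
  exact M.U_congr_of_hasVar t ht fun x hx => h _ _ (ht.hasVar hx)

/-- The assignment of the values under `φ` of the terms substituted by `γ`. -/
def sub (γ : Subst B) (φ : M.M.Assign) : M.M.Assign := fun τ x => M.U x.level (γ τ x) φ

theorem U_apply {i : ℕ} {τ : Ty B} {q : CTerm τ} (hq : q.LevelLE i) {γ : Subst B}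
    (hγ : ∀ τ (x : LVar τ), (γ τ x).LevelLE x.level) (φ : M.M.Assign) :
    M.U i (γ.apply q) φ = M.U i q (M.sub γ φ) := by
  obtain ⟨t, rfl, ht⟩ := hq
  choose γ₀ hγ₁ hγ₂ using hγ
  have hκ : ∀ (τ : Ty B) (c : Con τ), Term.mk (.con c : Tm [] τ) = Term.con c := fun _ _ => rfl
  rw [Subst.apply_eq_tr, Term.tr_mk hκ hγ₁, Tm.tr_con_eq_bind]
  conv_rhs => rw [← Tm.bind_var t]
  refine M.U_bind_congr t ht (fun σ y hy => ?_) (fun _ _ h => h) fun σ y hy φ₁ φ₁' h₁ h₁' => ?_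
  · cases y with
    | free x => exact (hγ₂ σ x).mono hy
  · cases y with
    | free x =>
      have hx := ht.hasVar (hy ⟨σ, x⟩ rfl)
      refine Eq.trans ?_ (M.U_var x φ₁' hx).symm
      rw [h₁' ⟨σ, x⟩ rfl, sub, ← hγ₁]
      refine (M.U_congr_of_hasVar (γ₀ σ x) ((hγ₂ σ x).mono hx) h₁).trans ?_
      exact M.U_lift hx _ φ ⟨_, rfl, hγ₂ σ x⟩

/-! ### Truth values of state vectors -/

theorem prog_append (i : ℕ) (P : List (CTerm (B := B) .p)) (D : CTerm (B := B) .p)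
    (φ : M.M.Assign) :
    M.prog i (P ++ [D]) φ = M.M.bin .andP (M.prog i P φ) (M.U i D φ) := by
  simp only [prog, List.foldl_append, List.foldl_cons, List.foldl_nil]

theorem vector_cons (s : State B) (A : StateVector B) (φ : M.M.Assign) :
    M.vector (s :: A) φ = M.state s φ ⊓ M.vector A φ := rfl

theorem vector_append (A A' : StateVector B) (φ : M.M.Assign) :
    M.vector (A ++ A') φ = M.vector A φ ⊓ M.vector A' φ := by
  induction A with
  | nil => exact (top_inf_eq _).symm
  | cons s A ih => rw [List.cons_append, vector_cons, vector_cons, ih, inf_assoc]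

theorem vector_singleton (s : State B) (φ : M.M.Assign) : M.vector [s] φ = M.state s φ :=
  inf_top_eq _

theorem prog_congr (i : ℕ) {P P' : List (CTerm (B := B) .p)} {φ φ' : M.M.Assign}
    (h : P.map (fun D => M.U i D φ) = P'.map (fun D => M.U i D φ')) :
    M.prog i P φ = M.prog i P' φ' := by
  have key : ∀ (P : List (CTerm (B := B) .p)) (φ : M.M.Assign), M.prog i P φ =
      (P.map fun D => M.U i D φ).foldl (fun d x => M.M.bin .andP d x) M.M.topP := fun P φ => by
    rw [List.foldl_map, prog]
  rw [key, key, h]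

theorem state_apply {s : State B} (hs : s.Valid) {γ : Subst B} (hγ : γ.Legal) (φ : M.M.Assign) :
    M.state (s.apply γ) φ = M.state s (M.sub γ φ) := by
  simp only [state, State.apply]
  rw [M.U_apply hs.2 hγ.2, M.prog_congr s.idx (P' := s.prog) (φ' := M.sub γ φ)]
  rw [List.map_map]
  exact List.map_congr_left fun D hD => M.U_apply (hs.1 D hD) hγ.2 φ

theorem vector_apply {A : StateVector B} (hA : A.Valid) {γ : Subst B} (hγ : γ.Legal)
    (φ : M.M.Assign) : M.vector (A.apply γ) φ = M.vector A (M.sub γ φ) := by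
  induction A with
  | nil => rfl
  | cons s A ih =>
    rw [StateVector.apply_cons, vector_cons, vector_cons, ih fun s hs => hA s (.tail _ hs),
      M.state_apply (hA s (.head _)) hγ]

/-! ### Ground steps decrease truth values -/

/-- The value of the clause with body `G` and head `A`. -/
def clause (i : ℕ) (G : Option (CTerm (B := B) .g)) (A : CTerm (B := B) .r) (φ : M.M.Assign) :
    M.M.D i .p :=
  match G with
  | none => M.M.incl .rp (M.U i A φ)
  | some G => M.M.bin .impP (M.U i G φ) (M.U i A φ)

theorem U_bin {i : ℕ} {α β τ : Ty B} (k : LCon (.arr α (.arr β τ))) {q : CTerm α} {r : CTerm β}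
    (hq : q.LevelLE i) (hr : r.LevelLE i) (φ : M.M.Assign) :
    M.U i (Term.app (Term.app (Term.lcon k) q) r) φ = M.M.bin k (M.U i q φ) (M.U i r φ) := by
  rw [M.U_app _ _ φ ((Term.levelLE_lcon i k).app hq) hr, M.U_app _ _ φ (Term.levelLE_lcon i k) hq,
    M.U_lcon]
  rfl

theorem U_rigid {i : ℕ} {A : CTerm (B := B) .r} (hA : A.LevelLE i) (φ : M.M.Assign) :
    M.U i (Term.rigid A) φ = M.M.rigid (M.U i A φ) := by
  rw [Term.rigid, M.U_inc _ _ φ ((hA.inc _).inc _), M.U_inc _ _ φ (hA.inc _), M.U_inc _ _ φ hA]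
  rfl

/-- Follows the elaboration: a conjunct lies below a conjunction by `le_and` and `and_comm`, and an
instance lies below a quantified program by `app_le_pi` at the value of the instantiating term. -/
theorem clause_le {T : Set (ACon B)} {i : ℕ} (φ : M.M.Assign) {Γ : List (Ty B)} {D : Term Γ .p}
    {K : Clause Γ} (h : InElaboration i D K) : ∀ {e : Env CTerm Γ}
    {G : Option (CTerm (B := B) .g)} {A : CTerm (B := B) .r},
    (∀ σ (y : Vr Γ σ), y.LevelLE i → (e.sub σ y).LevelLE i) → InstAt T i e K G A →
      M.M.le (M.clause i G A φ) (M.U i (D.close e) φ) := by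
  induction h with
  | fact hA =>
    intro e G A he h
    cases h
    rw [Term.close_inc, M.U_inc _ _ φ (hA.close he)]
    exact M.M.le_refl _
  | rule hG hA =>
    intro e G A he h
    cases h
    rw [Term.impP, Term.close_app, Term.close_app, Term.close_lcon,
      M.U_bin _ (hG.close he) (hA.close he)]
    exact M.M.le_refl _
  | left hD hK ih =>
    intro e G A he h
    rw [Term.andP, Term.close_app, Term.close_app, Term.close_lcon,
      M.U_bin _ (hK.levelLE.close he) (hD.close he)]
    exact M.M.le_trans _ _ _ (ih he h) (M.M.le_and _ _)
  | right hD hK ih =>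
    intro e G A he h
    rw [Term.andP, Term.close_app, Term.close_app, Term.close_lcon,
      M.U_bin _ (hD.close he) (hK.levelLE.close he)]
    exact M.M.le_trans _ _ _ (ih he h)
      (M.M.le_trans _ _ _ (M.M.le_and _ _) (M.M.and_comm _ _))
  | all hα hK ih =>
    intro e G A he h
    cases h with
    | @all _ _ _ _ _ t _ _ ht _ h =>
      rw [Term.allP, Term.close_app, Term.close_lcon, M.U_app _ _ φ (Term.levelLE_lcon i _)
        ((hK.levelLE.lam hα).close he), M.U_lcon]
      refine M.M.le_trans _ _ _ (ih (fun σ y hy => ?_) h) ?_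
      · cases y with
        | zero => exact ht
        | succ y => exact he _ y hy
      · rw [← Term.app_close_lam e hα, M.U_app _ _ φ ((hK.levelLE.lam hα).close he) ht]
        exact M.M.app_le_pi hα _ _

theorem le_prog {i : ℕ} {P : List (CTerm (B := B) .p)} {D : CTerm (B := B) .p} (hD : D ∈ P)
    (φ : M.M.Assign) : M.M.le (M.U i D φ) (M.prog i P φ) := by
  induction P using List.reverseRecOn with
  | nil => exact (List.not_mem_nil hD).elim
  | append_singleton P D' ih =>
    rw [prog_append]
    rcases List.mem_append.1 hD with h | h
    · exact M.M.le_trans _ _ _ (ih h) (M.M.le_and _ _)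
    · rw [List.mem_singleton.1 h]
      exact M.M.le_trans _ _ _ (M.M.le_and _ _) (M.M.and_comm _ _)

/-- Each rule corresponds to an axiom of valuations; clauses reach the program through `clause_le`
and `le_prog`. The empty set of new constants excludes Generic, whose premise concerns one element
only and gives no lower bound for a meet. -/
theorem vector_le_state {T : Set (ACon B)} {s : State B} {ss : List (State B)}
    (h : Ground T s ss ∅) (φ : M.M.Assign) : M.vector ss φ ≤ M.state s φ := by
  have hnil : ∀ (i : ℕ) (σ : Ty B) (y : Vr [] σ), y.LevelLE i →
      ((Env.nil : Env CTerm []).sub σ y).LevelLE i := fun i σ y hy => by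
    rw [Env.sub_nil]
    exact Term.levelLE_var hy
  generalize hK : (∅ : Set (ACon B)) = K at h
  cases h with
  | stay => exact (M.vector_singleton s φ).le
  | null i P =>
    change ⊤ ≤ M.val.I i (M.prog i P φ) (M.U i (Term.lcon .topG) φ)
    rw [M.U_lcon, M.val.top]
  | backchain i P hA hD hE hI =>
    rw [vector_singleton]
    simp only [state]
    rw [M.U_rigid hA]
    refine M.val.backchain _ _ _ (M.M.le_trans _ _ _ ?_ (M.le_prog hD φ))
    have := M.clause_le φ hE (hnil i) hI
    rwa [Term.close_nil] at this
  | axm i P hA hD hE hI =>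
    change ⊤ ≤ M.val.I i (M.prog i P φ) (M.U i (Term.rigid _) φ)
    rw [M.U_rigid hA, ← M.val.atom]
    refine M.val.inclusion _ _ _ (M.M.le_trans _ _ _ ?_ (M.le_prog hD φ))
    have := M.clause_le φ hE (hnil i) hI
    rwa [Term.close_nil] at this
  | orLeft i P hG hG' =>
    rw [vector_singleton]
    simp only [state]
    rw [Term.orG, M.U_bin _ hG hG', M.val.or]
    exact le_sup_left
  | orRight i P hG hG' =>
    rw [vector_singleton]
    simp only [state]
    rw [Term.orG, M.U_bin _ hG hG', M.val.or]
    exact le_sup_right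
  | and i P hG hG' =>
    rw [vector_cons, vector_singleton]
    simp only [state]
    rw [Term.andG, M.U_bin _ hG hG', M.val.and]
  | instance_ i P hα hG ht =>
    rw [vector_singleton]
    simp only [state]
    rw [Term.exG, M.U_app _ _ φ (Term.levelLE_lcon i _) (hG.lam hα), M.U_lcon,
      ← Term.beta hα, M.U_app _ _ φ (hG.lam hα) ht]
    exact (M.val.ex hα _ _).1 ⟨_, rfl⟩
  | augment i P hD hG =>
    rw [vector_singleton]
    simp only [state]
    rw [Term.impG, M.U_bin _ hD hG, M.val.imp, prog_append]
  | generic => exact ((Set.singleton_ne_empty _) hK.symm).elim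

theorem vector_le_of_step {ρ : Rule} {V W : Set (AVar B)} {C K : Set (ACon B)}
    {A A' : StateVector B} {γ : Subst B} (h : Step ρ V C A γ A' W K) (hρ : ρ ≠ .generic)
    (hA : A.Valid) (φ : M.M.Assign) : M.vector A' φ ≤ M.vector (A.apply γ) φ := by
  have hK : K = ∅ := by
    cases h <;> first | rfl | exact (hρ rfl).elim
  subst hK
  obtain ⟨L, R, s, ss, hγ, rfl, hg⟩ := h.ground hA
  rw [hγ, List.append_assoc, vector_append, vector_append, vector_append, vector_cons]
  exact inf_le_inf_left _ (inf_le_inf_right _ (M.vector_le_state hg φ))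

/-- The substitution of the last step is absorbed into the assignment by `vector_apply`, which is
why the induction needs all `φ`. -/
theorem vector_le_of_res {A A' : StateVector B} {η : Subst B} {V : Set (AVar B)}
    {C N : Set (ACon B)} (h : Res {ρ | ρ ≠ Rule.generic} A η A' V C N) (hA : A.Valid) :
    ∀ φ : M.M.Assign, M.vector A' φ ≤ M.vector (A.apply η) φ := by
  induction h with
  | refl => intro φ; rw [StateVector.apply_id]
  | step hr hρ hs ih =>
    intro φ
    refine (M.vector_le_of_step hs hρ (hr.valid hA) φ).trans ?_
    rw [StateVector.apply_comp, M.vector_apply (hr.valid hA) hs.legal,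
      M.vector_apply (hA.apply hr.legal) hs.legal]
    exact ih _

end UniformAlgebra

end Semantics


section Pullback

variable {B : Type u} {Ω : Type w} [DistribLattice Ω] [OrderTop Ω]

/-! ### Change of levels -/

/-- The structure whose carriers of level `j` are those of level `s j` of `M`, with new values for
the constants. -/
def UniformStructure.pullback (M : UniformStructure.{u, v} B) {s : ℕ → ℕ} (hs : Monotone s)
    (κ : ∀ {τ : Ty B} (c : Con τ), M.D (s c.level) τ) : UniformStructure.{u, v} B where
  D j τ := M.D (s j) τ
  app := M.app
  ext := M.ext
  const c := κ c
  lconst k := M.lc k (s 0)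
  lift hij := M.lift (hs hij)
  lift_refl d := M.lift_refl d
  lift_trans hij hjk d := M.lift_trans (hs hij) (hs hjk) d
  lift_injective hij := M.lift_injective (hs hij)
  lift_app hij f d := M.lift_app (hs hij) f d
  incl := M.incl
  incl_injective := M.incl_injective
  le := M.le
  le_refl := M.le_refl
  le_trans := M.le_trans
  topP := M.topP
  top_and p := by rw [UniformStructure.lc, M.lift_trans]; exact M.top_and p
  and_top p := by rw [UniformStructure.lc, M.lift_trans]; exact M.and_top p
  le_and p q := by rw [UniformStructure.lc, M.lift_trans]; exact M.le_and p q
  and_comm p q := by rw [UniformStructure.lc, M.lift_trans]; exact M.and_comm p q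
  app_le_pi hα f d := by rw [UniformStructure.lc, M.lift_trans]; exact M.app_le_pi hα f d

variable {M : UniformStructure.{u, v} B} {s : ℕ → ℕ} {hs : Monotone s}
  {κ : ∀ {τ : Ty B} (c : Con τ), M.D (s c.level) τ}

theorem UniformStructure.lc_pullback {τ : Ty B} (k : LCon τ) (j : ℕ) :
    (M.pullback hs κ).lc k j = M.lc k (s j) := M.lift_trans _ _ _

theorem UniformStructure.bin_pullback {j : ℕ} {α β τ : Ty B} (k : LCon (.arr α (.arr β τ)))
    (x : M.D (s j) α) (y : M.D (s j) β) :
    (M.pullback hs κ).bin (i := j) k x y = M.bin (i := s j) k x y := by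
  exact congrArg (fun f => M.app (M.app f x) y) (UniformStructure.lc_pullback k j)

/-- A monotone change of levels may stand still or jump, so monotonicity is needed between arbitrary
levels. -/
theorem Valuation.le_lift (I : Valuation M Ω) {i j : ℕ} (hij : i ≤ j) (p : M.D i .p)
    (g : M.D i .g) : I.I i p g ≤ I.I j (M.lift hij p) (M.lift hij g) := by
  induction j, hij using Nat.le_induction with
  | base => rw [M.lift_refl, M.lift_refl]
  | succ j hij ih =>
    refine ih.trans ((I.mono _ _).trans ?_)
    rw [M.lift_trans, M.lift_trans]

def Valuation.pullback (I : Valuation M Ω) : Valuation (M.pullback hs κ) Ω where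
  I j := I.I (s j)
  atom x := I.atom x
  mono p g := I.le_lift (hs (Nat.le_succ _)) p g
  top p := by rw [UniformStructure.lc_pullback]; exact I.top p
  and p g g' := (congrArg (I.I _ p) (UniformStructure.bin_pullback _ g g')).trans (I.and p g g')
  or p g g' := (congrArg (I.I _ p) (UniformStructure.bin_pullback _ g g')).trans (I.or p g g')
  imp p q g := (congrArg (I.I _ p) (UniformStructure.bin_pullback _ q g)).trans ((I.imp p q g).trans
    (congrArg (fun x => I.I _ x g) (UniformStructure.bin_pullback _ p q).symm))
  ex hα p f := by rw [UniformStructure.lc_pullback]; exact I.ex hα p f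
  all hα p f := by rw [UniformStructure.lc_pullback]; exact I.all hα p f
  inclusion p p' g := I.inclusion p p' g
  backchain p g x h := I.backchain p g x
    (Eq.subst (motive := fun q => M.le q p) (UniformStructure.bin_pullback _ g x) h)

/-- An injective renaming of the logic variables that changes levels according to `s`; index `0`
is not used. -/
def relevel (s : ℕ → ℕ) (τ : Ty B) (x : LVar τ) : LVar τ :=
  ⟨s x.level, Nat.pair x.level x.idx + 1, x.ok⟩

/-- Since `s` may identify levels, the new index encodes the old level together with the old index.
-/
theorem relevel_injective (s : ℕ → ℕ) (τ : Ty B) : Function.Injective (relevel s τ) := by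
  rintro ⟨l, n, h⟩ ⟨l', n', h'⟩ heq
  simp only [relevel, LVar.mk.injEq, Nat.add_right_cancel_iff, Nat.pair_eq_pair] at heq
  rw [LVar.mk.injEq]
  exact heq.2

open Classical in
/-- The assignment in `M` induced by an assignment with values at changed levels; `ψ` is used for
the other variables. -/
noncomputable def extendAssign (s : ℕ → ℕ) (ψ : M.Assign)
    (φ : ∀ (τ : Ty B) (x : LVar τ), M.D (s x.level) τ) : M.Assign := fun τ z =>
  if h : ∃ x, relevel s τ x = z then h.choose_spec ▸ φ τ h.choose else ψ τ z

theorem extendAssign_relevel (ψ : M.Assign) (φ : ∀ (τ : Ty B) (x : LVar τ), M.D (s x.level) τ)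
    {τ : Ty B} (x : LVar τ) : extendAssign s ψ φ τ (relevel s τ x) = φ τ x := by
  have h : ∃ x', relevel s τ x' = relevel s τ x := ⟨x, rfl⟩
  -- For a variable preimage `x'` the transport disappears once injectivity identifies `x'` with
  -- `x`.
  have key : ∀ (x' : LVar τ) (h : relevel s τ x' = relevel s τ x),
      (h ▸ φ τ x' : M.D (relevel s τ x).level τ) = φ τ x := by
    intro x' h
    obtain rfl := relevel_injective s τ h
    rfl
  exact (dif_pos h).trans (key _ _)

theorem extendAssign_of_ne (ψ : M.Assign) (φ : ∀ (τ : Ty B) (x : LVar τ), M.D (s x.level) τ)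
    {τ : Ty B} {z : LVar τ} (hz : ∀ x, relevel s τ x ≠ z) : extendAssign s ψ φ τ z = ψ τ z :=
  dif_neg fun ⟨x, hx⟩ => hz x hx

namespace UniformAlgebra

/-- The uniform algebra in which a term at level `j` takes the value in `M` at level `s j` of the
term with constants replaced by `κ` and variables renamed by `relevel`. -/
noncomputable def pullback (M : UniformAlgebra.{u, v, w} B Ω) {s : ℕ → ℕ} (hs : Monotone s)
    (κ : ∀ τ : Ty B, Con τ → CTerm τ) (ψ : M.M.Assign)
    (hκ : ∀ (τ : Ty B) (c : Con τ), ∃ t, Term.mk t = κ τ c ∧ t.LevelLE (s c.level) ∧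
      ∀ (σ : Ty B) (x : LVar σ), ¬ t.HasVar ⟨σ, relevel s σ x⟩) :
    UniformAlgebra.{u, v, w} B Ω :=
  have hκl : ∀ (i : ℕ) (τ : Ty B) (c : Con τ), c.level ≤ i → (κ τ c).LevelLE (s i) :=
    fun i τ c hc => by
      obtain ⟨t, ht, hl, -⟩ := hκ τ c
      exact ⟨t, ht, hl.mono (hs hc)⟩
  have hνl : ∀ (i : ℕ) (τ : Ty B) (x : LVar τ), x.level ≤ i →
      (Subst.ofRen (relevel s) τ x).LevelLE (s i) := fun i τ x hx => Term.levelLE_var (hs hx)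
  { M := M.M.pullback hs fun {τ} c => M.U (s c.level) (κ τ c) ψ
    val := M.val.pullback
    U := fun {τ} j q φ => M.U (s j) (q.tr κ (Subst.ofRen (relevel s))) (extendAssign s ψ φ)
    U_lift := fun {τ i j} hij t φ ht => M.U_lift (hs hij) _ _ (ht.tr (hκl i) (hνl i))
    U_var := fun {τ i} x φ hx => by
      rw [Term.tr_free]
      exact (M.U_var (relevel s τ x) (extendAssign s ψ φ) (hs hx)).trans
        (congrArg (M.M.lift (hs hx)) (extendAssign_relevel ψ φ x))
    U_con := fun {τ i} c φ hc => by
      obtain ⟨t, ht, hl, hv⟩ := hκ τ c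
      rw [Term.tr_con, M.U_lift (hs hc) _ _ ⟨t, ht, hl⟩]
      -- The two assignments differ only at renamed variables, which `κ` avoids; so the value of a
      -- constant does not depend on `φ`.
      have h : M.U (s c.level) (κ τ c) (extendAssign s ψ φ) = M.U (s c.level) (κ τ c) ψ := by
        rw [← ht]
        refine M.U_congr_of_hasVar t hl fun x hx => extendAssign_of_ne ψ φ fun y hy => ?_
        refine hv x.1 y ?_
        rw [hy]
        exact hx
      exact congrArg (M.M.lift (hs hc)) h
    U_lcon := fun {τ i} k φ => by
      rw [Term.tr_lcon, UniformStructure.lc_pullback]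
      exact M.U_lcon k _
    U_inc := fun {σ τ i} e t φ ht => by
      rw [Term.tr_inc]
      exact M.U_inc e _ _ (ht.tr (hκl i) (hνl i))
    U_app := fun {α β i} t r φ ht hr => by
      rw [Term.tr_app]
      exact M.U_app _ _ _ (ht.tr (hκl i) (hνl i)) (hr.tr (hκl i) (hνl i))
    U_lam := fun {α β i} hα t n φ φ' ht hfv hφ => by
      rw [Term.tr_lam, Term.tr_inst, Term.tr_free]
      -- The level and index used here are those of the renamed variable `relevel s α ⟨i, n, hα⟩`.
      have h := M.U_lam (i := s i) hα (t.tr κ (Subst.ofRen (relevel s))) (Nat.pair i n + 1)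
        (extendAssign s ψ φ) (extendAssign s ψ φ') (ht.tr (hκl i) (hνl i)) ?_ ?_
      · have hy : extendAssign s ψ φ' α ⟨s i, Nat.pair i n + 1, hα⟩ = φ' α ⟨i, n, hα⟩ :=
          extendAssign_relevel ψ φ' (⟨i, n, hα⟩ : LVar α)
        rw [hy] at h
        exact h
      · intro hmem
        obtain ⟨t₀, rfl, ht₀⟩ : ∃ t₀, Term.mk t₀ = t ∧ ¬ t₀.HasVar ⟨α, ⟨i, n, hα⟩⟩ := by
          simpa [Term.fv] using hfv
        choose κ₀ hκ₁ _ hκ₃ using hκ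
        have h := hmem _ (Term.tr_mk (κ := κ) (ν := Subst.ofRen (relevel s))
          (ν₀ := fun τ x => .var (.free (relevel s τ x))) hκ₁ (fun _ _ => rfl) t₀).symm
        rcases Tm.hasVar_tr t₀ h with ⟨⟨τ, z⟩, hz, hzx⟩ | ⟨c, -, hc⟩
        · have hzx' : (⟨τ, relevel s τ z⟩ : AVar B) = ⟨α, relevel s α ⟨i, n, hα⟩⟩ := hzx
          obtain ⟨rfl, hzx'⟩ := Sigma.mk.inj_iff.1 hzx'
          rw [relevel_injective s τ (eq_of_heq hzx')] at hz
          exact ht₀ hz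
        · exact hκ₃ c.1 c.2 α ⟨i, n, hα⟩ hc
      · rintro ⟨τ, x⟩ hx
        by_cases h : ∃ z, relevel s τ z = x
        · obtain ⟨z, rfl⟩ := h
          refine (extendAssign_relevel ψ φ' z).trans ((hφ ⟨τ, z⟩ ?_).trans
            (extendAssign_relevel ψ φ z).symm)
          intro hz
          cases hz
          exact hx rfl
        · simp only [not_exists] at h
          exact (extendAssign_of_ne ψ φ' h).trans (extendAssign_of_ne ψ φ h).symm }

end UniformAlgebra

/-- The structural induction behind soundness of the rule for universal goals: validity of a
generic instance in all uniform algebras implies validity of the universal goal. -/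
theorem state_allG_eq_top {i : ℕ} {P : List (CTerm (B := B) .p)} {α : Ty B} (hα : α.VarTy)
    {G : Term [α] .g} {c : Con α} (hP : ∀ D ∈ P, D.LevelLE i) (hG : G.LevelLE i)
    (hc : c.level = i + 1)
    (h : ∀ (M : UniformAlgebra.{u, v, w} B Ω) (φ : M.M.Assign),
      M.state ⟨i + 1, P, G.inst (Term.con c)⟩ φ = ⊤)
    (M : UniformAlgebra.{u, v, w} B Ω) (φ : M.M.Assign) :
    M.state ⟨i, P, Term.allG hα G⟩ φ = ⊤ := by
  classical
  simp only [UniformAlgebra.state]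
  rw [Term.allG, M.U_app _ _ φ (Term.levelLE_lcon i _) (hG.lam hα), M.U_lcon]
  refine top_unique ((M.val.all hα _ _).2 ?_)
  rintro _ ⟨d, rfl⟩
  refine le_of_eq (Eq.symm ?_)
  -- Levels up to `i` are kept and level `i + 1` is collapsed onto `i`; so `c` may denote `d`,
  -- although `d` has only level `i`.
  let s : ℕ → ℕ := fun j => if j ≤ i then j else j - 1
  have hs : Monotone s := by
    intro j k hjk
    simp only [s]
    split_ifs <;> omega
  have hs₁ : ∀ j ≤ i, s j = j := fun j hj => if_pos hj
  have hs₂ : s (i + 1) = i := if_neg (by omega)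
  -- Index `0` is outside the range of `relevel`, so `y` can serve as a name for `d`.
  let y : LVar α := ⟨i, 0, hα⟩
  -- Constants other than `c` above level `i` play no role in `P` and `G`; a constant of level `0`
  -- is a value admissible at every level.
  obtain ⟨κ, hκc, hκ⟩ : ∃ κ : ∀ τ : Ty B, Con τ → CTerm τ, κ α c = Term.var (.free y) ∧
      ∀ τ e, (⟨τ, e⟩ : ACon B) ≠ ⟨α, c⟩ →
        κ τ e = Term.con (if e.level ≤ i then e else ⟨0, 0, e.ok⟩) :=
    ⟨fun τ e => Function.update (β := fun a : ACon B => CTerm a.1)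
      (fun a => Term.con (if a.2.level ≤ i then a.2 else ⟨0, 0, a.2.ok⟩)) ⟨α, c⟩
        (Term.var (.free y)) ⟨τ, e⟩, Function.update_self .., fun τ e h =>
        Function.update_of_ne (β := fun a : ACon B => CTerm a.1) h ..⟩
  have hκl : ∀ τ (e : Con τ), e.level ≤ i → κ τ e = Term.con e := by
    intro τ e he
    rw [hκ, if_pos he]
    rintro ⟨⟩
    omega
  have hκ' : ∀ (τ : Ty B) (c : Con τ), ∃ t, Term.mk t = κ τ c ∧ t.LevelLE (s c.level) ∧
      ∀ (σ : Ty B) (x : LVar σ), ¬ t.HasVar ⟨σ, relevel s σ x⟩ := by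
    intro τ e
    by_cases he : (⟨τ, e⟩ : ACon B) = ⟨α, c⟩
    · cases he
      refine ⟨.var (.free y), hκc.symm, ?_, ?_⟩
      · change i ≤ s c.level
        rw [hc, hs₂]
      · intro σ x hx
        have hx' : (⟨α, y⟩ : AVar B) = ⟨σ, relevel s σ x⟩ := hx
        obtain ⟨rfl, hx'⟩ := Sigma.mk.inj_iff.1 hx'
        exact absurd (congrArg LVar.idx (eq_of_heq hx')).symm (Nat.succ_ne_zero _)
    · refine ⟨.con (if e.level ≤ i then e else ⟨0, 0, e.ok⟩), (hκ τ e he).symm, ?_,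
        fun σ x hx => hx⟩
      change Con.level (if e.level ≤ i then e else ⟨0, 0, e.ok⟩) ≤ s e.level
      split_ifs with hei
      · rw [hs₁ _ hei]
      · exact Nat.zero_le _
  let ψ : M.M.Assign := UniformStructure.Assign.update φ y d
  -- Up to level `i` this is `φ`; above it, any element of the right carrier will do, and `ψ`
  -- provides one.
  let φ' : ∀ (τ : Ty B) (x : LVar τ), M.M.D (s x.level) τ := fun τ x =>
    if hx : x.level ≤ i then M.M.lift (hs₁ _ hx).ge (φ τ x) else ψ τ ⟨s x.level, 0, x.ok⟩
  have hval := h (M.pullback hs κ ψ hκ') φ'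
  let χ : M.M.Assign := extendAssign s ψ φ'
  let T : ∀ {Γ : List (Ty B)} {τ : Ty B}, Term Γ τ → Term Γ τ := fun q =>
    q.tr κ (Subst.ofRen (relevel s))
  -- The equation `s (i + 1) = i` does not hold by computation and carriers depend on it, so the
  -- level is first generalised to `k`.
  have hval' : ∀ k, s (i + 1) = k → M.val.I k (M.prog k (P.map T) χ)
      (M.U k (T (G.inst (Term.con c))) χ) = ⊤ := by
    rintro _ rfl
    refine Eq.trans ?_ hval
    refine congrArg (fun p => M.val.I (s (i + 1)) p _) ?_
    simp only [UniformAlgebra.prog, List.foldl_map]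
    refine congrFun (congrFun (congrArg _ ?_) _) _
    funext p D
    exact (UniformStructure.bin_pullback _ _ _).symm
  have hval := hval' i hs₂
  -- On terms of level at most `i`, the translation only renames variables, and `χ` compensates for
  -- this. Cutting the renaming off above level `i` makes it level-preserving, as `U_apply`
  -- requires.
  have hT : ∀ {τ : Ty B} (q : CTerm τ), q.LevelLE i → M.U i (T q) χ = M.U i q φ := by
    intro τ q hq
    let ν : Subst B := fun τ x =>
      if x.level ≤ i then Subst.ofRen (relevel s) τ x else Term.var (.free x)
    have hν : ∀ (τ : Ty B) (x : LVar τ), (ν τ x).LevelLE x.level := by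
      intro τ x
      dsimp only [ν]
      split_ifs with hx
      · exact Term.levelLE_var (hs₁ _ hx).le
      · exact Term.levelLE_var le_rfl
    have h₁ : T q = ν.apply q := by
      rw [Subst.apply_eq_tr]
      exact hq.tr_congr hκl fun σ x hx => (if_pos hx).symm
    rw [h₁, M.U_apply hq hν]
    refine M.U_congr hq fun τ x hx => ?_
    simp only [UniformAlgebra.sub, ν, if_pos hx]
    refine (M.U_var (relevel s τ x) χ (hs₁ _ hx).le).trans ?_
    have h₂ : χ τ (relevel s τ x) = M.M.lift (hs₁ _ hx).ge (φ τ x) :=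
      (extendAssign_relevel ψ φ' x).trans (dif_pos hx)
    rw [h₂]
    exact (M.M.lift_trans _ _ _).trans (M.M.lift_refl _)
  have hprog : M.prog i (P.map T) χ = M.prog i P φ := by
    refine M.prog_congr i ?_
    rw [List.map_map]
    exact List.map_congr_left fun D hD => hT D (hP D hD)
  -- The translation turns the generic instance into the abstraction applied to `y`, and `χ` gives
  -- `y` the value `d`.
  have hgoal : M.U i (T (G.inst (Term.con c))) χ = M.M.app (M.U i (Term.lam hα G) φ) d := by
    have h₁ : T (G.inst (Term.con c)) = Term.app (T (Term.lam hα G)) (Term.var (.free y)) := by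
      simp only [T]
      rw [Term.tr_inst, Term.tr_con, hκc, Term.tr_lam, Term.beta]
    have hlev : (T (Term.lam hα G)).LevelLE i := (hG.lam hα).tr
      (fun σ e he => by rw [hκl σ e he]; exact Term.levelLE_con he)
      (fun σ x hx => Term.levelLE_var ((hs₁ _ hx).le.trans hx))
    have h₂ : χ α y = d := by
      refine (extendAssign_of_ne ψ φ' ?_).trans (UniformStructure.Assign.update_self φ y d)
      intro x hx
      exact absurd (congrArg LVar.idx hx) (Nat.succ_ne_zero _)
    rw [h₁, M.U_app _ _ χ hlev (Term.levelLE_var le_rfl), hT _ (hG.lam hα)]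
    refine congrArg _ ((M.U_var y χ le_rfl).trans ?_)
    rw [h₂, M.M.lift_refl]
  rw [hprog, hgoal] at hval
  exact hval

/-! ### Soundness along resolutions. -/

theorem state_eq_top_of_ground {T K : Set (ACon B)} {s : State B} {ss : List (State B)}
    (hg : Ground T s ss K)
    (h : ∀ (M : UniformAlgebra.{u, v, w} B Ω) (φ : M.M.Assign), M.vector ss φ = ⊤)
    (M : UniformAlgebra.{u, v, w} B Ω) (φ : M.M.Assign) : M.state s φ = ⊤ := by
  by_cases hK : K = ∅
  · subst hK
    exact top_unique ((h M φ).ge.trans (M.vector_le_state hg φ))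
  · cases hg with
    | generic i P hα hP hG hc =>
      refine state_allG_eq_top hα hP hG hc (fun M φ => ?_) M φ
      rw [← M.vector_singleton]
      exact h M φ
    | _ => exact absurd rfl hK

/-- The backward induction of `Res.provable`, with truth in all uniform algebras in place of
provability. The algebra must stay quantified in the induction, because Generic passes to a
different one. -/
theorem vector_eq_top_of_res {S : Set Rule} {A A' : StateVector B} {η : Subst B}
    {V : Set (AVar B)} {C N : Set (ACon B)} (hr : Res S A η A' V C N) (hA : A.Valid) :
    ∀ {ζ : Subst B}, ζ.Legal →
      (∀ (M : UniformAlgebra.{u, v, w} B Ω) (φ : M.M.Assign), M.vector (A'.apply ζ) φ = ⊤) →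
      ∀ (M : UniformAlgebra.{u, v, w} B Ω) (φ : M.M.Assign),
        M.vector (A.apply (η.comp ζ)) φ = ⊤ := by
  induction hr with
  | refl => intro ζ _ h; rwa [Subst.id_comp]
  | @step η γ A' A'' V W C N K ρ hr _ hs ih =>
    intro ζ hζ h
    have hassoc : (η.comp γ).comp ζ = η.comp (γ.comp ζ) := by
      funext τ x
      exact (Subst.apply_comp γ ζ (η τ x)).symm
    rw [hassoc]
    refine ih (hs.legal.comp hζ) ?_
    obtain ⟨L, R, s, ss, hγ, rfl, hg⟩ := hs.ground (hr.valid hA)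
    simp only [StateVector.apply_append, UniformAlgebra.vector_append, inf_eq_top_iff] at h
    intro M φ
    rw [StateVector.apply_comp, hγ, StateVector.apply_append, StateVector.apply_cons,
      M.vector_append, M.vector_cons, inf_eq_top_iff, inf_eq_top_iff]
    exact ⟨(h M φ).1.1, state_eq_top_of_ground
      (hg.apply (T' := Set.univ) hζ fun _ _ _ => Set.subset_univ _)
      (fun M φ => (h M φ).1.2) M φ, (h M φ).2⟩

theorem vector_eq_top_of_derives {S : Set Rule} {A A' : StateVector B} {θ : Subst B}
    (hA : A.Valid) (hr : Derives S A θ A')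
    (h : ∀ (M : UniformAlgebra.{u, v, w} B Ω) (φ : M.M.Assign), M.vector A' φ = ⊤)
    (M : UniformAlgebra.{u, v, w} B Ω) (φ : M.M.Assign) : M.vector (A.apply θ) φ = ⊤ := by
  obtain ⟨N, η, V, C, hr, rfl⟩ := hr
  rw [StateVector.apply_restrict, ← Subst.comp_id η]
  refine vector_eq_top_of_res hr hA Subst.legal_id (fun M φ => ?_) M φ
  rw [StateVector.apply_id]
  exact h M φ

end Pullback

end UCTT

theorem mainTheorem10 {B : Type u} :
    -- Soundness: truth in all uniform algebras is preserved backwards along enriched resolutions.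
    (∀ (A A' : StateVector B) (θ : Subst B), A.Valid → Derives enriched A θ A' →
      ∀ (Ω : Type w) [DistribLattice Ω] [OrderTop Ω],
        (∀ (M : UniformAlgebra.{u, v, w} B Ω) (φ : M.M.Assign), M.vector A' φ = ⊤) →
        ∀ (M : UniformAlgebra.{u, v, w} B Ω) (φ : M.M.Assign), M.vector (A.apply θ) φ = ⊤) ∧
    -- Soundness of successful enriched resolutions.
    (∀ (A : StateVector B) (θ : Subst B), A.Valid → Derives enriched A θ [] →
      ∀ (Ω : Type w) [DistribLattice Ω] [OrderTop Ω] (M : UniformAlgebra.{u, v, w} B Ω)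
        (φ : M.M.Assign), M.vector (A.apply θ) φ = ⊤) ∧
    -- Soundness, locally in each uniform algebra, of enriched resolutions without generic steps.
    (∀ (A A' : StateVector B) (θ : Subst B), A.Valid →
      Derives {ρ | ρ ≠ Rule.generic} A θ A' →
      ∀ (Ω : Type w) [DistribLattice Ω] [OrderTop Ω] (M : UniformAlgebra.{u, v, w} B Ω)
        (φ : M.M.Assign), M.vector A' φ ≤ M.vector (A.apply θ) φ) ∧
    -- Conservativity over ordinary resolution.
    (∀ A : StateVector B, A.Valid → Derives enriched A Subst.id [] →
      Derives ordinary A Subst.id []) ∧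
    -- Lifting.
    (∀ (A A' : StateVector B) (θ φ : Subst B) (N : Set (ACon B)), A.Valid → θ.Legal →
      DerivesWith enriched (A.apply θ) φ A' N →
      A' = [] ∨ Disjoint N (A.oc ∪ (θ.restrict A.fv).oc) →
      Derives enriched A ((θ.comp φ).restrict A.fv) A') := by
  refine ⟨fun A A' θ hA h Ω _ _ hA' => vector_eq_top_of_derives hA h hA',
    fun A θ hA h Ω _ _ => vector_eq_top_of_derives hA h fun _ _ => rfl, ?_,
    fun A hA h => derives_ordinary_of_enriched hA h, ?_⟩
  · rintro A A' θ hA ⟨N, η, V, C, hr, rfl⟩ Ω _ _ M φ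
    rw [StateVector.apply_restrict]
    exact M.vector_le_of_res hr hA φ
  · intro A A' θ φ N hA hθ h hN
    -- For the null vector no condition on the generic constants is needed, as they can be chosen
    -- anew; a nonempty `A'` may contain them.
    by_cases hne : A' = []
    · subst hne
      exact derives_null_of_apply hA hθ ⟨N, h⟩
    · exact derives_of_apply hA hθ h hne (hN.resolve_left hne)
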